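/- Let $p$ be an odd prime. For a finite simple undirected graph $\Gamma$ with vertices $1,\dots,n$, let the \emph{H-algebra} $R^0(\Gamma)$ be the (non-unital, non-associative) $\mathbb Z/p^3\mathbb Z$-algebra with generators $v_i$ ($1\le i\le n$) and $a_{ij}$ ($1\le i<j\le n$) and relations $v_i^2=0$; $v_iv_j=a_{ij}=-v_jv_i$ for $i<j$; all products $a_{ij}v_k$, $v_ka_{ij}$, $a_{ij}a_{kl}$ are $0$; $p\,a_{ij}=0$ if $ij$ is an edge and $p^2a_{ij}=0$ if it is not. Let the \emph{H-group} $G(\Gamma)$ be the group with generators $g_i$ ($1\le i\le n$) and $a_{ij}$ ($i<j$) and relations $[g_i,g_j]=a_{ij}$ for $i<j$, all $a_{ij}$ central, $g_i^{p^3}=1$, $a_{ij}^{p}=1$ if $ij$ is an edge and $a_{ij}^{p^2}=1$ if it is not. Consider the following decision problems. - GI: given the adjacency matrices of two finite simple graphs, are the graphs isomorphic? - HAI: given two H-algebras, each by the additive orders and the products (as linear combinations of basis elements over $\mathbb Z/p^3\mathbb Z$) of the elements of its standard basis $\{v_i\}\cup\{a_{ij}\}$, listed in any order, are the algebras isomorphic?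 - HGI: given two H-groups, each by its standard generators and the defining relations above, with the generators numbered and the relators listed in any order, are the groups isomorphic? Let $\le^P_T$ denote polynomial-time Turing reducibility (by deterministic oracle machines, for fixed $p$). Then $$\mathrm{GI}\le^P_T \mathrm{HAI}\le^P_T\mathrm{HGI}\le^P_T\mathrm{GI},$$ and the three problems are pairwise polynomial-time Turing equivalent. Moreover: 1. (Graph to algebra.) $\Gamma_1\cong\Gamma_2$ if and only if $R^0(\Gamma_1)\cong R^0(\Gamma_2)$. For $\Gamma$ with $n$ vertices, the additive group of $R^0(\Gamma)$ is the direct sum of the cyclic groups generated by the elements of the standard basis, of order $p^3$ for $v_i$, $p$ for edges $a_{ij}$ and $p^2$ for non-edges $a_{ij}$; this basis has $n(n+1)/2\le n^2$ elements, that is $O(n^2)$. 2. (Algebra to group.) $R^0(\Gamma_1)\cong R^0(\Gamma_2)$ if and only if $G(\Gamma_1)\cong G(\Gamma_2)$. The group $G(\Gamma)$ is finite; its presentation has at most $n^2$ generators and at most $3n^4$ relators, each a word of length at most $p^3$. 3. (Group to multigraph.) For a finite group $G$ let $\Gamma(G)$ be the directed multigraph whose vertices are the elements and the ordered triples of elements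 of $G$, in which each triple $(u,v,w)$ receives one edge from $u$ and, if $uv=w$, two edges from $v$ and sends one edge to $w$, while if $uv\ne w$ it receives one edge from $v$ (multiplicities are added if $u=v$). Then finite groups $G,H$ are isomorphic if and only if $\Gamma(G)\cong\Gamma(H)$, and if $G$ has order $m$ then $\Gamma(G)$ has at most $2m^3$ vertices and at most $4m^3$ edges, that is size $O(m^3)$. -/

import Mathlib

universe u

/-! ## Oracle machines and polynomial-time Turing reducibility -/

/-- An oracle Turing machine with finitely many stacks (the multi-stack machines `Turing.TM2` of
Mathlib, extended by an oracle). Inputs are words over `A`, oracle queries are words over `Q`.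

* `inStack` holds the input word at the start, each letter `a` written as `inSym a`.
* When the label `ask` is reached, the word on `queryStack` (top first, each symbol `s` read as
  `querySym s`) is submitted to the oracle, and the machine moves, in one step, to label `onYes` or
  `onNo`. In all other labels the machine performs the statement `prog l`, as a `TM2` machine does.
* On halting, the machine accepts iff `accept` holds of its internal state. -/
structure OracleTM (A Q : Type) where
  /-- stack names -/
  K : Type
  /-- stack symbols -/
  Sym : Type
  /-- program labels -/
  Lab : Type
  /-- internal states -/
  St : Type
  [decK : DecidableEq K]
  [finK : Finite K]
  [finSym : Finite Sym]
  [finLab : Finite Lab]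
  [finSt : Finite St]
  inStack : K
  queryStack : K
  inSym : A → Sym
  querySym : Sym → Q
  start : Lab
  ask : Lab
  onYes : Lab
  onNo : Lab
  initSt : St
  accept : St → Bool
  prog : Lab → Turing.TM2.Stmt (fun _ : K => Sym) Lab St

namespace OracleTM

attribute [instance] OracleTM.decK

variable {A Q : Type}

/-- Configurations: current label (`none` when halted), internal state, contents of the stacks. -/
abbrev Cfg (M : OracleTM A Q) : Type := Turing.TM2.Cfg (fun _ : M.K => M.Sym) M.Lab M.St

/-- The initial configuration on input `w`. -/
def init (M : OracleTM A Q) (w : List A) : M.Cfg where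
  l := some M.start
  var := M.initSt
  stk := fun k => if k = M.inStack then w.map M.inSym else []

open Classical in
/-- One step of the machine `M` with oracle `O`; there is no further step after halting. -/
noncomputable def step (M : OracleTM A Q) (O : Set (List Q)) (c : M.Cfg) : Option M.Cfg :=
  if c.l = some M.ask then
    some { c with
      l := some (if (c.stk M.queryStack).map M.querySym ∈ O then M.onYes else M.onNo) }
  else Turing.TM2.step M.prog c

/-- `M` with oracle `O` halts on input `w` after at most `t` steps, and accepts iff `ans`. -/
def AnswersWithin (M : OracleTM A Q) (O : Set (List Q)) (w : List A) (t : ℕ) (ans : Prop) : Prop :=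
  ∃ c : M.Cfg, Nonempty (StateTransition.EvalsToInTime (M.step O) (M.init w) (some c) t) ∧
    c.l = none ∧ (M.accept c.var = true ↔ ans)

end OracleTM

/-- A decision problem whose instances are encoded as words over a finite alphabet. -/
structure DecisionProblem where
  Instance : Type
  Alphabet : Type
  [finAlphabet : Finite Alphabet]
  encode : Instance → List Alphabet
  encode_injective : Function.Injective encode
  Yes : Instance → Prop

/-- A set of words is an oracle for `P` if it answers every encoded instance of `P` correctly
(nothing is required of words that encode no instance). -/
def DecisionProblem.IsOracle (P : DecisionProblem) (O : Set (List P.Alphabet)) : Prop :=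
  ∀ y : P.Instance, P.encode y ∈ O ↔ P.Yes y

/-- Polynomial-time Turing reducibility: a single oracle machine decides `P` in polynomial time,
in the length of the encoded instance, with the help of any oracle for `Q`. -/
def PolyTimeTuringReducible (P Q : DecisionProblem) : Prop :=
  ∃ (M : OracleTM P.Alphabet Q.Alphabet) (T : Polynomial ℕ),
    ∀ O : Set (List Q.Alphabet), Q.IsOracle O → ∀ x : P.Instance,
      M.AnswersWithin O (P.encode x) (T.eval (P.encode x).length) (P.Yes x)

infix:50 " ≤ᴾₜ " => PolyTimeTuringReducible

/-- Polynomial-time Turing equivalence. -/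
def PolyTimeTuringEquiv (P Q : DecisionProblem) : Prop := P ≤ᴾₜ Q ∧ Q ≤ᴾₜ P

/-! ## Words encoding pairs and matrices -/

/-- Encoding of a pair of words, with a separating letter `none`. -/
def pairWord {A : Type} (w₁ w₂ : List A) : List (Option A) :=
  w₁.map some ++ none :: w₂.map some

theorem pairWord_inj {A : Type} {w₁ w₂ u₁ u₂ : List A} (h : pairWord w₁ w₂ = pairWord u₁ u₂) :
    w₁ = u₁ ∧ w₂ = u₂ := by
  induction w₁ generalizing u₁ with
  | nil =>
    cases u₁ with
    | nil =>
      refine ⟨rfl, ?_⟩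
      simp only [pairWord, List.map_nil, List.nil_append, List.cons.injEq, true_and] at h
      exact List.map_injective_iff.2 (Option.some_injective A) h
    | cons a u => simp [pairWord] at h
  | cons a w ih =>
    cases u₁ with
    | nil => simp [pairWord] at h
    | cons b u =>
      simp only [pairWord, List.map_cons, List.cons_append, List.cons.injEq,
        Option.some.injEq] at h
      obtain ⟨h1, h2⟩ := ih (u₁ := u) h.2
      exact ⟨by rw [h.1, h1], h2⟩

theorem flatMap_inj_of_length {X A : Type} (l : List X) (f g : X → List A)
    (hlen : ∀ x, (f x).length = (g x).length) (h : l.flatMap f = l.flatMap g) :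
    ∀ x ∈ l, f x = g x := by
  induction l with
  | nil => simp
  | cons a l ih =>
    simp only [List.flatMap_cons] at h
    obtain ⟨h1, h2⟩ := List.append_inj h (hlen a)
    intro x hx
    rcases List.mem_cons.1 hx with rfl | hx
    · exact h1
    · exact ih h2 x hx

/-- The problem of deciding whether two given objects are isomorphic. -/
def isoProblem (I A : Type) [Finite A] (enc : I → List A) (hinj : Function.Injective enc)
    (iso : I → I → Prop) : DecisionProblem where
  Instance := I × I
  Alphabet := Option A
  encode x := pairWord (enc x.1) (enc x.2)
  encode_injective := fun _ _ h =>
    Prod.ext (hinj (pairWord_inj h).1) (hinj (pairWord_inj h).2)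
  Yes x := iso x.1 x.2

/-! ## Graph isomorphism -/

/-- A finite simple undirected graph with vertices `0, …, n - 1`. -/
abbrev FinGraph : Type := Σ n : ℕ, SimpleGraph (Fin n)

open Classical in
/-- The adjacency matrix, written row by row; `none` ends a row. -/
noncomputable def FinGraph.word (Γ : FinGraph) : List (Option Bool) :=
  (List.finRange Γ.1).flatMap fun i =>
    ((List.finRange Γ.1).map fun j => some (decide (Γ.2.Adj i j))) ++ [none]

theorem FinGraph.word_injective : Function.Injective FinGraph.word := by
  classical
  rintro ⟨n, G⟩ ⟨m, H⟩ h
  have hlen : n * (n + 1) = m * (m + 1) := by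
    have := congrArg List.length h
    simpa [FinGraph.word, List.length_flatMap] using this
  obtain rfl : n = m := by
    rcases lt_trichotomy n m with h' | h' | h'
    · nlinarith
    · exact h'
    · nlinarith
  have := flatMap_inj_of_length _ _ _ (fun x => by simp) h
  have hGH : G = H := by
    ext i j
    have hi := this i (List.mem_finRange i)
    have hi' := (List.append_inj hi (by simp)).1
    have hij := List.map_inj_left.1 hi' j (List.mem_finRange j)
    simpa using hij
  rw [hGH]

/-- **GI**: isomorphism of finite graphs given by their adjacency matrices. -/
noncomputable def GI : DecisionProblem :=
  isoProblem FinGraph (Option Bool) FinGraph.word FinGraph.word_injective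
    fun Γ₁ Γ₂ => Nonempty (Γ₁.2 ≃g Γ₂.2)

/-! ## H-algebras -/

/-- The (non-unital, non-associative) algebra over `ℤ/p³ℤ` with generators `X` and relations
`r`. -/
def PresentedAlg (p : ℕ) (X : Type)
    (r : FreeNonUnitalNonAssocAlgebra (ZMod (p ^ 3)) X →
      FreeNonUnitalNonAssocAlgebra (ZMod (p ^ 3)) X → Prop) : Type :=
  (ringConGen r).Quotient

namespace PresentedAlg

variable {p : ℕ} {X : Type}
  {r : FreeNonUnitalNonAssocAlgebra (ZMod (p ^ 3)) X →
    FreeNonUnitalNonAssocAlgebra (ZMod (p ^ 3)) X → Prop}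

noncomputable instance : NonUnitalNonAssocRing (PresentedAlg p X r) :=
  inferInstanceAs (NonUnitalNonAssocRing (ringConGen r).Quotient)

/-- The image of a generator. -/
noncomputable def gen (x : X) : PresentedAlg p X r :=
  RingCon.toQuotient (c := ringConGen r) (FreeNonUnitalNonAssocAlgebra.of (ZMod (p ^ 3)) x)

theorem nsmul_eq_zero (x : PresentedAlg p X r) : (p ^ 3) • x = 0 := by
  induction x using Quotient.inductionOn' with
  | h y =>
    have hy : (p ^ 3) • y = 0 := by
      rw [← Nat.cast_smul_eq_nsmul (ZMod (p ^ 3)), ZMod.natCast_self, zero_smul]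
    change RingCon.toQuotient (c := ringConGen r) ((p ^ 3) • y) = RingCon.toQuotient 0
    rw [hy]

/-- The module structure over `ℤ/p³ℤ`; for an additive group it is unique. -/
noncomputable instance : Module (ZMod (p ^ 3)) (PresentedAlg p X r) :=
  AddCommGroup.zmodModule nsmul_eq_zero

end PresentedAlg

/-- Isomorphism of (non-unital, non-associative) algebras over `R`. -/
def AlgIso (R A B : Type) [CommRing R] [NonUnitalNonAssocRing A] [Module R A]
    [NonUnitalNonAssocRing B] [Module R B] : Prop :=
  ∃ f : A →ₙₐ[R] B, Function.Bijective f

/-- Names of the standard generators for a graph on `n` vertices: the vertices `i`, and the pairs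
`i < j` of vertices. -/
abbrev HIndex (n : ℕ) : Type := Fin n ⊕ {e : Fin n × Fin n // e.1 < e.2}

/-- The defining relations of the H-algebra of `Γ`, with generators `v i` and `a e`. -/
inductive HRel (p : ℕ) {n : ℕ} (Γ : SimpleGraph (Fin n)) :
    FreeNonUnitalNonAssocAlgebra (ZMod (p ^ 3)) (HIndex n) →
      FreeNonUnitalNonAssocAlgebra (ZMod (p ^ 3)) (HIndex n) → Prop
  | v_sq (i : Fin n) : HRel p Γ (.of _ (.inl i) * .of _ (.inl i)) 0
  | v_mul (e : {e : Fin n × Fin n // e.1 < e.2}) :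
      HRel p Γ (.of _ (.inl e.1.1) * .of _ (.inl e.1.2)) (.of _ (.inr e))
  | v_mul_rev (e : {e : Fin n × Fin n // e.1 < e.2}) :
      HRel p Γ (.of _ (.inl e.1.2) * .of _ (.inl e.1.1)) (-(.of _ (.inr e)))
  | a_mul_v (e : {e : Fin n × Fin n // e.1 < e.2}) (i : Fin n) :
      HRel p Γ (.of _ (.inr e) * .of _ (.inl i)) 0
  | v_mul_a (i : Fin n) (e : {e : Fin n × Fin n // e.1 < e.2}) :
      HRel p Γ (.of _ (.inl i) * .of _ (.inr e)) 0
  | a_mul_a (e e' : {e : Fin n × Fin n // e.1 < e.2}) :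
      HRel p Γ (.of _ (.inr e) * .of _ (.inr e')) 0
  | edge (e : {e : Fin n × Fin n // e.1 < e.2}) (h : Γ.Adj e.1.1 e.1.2) :
      HRel p Γ (p • .of _ (.inr e)) 0
  | nonedge (e : {e : Fin n × Fin n // e.1 < e.2}) (h : ¬ Γ.Adj e.1.1 e.1.2) :
      HRel p Γ ((p ^ 2) • .of _ (.inr e)) 0

/-- The H-algebra of the graph `Γ` over `ℤ/p³ℤ`. -/
abbrev HAlg (p : ℕ) {n : ℕ} (Γ : SimpleGraph (Fin n)) : Type :=
  PresentedAlg p (HIndex n) (HRel p Γ)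

/-- The standard basis of the H-algebra of `Γ`: the elements `v i` and `a e`. -/
noncomputable def hBasis (p : ℕ) {n : ℕ} (Γ : SimpleGraph (Fin n)) (k : HIndex n) : HAlg p Γ :=
  PresentedAlg.gen k

open Classical in
/-- The orders `p³` (vertices), `p` (edges), `p²` (non-edges) of the standard basis elements. -/
noncomputable def hOrder (p : ℕ) {n : ℕ} (Γ : SimpleGraph (Fin n)) : HIndex n → ℕ
  | .inl _ => p ^ 3
  | .inr e => if Γ.Adj e.1.1 e.1.2 then p else p ^ 2

/-- `b` is an additive basis with element orders `d`: the group is the direct sum of the cyclic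
groups generated by the `b k`, of orders `d k`. -/
def IsAdditiveBasis {ι M : Type} [Fintype ι] [AddCommGroup M] (b : ι → M) (d : ι → ℕ) : Prop :=
  (∀ k, addOrderOf (b k) = d k) ∧
    ∀ x : M, ∃! c : (k : ι) → Fin (d k), x = ∑ k, (c k : ℕ) • b k

/-- A finite algebra over `ℤ/p³ℤ` given by the additive orders `p ^ ord k` of basis elements
`b 0, …, b (size - 1)` and by their products `b i * b j = ∑ k, coef i j k • b k`. -/
structure AlgTable (p : ℕ) where
  size : ℕ
  ord : Fin size → Fin 4
  coef : Fin size → Fin size → Fin size → ZMod (p ^ 3)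

namespace AlgTable

variable {p : ℕ}

/-- The relations expressed by a table. -/
inductive Rel (T : AlgTable p) :
    FreeNonUnitalNonAssocAlgebra (ZMod (p ^ 3)) (Fin T.size) →
      FreeNonUnitalNonAssocAlgebra (ZMod (p ^ 3)) (Fin T.size) → Prop
  | mul (i j : Fin T.size) :
      Rel T (.of _ i * .of _ j) (∑ k, T.coef i j k • FreeNonUnitalNonAssocAlgebra.of _ k)
  | order (k : Fin T.size) : Rel T ((p ^ (T.ord k : ℕ)) • .of _ k) 0

/-- The algebra given by a table. -/
abbrev Alg (T : AlgTable p) : Type := PresentedAlg p (Fin T.size) T.Rel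

/-- The table is the multiplication table of the standard basis, listed in some order, of the
H-algebra of some graph. -/
def IsHTable (T : AlgTable p) : Prop :=
  ∃ (n : ℕ) (Γ : SimpleGraph (Fin n)) (b : Fin T.size ≃ HIndex n),
    (∀ k, addOrderOf (hBasis p Γ (b k)) = p ^ (T.ord k : ℕ)) ∧
    ∀ i j, hBasis p Γ (b i) * hBasis p Γ (b j) = ∑ k, T.coef i j k • hBasis p Γ (b k)

/-- The word listing the orders and then all the coefficients. -/
def word (T : AlgTable p) : List (Fin 4 ⊕ ZMod (p ^ 3)) :=
  (List.ofFn T.ord).map Sum.inl ++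
    (List.finRange T.size).flatMap fun i => (List.finRange T.size).flatMap fun j =>
      (List.finRange T.size).map fun k => Sum.inr (T.coef i j k)

theorem word_injective : Function.Injective (word (p := p)) := by
  rintro ⟨n, e, c⟩ ⟨m, e', c'⟩ h
  have hord : List.ofFn e = List.ofFn e' := by
    have key : ∀ T : AlgTable p, (word T).filterMap Sum.getLeft? = List.ofFn T.ord := by
      intro T
      have h2 : (Sum.getLeft? : Fin 4 ⊕ ZMod (p ^ 3) → _) ∘ Sum.inl = some := rfl
      rw [word, List.filterMap_append, List.filterMap_map, h2, List.filterMap_some,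
        List.append_right_eq_self, List.filterMap_eq_nil_iff]
      simp only [List.mem_flatMap, List.mem_map]
      rintro a ⟨_, _, _, _, _, _, rfl⟩
      rfl
    rw [← key ⟨n, e, c⟩, h, key ⟨m, e', c'⟩]
  obtain rfl : n = m := by simpa using congrArg List.length hord
  obtain rfl : e = e' := List.ofFn_injective hord
  have h2 := (List.append_inj h (by simp)).2
  have hc : c = c' := by
    funext i j k
    have h3 := flatMap_inj_of_length _ _ _ (fun x => by simp) h2 i (List.mem_finRange i)
    have h4 := flatMap_inj_of_length _ _ _ (fun x => by simp) h3 j (List.mem_finRange j)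
    simpa using List.map_inj_left.1 h4 k (List.mem_finRange k)
  rw [hc]

end AlgTable

/-- **HAI**: isomorphism of H-algebras over `ℤ/p³ℤ` given by their multiplication tables. -/
noncomputable def HAI (p : ℕ) [Fact p.Prime] : DecisionProblem :=
  isoProblem {T : AlgTable p // T.IsHTable} (Fin 4 ⊕ ZMod (p ^ 3)) (fun T => T.1.word)
    (AlgTable.word_injective.comp Subtype.val_injective)
    fun T₁ T₂ => AlgIso (ZMod (p ^ 3)) T₁.1.Alg T₂.1.Alg

/-! ## H-groups -/

/-- The word `x y x⁻¹ y⁻¹`. -/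
def commWord {X : Type} (x y : X) : List (X × Bool) :=
  [(x, true), (y, true), (x, false), (y, false)]

/-- The defining relators of the H-group of `Γ`, with generators `g i` and `a e`:
`[g i, g j] = a e` for `e = (i, j)`, `i < j`; the `a e` are central; `(g i) ^ p³ = 1`;
`(a e) ^ p = 1` for edges and `(a e) ^ p² = 1` for non-edges. -/
inductive HRelator (p : ℕ) {n : ℕ} (Γ : SimpleGraph (Fin n)) : List (HIndex n × Bool) → Prop
  | comm (e : {e : Fin n × Fin n // e.1 < e.2}) :
      HRelator p Γ (commWord (.inl e.1.1) (.inl e.1.2) ++ [(.inr e, false)])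
  | central_a (e e' : {e : Fin n × Fin n // e.1 < e.2}) :
      HRelator p Γ (commWord (.inr e) (.inr e'))
  | central_g (e : {e : Fin n × Fin n // e.1 < e.2}) (i : Fin n) :
      HRelator p Γ (commWord (.inr e) (.inl i))
  | pow_g (i : Fin n) : HRelator p Γ (List.replicate (p ^ 3) (.inl i, true))
  | edge (e : {e : Fin n × Fin n // e.1 < e.2}) (h : Γ.Adj e.1.1 e.1.2) :
      HRelator p Γ (List.replicate p (.inr e, true))
  | nonedge (e : {e : Fin n × Fin n // e.1 < e.2}) (h : ¬ Γ.Adj e.1.1 e.1.2) :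
      HRelator p Γ (List.replicate (p ^ 2) (.inr e, true))

/-- The H-group of the graph `Γ` (of its H-algebra in the standard basis). -/
abbrev HGroup (p : ℕ) {n : ℕ} (Γ : SimpleGraph (Fin n)) : Type :=
  PresentedGroup (FreeGroup.mk '' {w : List (HIndex n × Bool) | HRelator p Γ w})

/-- A finite group presentation: generators `x 0, …, x (size - 1)` and a list of relators, which
are words in the letters `(k, true)` for `x k` and `(k, false)` for its inverse. -/
structure GroupPres where
  size : ℕ
  rels : List (List (Fin size × Bool))

/-- Letters for writing presentations. -/
inductive PresSym
  | tick
  | letter (sign : Bool)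
  | endmark

instance : Finite PresSym :=
  Finite.of_surjective
    (fun o : Option (Option Bool) => match o with
      | none => PresSym.tick
      | some none => PresSym.endmark
      | some (some b) => PresSym.letter b)
    (fun s => by
      cases s with
      | tick => exact ⟨none, rfl⟩
      | letter b => exact ⟨some (some b), rfl⟩
      | endmark => exact ⟨some none, rfl⟩)

namespace GroupPres

/-- The group given by a presentation. -/
abbrev Grp (P : GroupPres) : Type := PresentedGroup (FreeGroup.mk '' {w | w ∈ P.rels})

/-- Up to the naming of the generators and the order (and repetition) of the relators, the
presentation is the standard presentation of the H-group of some graph. -/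
def IsHPres (p : ℕ) (P : GroupPres) : Prop :=
  ∃ (n : ℕ) (Γ : SimpleGraph (Fin n)) (b : Fin P.size ≃ HIndex n),
    ∀ w : List (HIndex n × Bool), HRelator p Γ w ↔ ∃ u ∈ P.rels, w = u.map (Prod.map b id)

/-- A relator is written letter by letter, with generator numbers in unary, and ended by `endmark`. -/
def relWord {N : ℕ} (u : List (Fin N × Bool)) : List PresSym :=
  (u.flatMap fun x => List.replicate x.1 .tick ++ [.letter x.2]) ++ [.endmark]

/-- The number of generators in unary, followed by the relators. -/
def word (P : GroupPres) : List PresSym :=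
  List.replicate P.size .tick ++ .endmark :: P.rels.flatMap relWord

theorem replicate_tick_inj {a b : ℕ} {x y : PresSym} {l l' : List PresSym} (hx : x ≠ .tick)
    (hy : y ≠ .tick)
    (h : List.replicate a PresSym.tick ++ x :: l = List.replicate b PresSym.tick ++ y :: l') :
    a = b ∧ x = y ∧ l = l' := by
  induction a generalizing b with
  | zero =>
    cases b with
    | zero => simpa using h
    | succ b => exact absurd (by simpa [List.replicate_succ] using (List.cons.inj h).1) hx
  | succ a ih =>
    cases b with
    | zero =>
      simp only [List.replicate_succ, List.cons_append, List.replicate_zero, List.nil_append,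
        List.cons.injEq] at h
      exact absurd h.1.symm hy
    | succ b =>
      simp only [List.replicate_succ, List.cons_append, List.cons.injEq, true_and] at h
      obtain ⟨h1, h2⟩ := ih h
      exact ⟨by rw [h1], h2⟩

theorem relWord_append_inj {N : ℕ} {u u' : List (Fin N × Bool)} {l l' : List PresSym}
    (h : relWord u ++ l = relWord u' ++ l') : u = u' ∧ l = l' := by
  induction u generalizing u' with
  | nil =>
    cases u' with
    | nil => simpa [relWord] using h
    | cons x u' =>
      have h' : List.replicate 0 PresSym.tick ++ PresSym.endmark :: l =
          List.replicate x.1 PresSym.tick ++ PresSym.letter x.2 :: (relWord u' ++ l') := by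
        simpa [relWord] using h
      exact absurd (replicate_tick_inj (by simp) (by simp) h').2.1 (by simp)
  | cons y u ih =>
    cases u' with
    | nil =>
      have h' : List.replicate y.1 PresSym.tick ++ PresSym.letter y.2 :: (relWord u ++ l) =
          List.replicate 0 PresSym.tick ++ PresSym.endmark :: l' := by
        simpa [relWord] using h
      exact absurd (replicate_tick_inj (by simp) (by simp) h').2.1 (by simp)
    | cons x u' =>
      have h' : List.replicate y.1 PresSym.tick ++ PresSym.letter y.2 :: (relWord u ++ l) =
          List.replicate x.1 PresSym.tick ++ PresSym.letter x.2 :: (relWord u' ++ l') := by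
        simpa [relWord] using h
      obtain ⟨h1, h2, h3⟩ := replicate_tick_inj (by simp) (by simp) h'
      obtain ⟨h4, h5⟩ := ih h3
      have hyx : y = x := Prod.ext (Fin.ext h1) (by simpa using h2)
      exact ⟨by rw [hyx, h4], h5⟩

theorem word_injective : Function.Injective word := by
  rintro ⟨n, R⟩ ⟨m, S⟩ h
  obtain ⟨h1, -, h2⟩ := replicate_tick_inj (by simp) (by simp) h
  obtain rfl : n = m := h1
  have hRS : R = S := by
    clear h
    change R.flatMap relWord = S.flatMap relWord at h2
    induction R generalizing S with
    | nil =>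
      cases S with
      | nil => rfl
      | cons w S => simp [relWord] at h2
    | cons u R ih =>
      cases S with
      | nil => simp [relWord] at h2
      | cons w S =>
        simp only [List.flatMap_cons] at h2
        obtain ⟨h3, h4⟩ := relWord_append_inj h2
        rw [h3, ih S h4]
  rw [hRS]

end GroupPres

/-- **HGI**: isomorphism of H-groups given by generators and defining relations. -/
noncomputable def HGI (p : ℕ) : DecisionProblem :=
  isoProblem {P : GroupPres // P.IsHPres p} PresSym (fun P => P.1.word)
    (GroupPres.word_injective.comp Subtype.val_injective)
    fun P₁ P₂ => Nonempty (P₁.1.Grp ≃* P₂.1.Grp)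

/-! ## The multigraph of a group -/

/-- A directed multigraph: `mult x y` is the number of edges from `x` to `y`. -/
structure DiMultigraph (V : Type u) where
  mult : V → V → ℕ

/-- Isomorphism of directed multigraphs. -/
def DiMultigraph.Iso {V W : Type u} (D : DiMultigraph V) (E : DiMultigraph W) : Prop :=
  ∃ f : V ≃ W, ∀ x y, E.mult (f x) (f y) = D.mult x y

open Classical in
/-- The multigraph of a group. Vertices: the elements and the triples of elements. A triple
`(u, v, w)` receives one edge from `u`; if `u * v = w`, it receives two edges from `v` and sends
one edge to `w`; otherwise it receives one edge from `v`. -/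
noncomputable def groupMultigraph (G : Type u) [Group G] : DiMultigraph (G ⊕ G × G × G) where
  mult
    | .inl a, .inr (u, v, w) =>
        (if a = u then 1 else 0) + (if a = v then (if u * v = w then 2 else 1) else 0)
    | .inr (u, v, w), .inl a => if u * v = w ∧ a = w then 1 else 0
    | _, _ => 0

/-! The algebraic core is that a graph can be recovered from a notion of commuting vectors over the
field with p elements. Reduce the vertex coefficients of elements of an H-algebra modulo p. The
coefficients of a product `x * y` at the pairs of vertices are the 2×2 minors of the vertex
coefficients of `x` and `y`. If `p • (x * y) = 0`, then the minors at non-edges, which carry the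
order p², vanish modulo p; at edges, of order p, nothing is imposed (`HAlg.comm_resid`). In an
H-group the condition `⁅x, y⁆ ^ p = 1` has the same effect (`HGroup.comm_resid`). Hence an
isomorphism of algebras or of groups induces an invertible linear map of residues which, like its
inverse, takes adjacent basis vectors to commuting vectors.

Such maps force the graphs to be isomorphic (`GraphComm.nonempty_iso_of_mapsEdges`). A non-zero term
of the determinant of φ gives a bijection σ of the vertices with non-zero entries of φ at (σ i, i).
A vector commuting with x, where x has a non-zero coordinate k, lies in the span of x and of the
basis vectors at the neighbours of k. Comparing dimensions, the degree of i is at most that of σ i,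
and the map in the other direction turns this into equality. It follows that a non-zero entry in row
σ i and column j makes every neighbour of j equal or adjacent to i. So multiples of column i can be
subtracted from the other columns without losing the commutation property, and elimination ends with
a monomial matrix, that is, with a graph isomorphism.

The converse directions are universal properties. That the generators have the stated orders and no
further relations is seen on concrete models: tuples of coefficients multiplied by minors, and
tuples of exponents multiplied by means of a bilinear cocycle.

For the complexity statement, all three problems are regarded as codings of graphs. Vertices and
edges are recognised in a table by the additive orders p³ and p, and in a presentation by the power
relators. Every reduction decodes two graphs, encodes them anew and asks a single question
(`StackProgram.GraphCoding.reducible`). Decoding and encoding are expressed by bounded loops over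
unary numbers (`Num`, `Out`). Each construct of this language is compiled to a program on six
stacks, with polynomial bounds for running time and size of the result (`Num.numProgram`,
`Out.outProgram`), and the program becomes an oracle machine (`toOracleTM`).

In the multigraph of a group, the elements are the vertices that send a multiple edge, and the
multiplicities one and two tell left factors from right factors. -/

/-! ## Structured programs on six stacks -/

namespace StackProgram

/-- The stacks of a program. -/
inductive StackName
  | inp
  | buf
  | env
  | aux
  | res
  | out
deriving DecidableEq

instance : Finite StackName :=
  Finite.of_injective (fun k : StackName => match k with
    | .inp => (0 : Fin 6)
    | .buf => 1
    | .env => 2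
    | .aux => 3
    | .res => 4
    | .out => 5) (fun a b h => by cases a <;> cases b <;> first | rfl | simp at h)

/-- The contents of the stacks, tops first. -/
structure Store (S : Type) where
  inp : List S
  buf : List S
  env : List S
  aux : List S
  res : List S
  out : List S

namespace Store

variable {S : Type}

/-- The contents of the stack `k`. -/
def get (s : Store S) : StackName → List S
  | .inp => s.inp
  | .buf => s.buf
  | .env => s.env
  | .aux => s.aux
  | .res => s.res
  | .out => s.out

/-- The store with the contents of the stack `k` replaced by `l`. -/
def set (s : Store S) (k : StackName) (l : List S) : Store S :=
  match k with
  | .inp => { s with inp := l }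
  | .buf => { s with buf := l }
  | .env => { s with env := l }
  | .aux => { s with aux := l }
  | .res => { s with res := l }
  | .out => { s with out := l }

theorem get_set (s : Store S) (k : StackName) (l : List S) :
    (s.set k l).get = Function.update s.get k l := by
  funext k'
  cases k <;> cases k' <;> rfl

end Store

/-- Programs. `case k c` pops the stack `k` and branches on the result; `loop k isEnd c` pops the
stack `k` and, unless `isEnd` holds of the result `o`, performs `c o` and repeats. -/
inductive Cmd (S : Type)
  | skip
  | push (k : StackName) (s : S)
  | seq (a b : Cmd S)
  | case (k : StackName) (c : Option S → Cmd S)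
  | loop (k : StackName) (isEnd : Option S → Bool) (c : Option S → Cmd S)

variable {S : Type}

/-- `Exec c s s' t`: the program `c` leads from the store `s` to `s'` in `t` steps. -/
inductive Exec : Cmd S → Store S → Store S → ℕ → Prop
  | skip (s) : Exec .skip s s 1
  | push (s k x) : Exec (.push k x) s (s.set k (x :: s.get k)) 1
  | seq {a b s₁ s₂ s₃ t₁ t₂} (h₁ : Exec a s₁ s₂ t₁) (h₂ : Exec b s₂ s₃ t₂) :
      Exec (.seq a b) s₁ s₃ (t₁ + t₂)
  | case {k c s s' t} (h : Exec (c (s.get k).head?) (s.set k (s.get k).tail) s' t) :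
      Exec (.case k c) s s' (1 + t)
  | loop_end {k isEnd c s} (h : isEnd (s.get k).head? = true) :
      Exec (.loop k isEnd c) s (s.set k (s.get k).tail) 1
  | loop_step {k isEnd c s s₁ s₂ t₁ t₂} (h : isEnd (s.get k).head? = false)
      (h₁ : Exec (c (s.get k).head?) (s.set k (s.get k).tail) s₁ t₁)
      (h₂ : Exec (.loop k isEnd c) s₁ s₂ t₂) :
      Exec (.loop k isEnd c) s s₂ (1 + (t₁ + t₂))

/-! ### Compilation of structured programs into stack machines -/

/-- Control points of a program. -/
def Lab : Cmd S → Type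
  | .skip => Unit
  | .push _ _ => Unit
  | .seq a b => Lab a ⊕ Lab b
  | .case _ c => Unit ⊕ (Σ o, Lab (c o))
  | .loop _ _ c => Unit ⊕ (Σ o, Lab (c o))

/-- Finitely many symbols are needed because `case` and `loop` contain one body for each possible
result of a pop. -/
theorem Lab.finite [Finite S] (c : Cmd S) : Finite (Lab c) := by
  induction c with
  | skip => exact inferInstanceAs (Finite Unit)
  | push k s => exact inferInstanceAs (Finite Unit)
  | seq a b iha ihb => exact inferInstanceAs (Finite (Lab a ⊕ Lab b))
  | case k c ih => exact inferInstanceAs (Finite (Unit ⊕ (Σ o, Lab (c o))))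
  | loop k isEnd c ih => exact inferInstanceAs (Finite (Unit ⊕ (Σ o, Lab (c o))))

/-- The control point at which a program starts. -/
def entry : (c : Cmd S) → Lab c
  | .skip => ()
  | .push _ _ => ()
  | .seq a _ => Sum.inl (entry a)
  | .case _ _ => Sum.inl ()
  | .loop _ _ _ => Sum.inl ()

/-- Statements of the control points of a program within a stack machine. -/
def code {L : Type} : (c : Cmd S) → (Lab c → L) → L → Lab c →
    Turing.TM2.Stmt (fun _ : StackName => S) L (Option S)
  | .skip, _, exit, _ => .goto fun _ => exit
  | .push k s, _, exit, _ => .push k (fun _ => s) (.goto fun _ => exit)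
  | .seq a b, emb, _, .inl l => code a (fun l => emb (.inl l)) (emb (.inr (entry b))) l
  | .seq _ b, emb, exit, .inr l => code b (fun l => emb (.inr l)) exit l
  | .case k c, emb, _, .inl _ =>
      .pop k (fun _ o => o) (.goto fun o => emb (.inr ⟨o, entry (c o)⟩))
  | .case _ c, emb, exit, .inr ⟨o, l⟩ => code (c o) (fun l => emb (.inr ⟨o, l⟩)) exit l
  | .loop k isEnd c, emb, exit, .inl _ =>
      .pop k (fun _ o => o)
        (.goto fun o => if isEnd o then exit else emb (.inr ⟨o, entry (c o)⟩))
  | .loop _ _ c, emb, _, .inr ⟨o, l⟩ =>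
      code (c o) (fun l => emb (.inr ⟨o, l⟩)) (emb (.inl ())) l

/-- The time in `Exec` is counted so that each unit is exactly one machine step. An arbitrary
embedding of the labels and an arbitrary exit let the induction descend into subprograms. The
internal state `v` is irrelevant, as a pop overwrites it before any branching. -/
theorem Exec.iterate_step {L : Type}
    (f : Turing.TM2.Cfg (fun _ : StackName => S) L (Option S) →
      Option (Turing.TM2.Cfg (fun _ : StackName => S) L (Option S)))
    {c : Cmd S} {s s' : Store S} {t : ℕ} (h : Exec c s s' t) (emb : Lab c → L) (exit : L)
    (hf : ∀ l v T, f ⟨some (emb l), v, T⟩ = some (Turing.TM2.stepAux (code c emb exit l) v T))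
    (v : Option S) :
    ∃ v', (flip bind f)^[t] (some ⟨some (emb (entry c)), v, s.get⟩) =
      some ⟨some exit, v', s'.get⟩ := by
  induction h generalizing exit v with
  | skip s => exact ⟨v, hf _ _ _⟩
  | push s k x =>
    refine ⟨v, (hf _ _ _).trans ?_⟩
    rw [Store.get_set]
    rfl
  | @seq a b s₁ s₂ s₃ t₁ t₂ h₁ h₂ ih₁ ih₂ =>
    obtain ⟨v₁, e₁⟩ := ih₁ (fun l => emb (.inl l)) (emb (.inr (entry b)))
      (fun l v T => hf (.inl l) v T) v
    obtain ⟨v₂, e₂⟩ := ih₂ (fun l => emb (.inr l)) exit (fun l v T => hf (.inr l) v T) v₁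
    refine ⟨v₂, ?_⟩
    rw [add_comm, Function.iterate_add_apply]
    exact (congrArg _ e₁).trans e₂
  | @case k c s s' t h ih =>
    obtain ⟨v₂, e₂⟩ := ih (fun l => emb (.inr ⟨_, l⟩)) exit (fun l v T => hf (.inr ⟨_, l⟩) v T)
      (s.get k).head?
    refine ⟨v₂, ?_⟩
    rw [add_comm, Function.iterate_add_apply, ← e₂]
    refine congrArg _ ((hf _ _ _).trans ?_)
    rw [Store.get_set]
    rfl
  | @loop_end k isEnd c s h =>
    refine ⟨(s.get k).head?, (hf _ _ _).trans ?_⟩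
    rw [Store.get_set]
    simp [entry, code, Turing.TM2.stepAux, h]
  | @loop_step k isEnd c s s₁ s₂ t₁ t₂ h h₁ h₂ ih₁ ih₂ =>
    obtain ⟨v₁, e₁⟩ := ih₁ (fun l => emb (.inr ⟨_, l⟩)) (emb (.inl ()))
      (fun l v T => hf (.inr ⟨_, l⟩) v T) (s.get k).head?
    obtain ⟨v₂, e₂⟩ := ih₂ emb exit hf v₁
    refine ⟨v₂, ?_⟩
    rw [add_comm, Function.iterate_add_apply, add_comm, Function.iterate_add_apply, ← e₂]
    refine congrArg _ (Eq.trans (congrArg _ ((hf _ _ _).trans ?_)) e₁)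
    rw [Store.get_set]
    simp [entry, code, Turing.TM2.stepAux, h]

/-- The machine that runs the program `c` and answers as the oracle does about the word which `c`
leaves on the stack `buf`. -/
def toOracleTM {A Q : Type} [Finite S] (inSym : A → S) (querySym : S → Q) (s₀ : S) (c : Cmd S) :
    OracleTM A Q where
  K := StackName
  Sym := S
  Lab := Lab c ⊕ Fin 3
  St := Option S
  finLab := by
    have := Lab.finite c
    infer_instance
  inStack := .inp
  queryStack := .buf
  inSym := inSym
  querySym := querySym
  start := .inl (entry c)
  ask := .inr 0
  onYes := .inr 1
  onNo := .inr 2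
  initSt := none
  accept := Option.isSome
  prog
    | .inl l => code c Sum.inl (.inr 0) l
    | .inr i => .load (fun _ => if i = 1 then some s₀ else none) .halt

/-- After the `t` steps of the program come two more: the query, and the statement that records the
answer in the state and halts. -/
theorem toOracleTM_answersWithin {A Q : Type} [Finite S] (inSym : A → S) (querySym : S → Q)
    (s₀ : S) (c : Cmd S) (O : Set (List Q)) (w : List A) (u : List S) {s' : Store S} {t T : ℕ}
    (h : Exec c ⟨w.map inSym, [], [], [], [], []⟩ s' t) (hu : s'.buf = u) (hT : t + 2 ≤ T) :
    (toOracleTM inSym querySym s₀ c).AnswersWithin O w T (u.map querySym ∈ O) := by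
  classical
  set M := toOracleTM inSym querySym s₀ c with hM
  have hinit : M.init w = ⟨some (.inl (entry c)), none,
      (⟨w.map inSym, [], [], [], [], []⟩ : Store S).get⟩ := by
    unfold OracleTM.init
    congr 1
    funext k
    cases k <;> rfl
  obtain ⟨v', e⟩ := h.iterate_step (M.step O) (Sum.inl : Lab c → Lab c ⊕ Fin 3) (.inr 0)
    (by
      intro l v T
      have : ¬ (some (Sum.inl l : Lab c ⊕ Fin 3) = some (Sum.inr 0)) := by simp
      exact if_neg this) none
  refine ⟨⟨none, if u.map querySym ∈ O then some s₀ else none, s'.get⟩, ⟨⟨⟨t + 2, ?_⟩, hT⟩⟩, rfl,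
    ?_⟩
  · rw [hinit, add_comm, Function.iterate_add_apply]
    refine (congrArg _ e).trans ?_
    have h1 : M.step O ⟨some (.inr 0), v', s'.get⟩ =
        some ⟨some (if u.map querySym ∈ O then (.inr 1 : Lab c ⊕ Fin 3) else .inr 2), v',
          s'.get⟩ := by
      subst hu
      exact if_pos rfl
    refine (congrArg (fun o => o >>= M.step O) h1).trans ?_
    have h2 : ∀ i : Fin 3, i ≠ 0 → M.step O ⟨some (.inr i : Lab c ⊕ Fin 3), v', s'.get⟩ =
        some ⟨none, if i = 1 then some s₀ else none, s'.get⟩ := by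
      intro i hi
      have : ¬ (some (Sum.inr i : Lab c ⊕ Fin 3) = some (Sum.inr 0)) := by simpa using hi
      exact if_neg this
    by_cases hq : u.map querySym ∈ O
    · simp only [hq]
      exact h2 1 (by decide)
    · simp only [hq]
      exact h2 2 (by decide)
  · change Option.isSome (if u.map querySym ∈ O then some s₀ else none) = true ↔ _
    by_cases hq : u.map querySym ∈ O <;> simp [hq]

end StackProgram

/-! ## A language of bounded loops -/

namespace StackProgram

/-- Values of `k` variables. -/
abbrev Ctx : ℕ → Type
  | 0 => Unit
  | k + 1 => Ctx k × ℕ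

open Classical in
/-- Numerical functions of an instance, given as a word by `enc`, and of `k` variables, that can be
computed by bounded loops. -/
inductive Num {X A : Type} (enc : X → List A) : (k : ℕ) → (X → Ctx k → ℕ) → Prop
  | last {k} : Num enc (k + 1) fun _ c => c.2
  | weak {k f} (hf : Num enc k f) : Num enc (k + 1) fun x c => f x c.1
  | const {k} (m : ℕ) : Num enc k fun _ _ => m
  | len {k} : Num enc k fun x _ => (enc x).length
  | add {k f g} (hf : Num enc k f) (hg : Num enc k g) : Num enc k fun x c => f x c + g x c
  | sub {k f g} (hf : Num enc k f) (hg : Num enc k g) : Num enc k fun x c => f x c - g x c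
  | sum' {k e f} (he : Num enc k e) (hf : Num enc (k + 1) f) :
      Num enc k fun x c => ∑ i ∈ Finset.range (e x c), f x (c, i)
  | sym' {k f} (S : A → Prop) (hf : Num enc k f) :
      Num enc k fun x c => if ∃ a ∈ (enc x)[f x c]?, S a then 1 else 0

/-- Words depending on an instance, given as a word by `enc`, and on `k` variables, that can be
written by bounded loops. -/
inductive Out {X A : Type} (enc : X → List A) (B : Type) : (k : ℕ) → (X → Ctx k → List B) → Prop
  | nil {k} : Out enc B k fun _ _ => []
  | emit {k} (b : B) : Out enc B k fun _ _ => [b]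
  | weak {k t} (ht : Out enc B k t) : Out enc B (k + 1) fun x c => t x c.1
  | append {k s t} (hs : Out enc B k s) (ht : Out enc B k t) : Out enc B k fun x c => s x c ++ t x c
  | flatMap' {k e t} (he : Num enc k e) (ht : Out enc B (k + 1) t) :
      Out enc B k fun x c => (List.range (e x c)).flatMap fun i => t x (c, i)

/-- The program `c` leads from `s` to `s'` in at most `T` steps. -/
def Runs {S : Type} (c : Cmd S) (s s' : Store S) (T : ℕ) : Prop := ∃ t ≤ T, Exec c s s' t

section Runs

variable {S : Type}

theorem Runs.mono {c : Cmd S} {s s' T T'} (h : Runs c s s' T) (hT : T ≤ T') : Runs c s s' T' :=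
  let ⟨t, ht, e⟩ := h
  ⟨t, ht.trans hT, e⟩

theorem Runs.skip (s : Store S) : Runs .skip s s 1 := ⟨1, le_rfl, .skip s⟩

theorem Runs.push (s : Store S) (k : StackName) (x : S) :
    Runs (.push k x) s (s.set k (x :: s.get k)) 1 := ⟨1, le_rfl, .push s k x⟩

theorem Runs.seq {a b : Cmd S} {s₁ s₂ s₃ : Store S} {t₁ t₂ : ℕ} (h₁ : Runs a s₁ s₂ t₁)
    (h₂ : Runs b s₂ s₃ t₂) : Runs (.seq a b) s₁ s₃ (t₁ + t₂) :=
  let ⟨_, l₁, e₁⟩ := h₁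
  let ⟨_, l₂, e₂⟩ := h₂
  ⟨_, add_le_add l₁ l₂, .seq e₁ e₂⟩

theorem Runs.case {k : StackName} {c : Option S → Cmd S} {s s' : Store S} {t : ℕ}
    (h : Runs (c (s.get k).head?) (s.set k (s.get k).tail) s' t) :
    Runs (.case k c) s s' (1 + t) :=
  let ⟨_, l, e⟩ := h
  ⟨_, by omega, .case e⟩

/-- `σ i` is the store before round `i`. Each round costs `t` and one pop, and the pop that ends the
loop costs one more. The bound is stated with `N` in place of `n` so that it can later be the value
of a polynomial. -/
theorem Runs.loop {k : StackName} {isEnd : Option S → Bool} {c : Option S → Cmd S} {n N : ℕ}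
    {t : ℕ} (σ : ℕ → Store S) (hn : n ≤ N)
    (hgo : ∀ i < n, isEnd ((σ i).get k).head? = false ∧
      Runs (c ((σ i).get k).head?) ((σ i).set k ((σ i).get k).tail) (σ (i + 1)) t)
    (hend : isEnd ((σ n).get k).head? = true) :
    Runs (.loop k isEnd c) (σ 0) ((σ n).set k ((σ n).get k).tail) (N * (t + 1) + 1) := by
  refine Runs.mono (T := n * (t + 1) + 1) ?_ (by gcongr)
  clear hn N
  induction n generalizing σ with
  | zero => exact ⟨1, by omega, .loop_end hend⟩
  | succ n ih =>
    obtain ⟨t₂, l₂, e₂⟩ := ih (fun i => σ (i + 1)) (fun i hi => hgo (i + 1) (by omega)) hend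
    obtain ⟨h0, t₁, l₁, e₁⟩ := hgo 0 (by omega)
    exact ⟨_, by ring_nf at l₂ ⊢; omega, .loop_step h0 e₁ e₂⟩

end Runs

/-! ### Compilation of bounded loops, with polynomial bounds -/

section Compile

variable {A B : Type}

/-- The stack symbols: markers, input letters and output letters. -/
abbrev Sym (A B : Type) : Type := Bool ⊕ A ⊕ B

/-- The unit of unary numbers. -/
abbrev tick : Sym A B := .inl true

/-- The symbol that separates unary numbers. -/
abbrev bar : Sym A B := .inl false

/-- The unary number `n`. -/
abbrev unary (n : ℕ) : List (Sym A B) := List.replicate n tick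

/-- The result of popping a stack is not a tick. -/
def notTick : Option (Sym A B) → Bool
  | some (.inl b) => !b
  | _ => true

/-- Repeat `c` as long as a tick can be popped from the stack `k`. -/
def tickLoop (k : StackName) (c : Cmd (Sym A B)) : Cmd (Sym A B) :=
  .loop k notTick fun _ => c

/-- The pop that ends the loop also removes the bar under the number, so the number disappears from
the stack completely. -/
theorem Runs.tickLoop {k : StackName} {c : Cmd (Sym A B)} {n N t : ℕ} (σ : ℕ → Store (Sym A B))
    (l : List (Sym A B)) (hn : n ≤ N)
    (hget : ∀ i ≤ n, (σ i).get k = unary (n - i) ++ bar :: l)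
    (hgo : ∀ i < n, Runs c ((σ i).set k (unary (n - (i + 1)) ++ bar :: l)) (σ (i + 1)) t) :
    Runs (tickLoop k c) (σ 0) ((σ n).set k l) (N * (t + 1) + 1) := by
  have h1 : ((σ n).get k) = bar :: l := by simpa using hget n le_rfl
  have h2 : ∀ i < n, (σ i).get k = tick :: (unary (n - (i + 1)) ++ bar :: l) := by
    intro i hi
    rw [hget i hi.le, show n - i = n - (i + 1) + 1 by omega]
    rfl
  have := Runs.loop (k := k) (isEnd := notTick)
    (c := fun _ => c) (t := t) σ hn
    (fun i hi => ⟨by rw [h2 i hi]; rfl, by rw [h2 i hi]; exact hgo i hi⟩)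
    (by rw [h1]; rfl)
  rw [h1] at this
  exact this

/-- Move a unary number from the stack `k` to the stack `k'`. -/
def moveUnary (k k' : StackName) : Cmd (Sym A B) :=
  .seq (.push k' bar) (tickLoop k (.push k' tick))

theorem runs_moveUnary_res_aux (I E F R O : List (Sym A B)) {n N : ℕ} (hn : n ≤ N) :
    Runs (moveUnary .res .aux) ⟨I, [], E, F, unary n ++ bar :: R, O⟩
      ⟨I, [], E, unary n ++ bar :: F, R, O⟩ (2 * N + 2) := by
  refine (Runs.seq (Runs.push _ _ _) (Runs.tickLoop (t := 1)
    (fun i => ⟨I, [], E, unary i ++ bar :: F, unary (n - i) ++ bar :: R, O⟩) R hn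
    (fun i hi => rfl) (fun i hi => Runs.push _ _ _))).mono (by omega)

theorem runs_moveUnary_aux_env (I E F R O : List (Sym A B)) {n N : ℕ} (hn : n ≤ N) :
    Runs (moveUnary .aux .env) ⟨I, [], E, unary n ++ bar :: F, R, O⟩
      ⟨I, [], unary n ++ bar :: E, F, R, O⟩ (2 * N + 2) := by
  refine (Runs.seq (Runs.push _ _ _) (Runs.tickLoop (t := 1)
    (fun i => ⟨I, [], unary i ++ bar :: E, unary (n - i) ++ bar :: F, R, O⟩) F hn
    (fun i hi => rfl) (fun i hi => Runs.push _ _ _))).mono (by omega)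

theorem runs_moveUnary_env_aux (I E F R O : List (Sym A B)) {n N : ℕ} (hn : n ≤ N) :
    Runs (moveUnary .env .aux) ⟨I, [], unary n ++ bar :: E, F, R, O⟩
      ⟨I, [], E, unary n ++ bar :: F, R, O⟩ (2 * N + 2) := by
  refine (Runs.seq (Runs.push _ _ _) (Runs.tickLoop (t := 1)
    (fun i => ⟨I, [], unary (n - i) ++ bar :: E, unary i ++ bar :: F, R, O⟩) E hn
    (fun i hi => rfl) (fun i hi => Runs.push _ _ _))).mono (by omega)

/-- Move all symbols of the stack `k` to the stack `k'`. -/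
def moveAll (k k' : StackName) (c : Cmd (Sym A B)) : Cmd (Sym A B) :=
  .loop k (fun o => o.isNone) fun o => o.elim .skip fun s => .seq (.push k' s) c

theorem runs_moveAll_buf_inp (l I E F R O : List (Sym A B)) {N : ℕ} (hN : l.length ≤ N) :
    Runs (moveAll .buf .inp .skip) ⟨I, l, E, F, R, O⟩ ⟨l.reverse ++ I, [], E, F, R, O⟩
      (3 * N + 1) := by
  refine Runs.mono (T := 3 * l.length + 1) ?_ (by omega)
  clear hN N
  induction l generalizing I with
  | nil => exact ⟨1, by omega, .loop_end (s := ⟨I, [], E, F, R, O⟩) rfl⟩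
  | cons a l ih =>
    obtain ⟨t, ht, e⟩ := ih (a :: I)
    refine ⟨1 + ((1 + 1) + t), by rw [List.length_cons]; omega, ?_⟩
    rw [List.reverse_cons, List.append_assoc]
    exact .loop_step (s := ⟨I, a :: l, E, F, R, O⟩) rfl (.seq (.push _ _ _) (.skip _)) e

theorem runs_moveAll_inp_buf (l I E F R O : List (Sym A B)) {N : ℕ} (hN : l.length ≤ N) :
    Runs (moveAll .inp .buf (.push .res tick)) ⟨l, I, E, F, R, O⟩
      ⟨[], l.reverse ++ I, E, F, unary l.length ++ R, O⟩ (3 * N + 1) := by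
  refine Runs.mono (T := 3 * l.length + 1) ?_ (by omega)
  clear hN N
  induction l generalizing I R with
  | nil => exact ⟨1, by omega, .loop_end (s := ⟨[], I, E, F, R, O⟩) rfl⟩
  | cons a l ih =>
    obtain ⟨t, ht, e⟩ := ih (a :: I) (tick :: R)
    refine ⟨1 + ((1 + 1) + t), by rw [List.length_cons]; omega, ?_⟩
    rw [List.reverse_cons, List.append_assoc, List.length_cons, unary, List.replicate_succ',
      List.append_assoc]
    exact .loop_step (s := ⟨a :: l, I, E, F, R, O⟩) rfl (.seq (.push _ _ _) (.push _ _ _)) e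

theorem runs_moveAll_out_buf (l I E F R O : List (Sym A B)) {N : ℕ} (hN : l.length ≤ N) :
    Runs (moveAll .out .buf .skip) ⟨I, O, E, F, R, l⟩ ⟨I, l.reverse ++ O, E, F, R, []⟩
      (3 * N + 1) := by
  refine Runs.mono (T := 3 * l.length + 1) ?_ (by omega)
  clear hN N
  induction l generalizing O with
  | nil => exact ⟨1, by omega, .loop_end (s := ⟨I, O, E, F, R, []⟩) rfl⟩
  | cons a l ih =>
    obtain ⟨t, ht, e⟩ := ih (a :: O)
    refine ⟨1 + ((1 + 1) + t), by rw [List.length_cons]; omega, ?_⟩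
    rw [List.reverse_cons, List.append_assoc]
    exact .loop_step (s := ⟨I, O, E, F, R, a :: l⟩) rfl (.seq (.push _ _ _) (.skip _)) e

/-- The stack contents representing the variables. -/
def ctxStack : (k : ℕ) → Ctx k → List (Sym A B)
  | 0, _ => []
  | k + 1, c => unary c.2 ++ bar :: ctxStack k c.1

/-- All variables are at most `M`. -/
def CtxLE (M : ℕ) : (k : ℕ) → Ctx k → Prop
  | 0, _ => True
  | k + 1, c => c.2 ≤ M ∧ CtxLE M k c.1

theorem CtxLE.mono {M N k : ℕ} (h : M ≤ N) {c : Ctx k} (hc : CtxLE M k c) : CtxLE N k c := by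
  induction k with
  | zero => trivial
  | succ k ih => exact ⟨hc.1.trans h, ih hc.2⟩

variable {X : Type} (enc : X → List A) (B)

/-- `f` is computed in polynomial time by a program that leaves its value on the stack `res`. -/
def NumProgram (k : ℕ) (f : X → Ctx k → ℕ) : Prop :=
  ∃ (p : Cmd (Sym A B)) (P V : Polynomial ℕ), ∀ x c M, (enc x).length ≤ M → CtxLE M k c →
    f x c ≤ V.eval M ∧ ∀ E F R O,
      Runs p ⟨(enc x).map (.inr ∘ .inl), [], ctxStack k c ++ E, F, R, O⟩
        ⟨(enc x).map (.inr ∘ .inl), [], ctxStack k c ++ E, F, unary (f x c) ++ R, O⟩ (P.eval M)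

/-- `f` is computed in polynomial time by a program that leaves its value on the stack `out`. -/
def OutProgram (k : ℕ) (f : X → Ctx k → List B) : Prop :=
  ∃ (p : Cmd (Sym A B)) (P V : Polynomial ℕ), ∀ x c M, (enc x).length ≤ M → CtxLE M k c →
    (f x c).length ≤ V.eval M ∧ ∀ E F R O,
      Runs p ⟨(enc x).map (.inr ∘ .inl), [], ctxStack k c ++ E, F, R, O⟩
        ⟨(enc x).map (.inr ∘ .inl), [], ctxStack k c ++ E, F, R,
          ((f x c).map (.inr ∘ .inr)).reverse ++ O⟩ (P.eval M)

variable {enc B}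

/-- Perform `q` for all values of a new variable smaller than the value computed by `p`. -/
def forCmd (p q : Cmd (Sym A B)) : Cmd (Sym A B) :=
  .seq (.push .res bar) <| .seq p <| .seq (moveUnary .res .aux) <| .seq (.push .env bar) <|
    .seq (tickLoop .aux (.seq q (.push .env tick))) (tickLoop .env .skip)

/-- `r i` and `o i` are the contents of `res` and `out` after `i` rounds, so that sums and
concatenations are treated alike. The bar on `res` separates `n` from older ticks. On `aux` the
number `n` counts down while the loop variable on `env` counts up from zero. Moving, counting and
discarding the variable account for `6 * N + 6`. -/
theorem runs_forCmd {p q : Cmd (Sym A B)} {I E F : List (Sym A B)} (n N t u : ℕ) (hn : n ≤ N)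
    (r o : ℕ → List (Sym A B))
    (hp : ∀ F R O, Runs p ⟨I, [], E, F, R, O⟩ ⟨I, [], E, F, unary n ++ R, O⟩ t)
    (hq : ∀ i < n, ∀ F, Runs q ⟨I, [], unary i ++ bar :: E, F, r i, o i⟩
      ⟨I, [], unary i ++ bar :: E, F, r (i + 1), o (i + 1)⟩ u) :
    Runs (forCmd p q) ⟨I, [], E, F, r 0, o 0⟩ ⟨I, [], E, F, r n, o n⟩
      (t + N * u + 6 * N + 6) := by
  have h1 := Runs.tickLoop (k := .aux) (c := .seq q (.push .env tick)) (n := n) (N := N)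
    (t := u + 1) (fun i => ⟨I, [], unary i ++ bar :: E, unary (n - i) ++ bar :: F, r i, o i⟩)
    F hn (fun i hi => rfl) (fun i hi => (hq i hi _).seq (Runs.push _ _ _))
  have h2 := Runs.tickLoop (k := .env) (c := .skip) (n := n) (N := N) (t := 1)
    (fun i => ⟨I, [], unary (n - i) ++ bar :: E, F, r n, o n⟩) E hn (fun i hi => rfl)
    (fun i hi => Runs.skip _)
  exact ((Runs.push ⟨I, [], E, F, r 0, o 0⟩ .res bar).seq
    ((hp F (bar :: r 0) (o 0)).seq ((runs_moveUnary_res_aux I E F (r 0) (o 0) hn).seq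
    ((Runs.push ⟨I, [], E, unary n ++ bar :: F, r 0, o 0⟩ .env bar).seq
    (Runs.seq (s₂ := ⟨I, [], unary n ++ bar :: E, F, r n, o n⟩)
      (by simpa [Store.get, Store.set] using h1)
      (by simpa [Store.get, Store.set] using h2)))))).mono
    (by ring_nf; omega)

/-- Reading a stack destroys it, so each tick of the variable goes to both `res` and `aux`, and
`aux` then restores the variable. -/
theorem numProgram_last {k : ℕ} : NumProgram B enc (k + 1) fun _ c => c.2 := by
  refine ⟨.seq (.push .aux bar) (.seq (tickLoop .env (.seq (.push .aux tick) (.push .res tick)))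
    (moveUnary .aux .env)), 5 * .X + 4, .X, fun x c M _ hc =>
      ⟨by simpa using hc.1, fun E F R O => ?_⟩⟩
  set I : List (Sym A B) := (enc x).map (.inr ∘ .inl)
  obtain ⟨c, n⟩ := c
  set E' : List (Sym A B) := ctxStack k c ++ E with hE'
  have hE : ctxStack (k + 1) (c, n) ++ E = unary n ++ bar :: E' := by simp [ctxStack, hE']
  rw [hE]
  refine Runs.mono ((Runs.push _ _ _).seq (Runs.seq (Runs.tickLoop (t := 2)
    (fun i => ⟨I, [], unary (n - i) ++ bar :: E', unary i ++ bar :: F, unary i ++ R, O⟩) E' hc.1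
    (fun i hi => rfl) (fun i hi => (Runs.push _ _ _).seq (Runs.push _ _ _)))
    (runs_moveUnary_aux_env I E' F _ O hc.1))) ?_
  simp
  omega

/-- The newest variable lies on top of the older ones and waits on `aux` while `p` runs. -/
theorem NumProgram.weak {k : ℕ} {f : X → Ctx k → ℕ} (hf : NumProgram B enc k f) :
    NumProgram B enc (k + 1) fun x c => f x c.1 := by
  obtain ⟨p, P, V, hp⟩ := hf
  refine ⟨.seq (moveUnary .env .aux) (.seq p (moveUnary .aux .env)), P + 4 * .X + 4, V,
    fun x c M hx hc => ⟨(hp x c.1 M hx hc.2).1, fun E F R O => ?_⟩⟩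
  obtain ⟨c, n⟩ := c
  have hE : ctxStack (k + 1) (c, n) ++ E = unary n ++ bar :: (ctxStack k c ++ E) := by
    simp [ctxStack]
  rw [hE]
  refine ((runs_moveUnary_env_aux _ _ F R O hc.1).seq (((hp x c M hx hc.2).2 _ _ _ _).seq
    (runs_moveUnary_aux_env _ _ _ _ _ hc.1))).mono ?_
  simp
  omega

theorem numProgram_const {k : ℕ} (m : ℕ) : NumProgram B enc k fun _ _ => m := by
  induction m with
  | zero => exact ⟨.skip, 1, 0, fun x c M _ _ => ⟨by simp, fun E F R O => by
      simpa using Runs.skip _⟩⟩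
  | succ m ih =>
    obtain ⟨p, P, V, hp⟩ := ih
    refine ⟨.seq p (.push .res tick), P + 1, V + 1, fun x c M hx hc => ⟨?_, fun E F R O => ?_⟩⟩
    · simpa using (hp x c M hx hc).1
    · rw [Polynomial.eval_add, Polynomial.eval_one]
      exact ((hp x c M hx hc).2 E F R O).seq (Runs.push _ _ _)

/-- The input is reversed onto `buf` with one tick per letter, and a second reversal restores it. -/
theorem numProgram_len {k : ℕ} : NumProgram B enc k fun x _ => (enc x).length := by
  refine ⟨.seq (moveAll .inp .buf (.push .res tick)) (moveAll .buf .inp .skip), 6 * .X + 2, .X,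
    fun x c M hx _ => ⟨by simpa using hx, fun E F R O => ?_⟩⟩
  have h1 := runs_moveAll_inp_buf ((enc x).map (.inr ∘ .inl)) [] (ctxStack k c ++ E) F R O
    (N := M) (by simpa using hx)
  have h2 := runs_moveAll_buf_inp ((enc x).map (.inr ∘ .inl)).reverse [] (ctxStack k c ++ E) F
    (unary (enc x).length ++ R) O (N := M) (by simpa using hx)
  simp only [List.append_nil, List.reverse_reverse, List.length_map] at h1 h2
  refine (h1.seq h2).mono ?_
  simp
  omega

/-- A result is left on `res` without a bar beneath it, so running two programs in succession adds
their values. -/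
theorem NumProgram.add {k : ℕ} {f g : X → Ctx k → ℕ} (hf : NumProgram B enc k f)
    (hg : NumProgram B enc k g) : NumProgram B enc k fun x c => f x c + g x c := by
  obtain ⟨p, P, V, hp⟩ := hf
  obtain ⟨q, Q, W, hq⟩ := hg
  refine ⟨.seq p q, P + Q, V + W, fun x c M hx hc => ⟨?_, fun E F R O => ?_⟩⟩
  · simpa using add_le_add (hp x c M hx hc).1 (hq x c M hx hc).1
  · have := ((hp x c M hx hc).2 E F R O).seq ((hq x c M hx hc).2 E F _ O)
    rw [← List.append_assoc, ← List.replicate_add, add_comm (g x c)] at this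
    simpa using this

/-- For each tick of the subtrahend on `aux` one symbol is popped from `res`. When this is the bar
under the minuend it is put back, which truncates the difference at zero. A final passage through
`aux` removes that bar. -/
theorem NumProgram.sub {k : ℕ} {f g : X → Ctx k → ℕ} (hf : NumProgram B enc k f)
    (hg : NumProgram B enc k g) : NumProgram B enc k fun x c => f x c - g x c := by
  obtain ⟨p, P, V, hp⟩ := hf
  obtain ⟨q, Q, W, hq⟩ := hg
  refine ⟨.seq (.push .res bar) <| .seq q <| .seq (moveUnary .res .aux) <| .seq (.push .res bar) <|
      .seq p <| .seq (tickLoop .aux (.case .res fun o =>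
        bif notTick o then .push .res bar else .skip))
      <| .seq (moveUnary .res .aux) (tickLoop .aux (.push .res tick)),
    P + Q + 5 * W + 4 * V + 8, V, fun x c M hx hc => ⟨?_, fun E F R O => ?_⟩⟩
  · exact (Nat.sub_le _ _).trans (hp x c M hx hc).1
  · obtain ⟨hV, hp⟩ := hp x c M hx hc
    obtain ⟨hW, hq⟩ := hq x c M hx hc
    set I : List (Sym A B) := (enc x).map (.inr ∘ .inl)
    set E' := ctxStack k c ++ E
    beta_reduce
    generalize f x c = n at *
    generalize g x c = m at *
    have h1 := Runs.tickLoop (k := .aux)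
      (c := .case .res fun o =>
        bif notTick o then .push .res bar else .skip) (t := 2) (n := m)
      (fun i => ⟨I, [], E', unary (m - i) ++ bar :: F, unary (n - i) ++ bar :: R, O⟩) F hW
      (fun i hi => rfl) (by
        intro i hi
        refine Runs.case (t := 1) ?_
        rcases Nat.lt_or_ge i n with h | h
        · have h3 : n - i = n - (i + 1) + 1 := by omega
          simp only [h3]
          exact Runs.skip _
        · have h3 : n - i = 0 := by omega
          have h4 : n - (i + 1) = 0 := by omega
          simp only [h3, h4]
          exact Runs.push _ _ _)
    have h2 := Runs.tickLoop (k := .aux) (c := .push .res tick) (t := 1) (n := n - m)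
      (N := V.eval M)
      (fun i => ⟨I, [], E', unary (n - m - i) ++ bar :: F, unary i ++ R, O⟩) F (by omega)
      (fun i hi => rfl) (fun i hi => Runs.push _ _ _)
    refine ((Runs.push ⟨I, [], E', F, R, O⟩ .res bar).seq ((hq E F _ O).seq
      ((runs_moveUnary_res_aux I E' F R O hW).seq
      ((Runs.push ⟨I, [], E', unary m ++ bar :: F, R, O⟩ .res bar).seq
      ((hp E _ _ O).seq (Runs.seq (s₂ := ⟨I, [], E', F, unary (n - m) ++ bar :: R, O⟩)
        (by simpa [Store.get, Store.set] using h1)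
      ((runs_moveUnary_res_aux I E' F R O (N := V.eval M) (by omega)).seq
      (by simpa [Store.get, Store.set] using h2)))))))).mono ?_
    simp
    omega

/-- The new variable is bounded by `V.eval M`, so the body runs with all variables at most `M +
V.eval M`; this explains the composition with `.X + V`. -/
theorem NumProgram.sum {k : ℕ} {e : X → Ctx k → ℕ} {f : X → Ctx (k + 1) → ℕ}
    (he : NumProgram B enc k e) (hf : NumProgram B enc (k + 1) f) :
    NumProgram B enc k fun x c => ∑ i ∈ Finset.range (e x c), f x (c, i) := by
  obtain ⟨p, P, V, hp⟩ := he
  obtain ⟨q, Q, W, hq⟩ := hf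
  refine ⟨forCmd p q, P + V * Q.comp (.X + V) + 6 * V + 6, V * W.comp (.X + V),
    fun x c M hx hc => ?_⟩
  obtain ⟨hV, hp⟩ := hp x c M hx hc
  have hq' : ∀ i < e x c, _ := fun i hi => hq x (c, i) (M + V.eval M) (by omega)
    ⟨by change i ≤ _; omega, hc.mono (by omega)⟩
  constructor
  · calc ∑ i ∈ Finset.range (e x c), f x (c, i)
        ≤ ∑ i ∈ Finset.range (e x c), W.eval (M + V.eval M) :=
          Finset.sum_le_sum fun i hi => (hq' i (Finset.mem_range.1 hi)).1
      _ = e x c * W.eval (M + V.eval M) := by simp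
      _ ≤ V.eval M * W.eval (M + V.eval M) := by gcongr
      _ = _ := by simp
  · intro E F R O
    have := runs_forCmd (q := q) (F := F) (e x c) (V.eval M) _ (Q.eval (M + V.eval M)) hV
      (fun n => unary (∑ i ∈ Finset.range n, f x (c, i)) ++ R) (fun _ => O)
      (fun F R O => hp E F R O) (by
        intro i hi F
        have h := (hq' i hi).2 E F (unary (∑ i ∈ Finset.range i, f x (c, i)) ++ R) O
        rw [← List.append_assoc, ← List.replicate_add, add_comm (f x (c, i)),
          ← Finset.sum_range_succ] at h
        simpa [ctxStack] using h)
    simpa using this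

open Classical in
theorem NumProgram.sym {k : ℕ} {f : X → Ctx k → ℕ} (S : A → Prop) (hf : NumProgram B enc k f) :
    NumProgram B enc k fun x c => if ∃ a ∈ (enc x)[f x c]?, S a then 1 else 0 := by
  obtain ⟨p, P, V, hp⟩ := hf
  refine ⟨.seq (.push .res bar) <| .seq p <|
      .seq (tickLoop .res (.case .inp fun o => o.elim .skip fun s => .push .buf s)) <|
      .seq (.case .inp fun o => o.elim .skip fun s => .seq (.push .inp s)
        (if ∃ a, s = .inr (.inl a) ∧ S a then .push .res tick else .skip)) <|
      moveAll .buf .inp .skip, P + 3 * V + 3 * .X + 6, 1,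
      fun x c M hx hc => ⟨?_, fun E F R O => ?_⟩⟩
  · simp only [Polynomial.eval_one]
    split_ifs <;> omega
  · obtain ⟨hV, hp⟩ := hp x c M hx hc
    set I : List (Sym A B) := (enc x).map (.inr ∘ .inl) with hI
    set E' := ctxStack k c ++ E
    beta_reduce
    generalize f x c = n at *
    have h1 := Runs.tickLoop (k := .res)
      (c := .case .inp fun o => o.elim .skip fun s => .push .buf s) (t := 2) (n := n)
      (fun i => ⟨I.drop i, (I.take i).reverse, E', F, unary (n - i) ++ bar :: R, O⟩) R hV
      (fun i hi => rfl) (by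
        intro i hi
        refine Runs.case (t := 1) ?_
        change Runs (Option.elim (I.drop i).head? _ _)
          (⟨(I.drop i).tail, (I.take i).reverse, E', F, _, O⟩) _ 1
        rw [List.tail_drop, List.head?_drop]
        rcases Nat.lt_or_ge i I.length with h | h
        · rw [List.getElem?_eq_getElem h, List.take_add_one, List.getElem?_eq_getElem h]
          simp only [Option.toList_some, List.reverse_append, List.reverse_cons, List.reverse_nil,
            List.nil_append, List.singleton_append]
          exact Runs.push _ _ _
        · rw [List.getElem?_eq_none h, List.take_add_one, List.getElem?_eq_none h]
          simp only [Option.toList_none, List.append_nil]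
          exact Runs.skip _)
    have h2 : Runs (.case .inp fun o => o.elim .skip fun s => .seq (.push .inp s)
        (if ∃ a, s = .inr (.inl a) ∧ S a then .push .res tick else .skip))
        ⟨I.drop n, (I.take n).reverse, E', F, R, O⟩
        ⟨I.drop n, (I.take n).reverse, E', F,
          unary (if ∃ a ∈ (enc x)[n]?, S a then 1 else 0) ++ R, O⟩ (1 + 2) := by
      refine Runs.case ?_
      change Runs (Option.elim (I.drop n).head? _ _)
          (⟨(I.drop n).tail, (I.take n).reverse, E', F, _, O⟩) _ 2
      rw [List.head?_drop, hI, List.getElem?_map, ← hI]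
      rcases Nat.lt_or_ge n (enc x).length with h | h
      · have hn : n < I.length := by simpa [hI] using h
        have hIn : I[n] = .inr (.inl (enc x)[n]) := by simp [hI]
        rw [List.getElem?_eq_getElem h, List.drop_eq_getElem_cons hn, hIn]
        simp only [Option.map_some, Option.elim_some, Function.comp_apply, Sum.inr.injEq,
          Sum.inl.injEq, exists_eq_left', Option.mem_def, Option.some.injEq, List.tail_cons]
        refine (Runs.push _ _ _).seq (t₂ := 1) ?_
        split_ifs
        · exact Runs.push _ _ _
        · exact Runs.skip _
      · have hn : I.length ≤ n := by simpa [hI] using h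
        rw [List.getElem?_eq_none h, List.drop_eq_nil_of_le hn]
        simpa using (Runs.skip _).mono (T' := 2) (by omega)
    have h3 := runs_moveAll_buf_inp (I.take n).reverse (I.drop n) E' F
      (unary (if ∃ a ∈ (enc x)[n]?, S a then 1 else 0) ++ R) O (N := M) (by simp [hI]; omega)
    refine ((Runs.push ⟨I, [], E', F, R, O⟩ .res bar).seq ((hp E F _ O).seq
      (Runs.seq (s₂ := ⟨I.drop n, (I.take n).reverse, E', F, R, O⟩)
        (by simpa [Store.get, Store.set] using h1) (h2.seq (by simpa using h3))))).mono ?_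
    simp
    omega

theorem Num.numProgram {k : ℕ} {f : X → Ctx k → ℕ} (h : Num enc k f) : NumProgram B enc k f := by
  induction h with
  | last => exact numProgram_last
  | weak _ ih => exact ih.weak
  | const m => exact numProgram_const m
  | len => exact numProgram_len
  | add _ _ ihf ihg => exact ihf.add ihg
  | sub _ _ ihf ihg => exact ihf.sub ihg
  | sum' _ _ ihe ihf => exact ihe.sum ihf
  | sym' S _ ih => exact ih.sym S

/-- The stack `out` grows at its top and holds the word reversed, so concatenation of words is
succession of programs. -/
theorem Out.outProgram {k : ℕ} {f : X → Ctx k → List B} (h : Out enc B k f) :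
    OutProgram B enc k f := by
  induction h with
  | nil => exact ⟨.skip, 1, 0, fun x c M _ _ => ⟨by simp, fun E F R O => by
      simpa using Runs.skip _⟩⟩
  | emit b => exact ⟨.push .out (.inr (.inr b)), 1, 1, fun x c M _ _ => ⟨by simp, fun E F R O => by
      rw [Polynomial.eval_one]
      exact Runs.push _ _ _⟩⟩
  | @weak k f hf ihf =>
    obtain ⟨p, P, V, hp⟩ := ihf
    refine ⟨.seq (moveUnary .env .aux) (.seq p (moveUnary .aux .env)), P + 4 * .X + 4, V,
      fun x c M hx hc => ⟨(hp x c.1 M hx hc.2).1, fun E F R O => ?_⟩⟩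
    obtain ⟨c, n⟩ := c
    have hE : ctxStack (k + 1) (c, n) ++ E = unary n ++ bar :: (ctxStack k c ++ E) := by
      simp [ctxStack]
    rw [hE]
    refine ((runs_moveUnary_env_aux _ _ F R O hc.1).seq (((hp x c M hx hc.2).2 _ _ _ _).seq
      (runs_moveUnary_aux_env _ _ _ _ _ hc.1))).mono ?_
    simp
    omega
  | @append k f g hf hg ihf ihg =>
    obtain ⟨p, P, V, hp⟩ := ihf
    obtain ⟨q, Q, W, hq⟩ := ihg
    refine ⟨.seq p q, P + Q, V + W, fun x c M hx hc => ⟨?_, fun E F R O => ?_⟩⟩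
    · simpa using add_le_add (hp x c M hx hc).1 (hq x c M hx hc).1
    · simpa using ((hp x c M hx hc).2 E F R O).seq ((hq x c M hx hc).2 E F R _)
  | @flatMap' k e f he hf ihf =>
    obtain ⟨p, P, V, hp⟩ := he.numProgram (B := B)
    obtain ⟨q, Q, W, hq⟩ := ihf
    refine ⟨forCmd p q, P + V * Q.comp (.X + V) + 6 * V + 6, V * W.comp (.X + V),
      fun x c M hx hc => ?_⟩
    obtain ⟨hV, hp⟩ := hp x c M hx hc
    have hq' : ∀ i < e x c, _ := fun i hi => hq x (c, i) (M + V.eval M) (by omega)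
      ⟨by change i ≤ _; omega, hc.mono (by omega)⟩
    constructor
    · rw [List.length_flatMap]
      calc ((List.range (e x c)).map fun i => (f x (c, i)).length).sum
          ≤ ((List.range (e x c)).map fun i => W.eval (M + V.eval M)).sum :=
            List.sum_le_sum fun i hi => (hq' i (List.mem_range.1 hi)).1
        _ = e x c * W.eval (M + V.eval M) := by simp
        _ ≤ V.eval M * W.eval (M + V.eval M) := by gcongr
        _ = _ := by simp
    · intro E F R O
      have := runs_forCmd (q := q) (F := F) (e x c) (V.eval M) _ (Q.eval (M + V.eval M)) hV
        (fun _ => R)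
        (fun n => (((List.range n).flatMap fun i => f x (c, i)).map (.inr ∘ .inr)).reverse ++ O)
        (fun F R O => hp E F R O) (by
          intro i hi F
          have h := (hq' i hi).2 E F R
            ((((List.range i).flatMap fun i => f x (c, i)).map (.inr ∘ .inr)).reverse ++ O)
          rw [← List.append_assoc, ← List.reverse_append, ← List.map_append,
            show (List.range i).flatMap (fun i => f x (c, i)) ++ f x (c, i) =
              (List.range (i + 1)).flatMap (fun i => f x (c, i)) by
              simp [List.range_succ]] at h
          simpa [ctxStack] using h)
      simpa using this

end Compile

/-- A translation of instances that can be written by bounded loops is a reduction. -/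
theorem reducible_of_out {P Q : DecisionProblem} [hQ : Nonempty Q.Alphabet]
    (f : P.Instance → Q.Instance)
    (hf : Out P.encode Q.Alphabet 0 fun x _ => Q.encode (f x))
    (hyes : ∀ x, P.Yes x ↔ Q.Yes (f x)) : P ≤ᴾₜ Q := by
  classical
  have := P.finAlphabet
  have := Q.finAlphabet
  obtain ⟨p, T, V, hp⟩ := hf.outProgram
  -- Moving `out` to `buf` undoes the reversal. Symbols other than output letters do not occur in
  -- the query and are read as an arbitrary letter. Of the extra time `3 * V + 3`, the move takes `3
  -- * V + 1`, and query and halting take two.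
  refine ⟨toOracleTM (S := Sym P.Alphabet Q.Alphabet) (.inr ∘ .inl)
    (Sum.elim (fun _ => hQ.some) (Sum.elim (fun _ => hQ.some) id)) tick
    (.seq p (moveAll .out .buf .skip)), T + 3 * V + 3, fun O hO x => ?_⟩
  obtain ⟨hV, hp⟩ := hp x () (P.encode x).length le_rfl trivial
  have h1 := hp [] [] [] []
  have h2 := runs_moveAll_out_buf
    ((Q.encode (f x)).map (.inr ∘ .inr)).reverse ((P.encode x).map (.inr ∘ .inl)) [] [] [] []
    (A := P.Alphabet) (N := V.eval (P.encode x).length) (by simpa using hV)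
  rw [List.append_nil, List.append_nil] at h1
  obtain ⟨t, ht, e⟩ := h1.seq h2
  have h3 := toOracleTM_answersWithin (T := (T + 3 * V + 3).eval (P.encode x).length)
    (.inr ∘ .inl) (Sum.elim (fun _ => hQ.some) (Sum.elim (fun _ => hQ.some) id)) tick _ O
    (P.encode x) _ e rfl (by simp; omega)
  have h4 : (((Q.encode (f x)).map (Sum.inr ∘ Sum.inr : _ → Sym P.Alphabet _)).reverse.reverse
      ++ []).map (Sum.elim (fun _ => hQ.some) (Sum.elim (fun _ => hQ.some) id)) =
      Q.encode (f x) := by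
    simp [Function.comp_def]
  rw [h4, hO, ← hyes] at h3
  exact h3

end StackProgram

/-! ## Commutation of vectors relative to a graph -/

namespace GraphComm

variable {V W F : Type*} [Field F]

/-- All minors of `x` and `y` at non-adjacent vertices vanish. -/
def Comm (Γ : SimpleGraph V) (x y : V → F) : Prop :=
  ∀ k l, k ≠ l → ¬ Γ.Adj k l → x k * y l = x l * y k

namespace Comm

variable {Γ : SimpleGraph V} {x y z : V → F}

theorem refl (x : V → F) : Comm Γ x x := fun _ _ _ _ => mul_comm _ _

theorem symm (h : Comm Γ x y) : Comm Γ y x := fun k l hkl hn => by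
  linear_combination -h k l hkl hn

theorem add (h₁ : Comm Γ x y) (h₂ : Comm Γ x z) : Comm Γ x (y + z) := fun k l hkl hn => by
  simp only [Pi.add_apply]
  linear_combination h₁ k l hkl hn + h₂ k l hkl hn

theorem smul (c : F) (h : Comm Γ x y) : Comm Γ x (c • y) := fun k l hkl hn => by
  simp only [Pi.smul_apply, smul_eq_mul]
  linear_combination c * h k l hkl hn

theorem zero (x : V → F) : Comm Γ x 0 := fun k l _ _ => by simp

end Comm

/-- The vectors commuting with `x`. -/
def centralizer (Γ : SimpleGraph V) (x : V → F) : Submodule F (V → F) where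
  carrier := {y | Comm Γ x y}
  add_mem' := Comm.add
  zero_mem' := Comm.zero x
  smul_mem' c _ h := h.smul c

theorem finrank_spanSubset [Fintype V] (s : Finset V) :
    Module.finrank F (Pi.spanSubset F (s : Set V)) = s.card := by
  rw [Pi.dim_spanSubset, Set.ncard_coe_finset]

/-- The minors of `x` and `y` in the coordinates `k` and `l` determine `y l` from `y k` for every
`l` not adjacent to `k`. Hence `y` minus its multiple of `x` is supported on the neighbours of `k`.
-/
theorem centralizer_le [Fintype V] (Γ : SimpleGraph V) [DecidableRel Γ.Adj] {x : V → F} {k : V}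
    (hk : x k ≠ 0) :
    centralizer Γ x ≤ Submodule.span F {x} ⊔ Pi.spanSubset F (Γ.neighborFinset k : Set V) := by
  intro y hy
  rw [Submodule.mem_sup]
  refine ⟨(y k / x k) • x, Submodule.smul_mem _ _ (Submodule.mem_span_singleton_self x),
    y - (y k / x k) • x, ?_, by abel⟩
  rw [Pi.mem_spanSubset_iff]
  intro l hl
  have hl : ¬ Γ.Adj k l := by simpa using hl
  simp only [Pi.sub_apply, Pi.smul_apply, smul_eq_mul]
  by_cases hkl : k = l
  · subst hkl
    field_simp
    ring
  · have := hy k l hkl hl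
    field_simp
    linear_combination this

variable [Fintype V] [Fintype W] [DecidableEq V] [DecidableEq W]

/-- `φ` maps adjacent basis vectors to commuting vectors. -/
def MapsEdges (Γ : SimpleGraph V) (Δ : SimpleGraph W) (φ : (V → F) ≃ₗ[F] (W → F)) : Prop :=
  ∀ i j, Γ.Adj i j → Comm Δ (φ (Pi.single i 1)) (φ (Pi.single j 1))

-- The determinant of an invertible matrix has a non-zero term in its Leibniz expansion; `ε` only
-- serves to make the matrix square over one index set.
omit [DecidableEq W] in
theorem exists_diagonal (φ : (V → F) ≃ₗ[F] (W → F)) :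
    ∃ σ : V ≃ W, ∀ i, φ (Pi.single i 1) (σ i) ≠ 0 := by
  have hcard : Fintype.card V = Fintype.card W := by
    simpa using φ.finrank_eq
  let ε : V ≃ W := Fintype.equivOfCardEq hcard
  let ψ : (V → F) ≃ₗ[F] (V → F) := φ.trans (LinearEquiv.funCongrLeft F F ε)
  have hdet := (LinearEquiv.isUnit_det ψ (Pi.basisFun F V) (Pi.basisFun F V)).ne_zero
  rw [Matrix.det_apply] at hdet
  obtain ⟨τ, -, hτ⟩ := Finset.exists_ne_zero_of_sum_ne_zero hdet
  have hτ' := right_ne_zero_of_smul hτ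
  rw [Finset.prod_ne_zero_iff] at hτ'
  refine ⟨τ.trans ε, fun i => ?_⟩
  have := hτ' i (Finset.mem_univ i)
  simpa [LinearMap.toMatrix_apply, ψ, LinearEquiv.funCongrLeft, LinearMap.funLeft] using this

/-! ### Comparison of degrees, dominance and elimination -/

section Diagonal

variable {Γ : SimpleGraph V} {Δ : SimpleGraph W} [DecidableRel Γ.Adj] [DecidableRel Δ.Adj]
  {φ : (V → F) ≃ₗ[F] (W → F)} (hφ : MapsEdges Γ Δ φ)
include hφ

omit [Fintype W] [DecidableEq W] [DecidableRel Δ.Adj] in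
theorem MapsEdges.map_star_le (i : V) :
    (Pi.spanSubset F (insert i (Γ.neighborFinset i) : Finset V)).map (φ : (V → F) →ₗ[F] W → F) ≤
      centralizer Δ (φ (Pi.single i 1)) := by
  rw [Pi.spanSubset, Submodule.map_span, Submodule.span_le]
  rintro _ ⟨_, ⟨j, hj, rfl⟩, rfl⟩
  simp only [Finset.coe_insert, Set.mem_insert_iff, Finset.mem_coe,
    SimpleGraph.mem_neighborFinset] at hj
  rw [Pi.basisFun_apply]
  rcases hj with rfl | hj
  · exact Comm.refl _
  · exact hφ _ _ hj

-- The vectors supported on `i` and its neighbours form a space of dimension `Γ.degree i + 1`. It is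
-- mapped injectively into the centralizer of `φ (Pi.single i 1)`, which has dimension at most
-- `Δ.degree k + 1`.
omit [DecidableEq W] in
theorem MapsEdges.degree_le {i : V} {k : W} (hk : φ (Pi.single i 1) k ≠ 0) :
    Γ.degree i ≤ Δ.degree k := by
  have h1 := Submodule.finrank_mono ((hφ.map_star_le i).trans (centralizer_le Δ hk))
  rw [LinearEquiv.finrank_map_eq, finrank_spanSubset, Finset.card_insert_of_notMem (by simp)] at h1
  have h2 := Submodule.finrank_add_le_finrank_add_finrank
    (Submodule.span F {φ (Pi.single i 1)}) (Pi.spanSubset F (Δ.neighborFinset k : Set W))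
  have h3 : Module.finrank F (Submodule.span F {φ (Pi.single i 1)}) ≤ 1 := by
    simpa using finrank_span_le_card (R := F) ({φ (Pi.single i 1)} : Set (W → F))
  rw [finrank_spanSubset] at h2
  simp only [SimpleGraph.card_neighborFinset_eq_degree] at h1 h2
  omega

theorem MapsEdges.sum_degree_le : ∑ i, Γ.degree i ≤ ∑ k, Δ.degree k := by
  obtain ⟨σ, hσ⟩ := exists_diagonal φ
  rw [← Equiv.sum_comp σ]
  exact Finset.sum_le_sum fun i _ => hφ.degree_le (hσ i)

variable (hdeg : ∑ k, Δ.degree k ≤ ∑ i, Γ.degree i) {σ : V ≃ W}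
  (hσ : ∀ i, φ (Pi.single i 1) (σ i) ≠ 0)
include hdeg hσ

/-- The degrees are compared termwise along `σ`, while their sums satisfy the opposite inequality.
-/
theorem MapsEdges.degree_eq (i : V) : Γ.degree i = Δ.degree (σ i) := by
  rw [← Equiv.sum_comp σ] at hdeg
  have h := fun i (_ : i ∈ Finset.univ) => hφ.degree_le (hσ i)
  exact (Finset.sum_eq_sum_iff_of_le h).1 (le_antisymm (Finset.sum_le_sum h) hdeg) i
    (Finset.mem_univ i)

/-- With equal degrees, the inclusions behind `degree_le` are between spaces of the same dimension.
-/
theorem MapsEdges.map_star_eq (i : V) :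
    (Pi.spanSubset F (insert i (Γ.neighborFinset i) : Finset V)).map (φ : (V → F) →ₗ[F] W → F) =
      Submodule.span F {φ (Pi.single i 1)} ⊔
        Pi.spanSubset F (Δ.neighborFinset (σ i) : Set W) := by
  refine Submodule.eq_of_le_of_finrank_le ((hφ.map_star_le i).trans (centralizer_le Δ (hσ i))) ?_
  have h2 := Submodule.finrank_add_le_finrank_add_finrank
    (Submodule.span F {φ (Pi.single i 1)}) (Pi.spanSubset F (Δ.neighborFinset (σ i) : Set W))
  have h3 : Module.finrank F (Submodule.span F {φ (Pi.single i 1)}) ≤ 1 := by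
    simpa using finrank_span_le_card (R := F) ({φ (Pi.single i 1)} : Set (W → F))
  rw [LinearEquiv.finrank_map_eq, finrank_spanSubset, Finset.card_insert_of_notMem (by simp)]
  rw [finrank_spanSubset] at h2
  simp only [SimpleGraph.card_neighborFinset_eq_degree] at h2 ⊢
  have := hφ.degree_eq hdeg hσ i
  omega

/-- If `φ` has a non-zero entry in the row `σ i` and the column `j`, then `i` dominates `j`. -/
theorem MapsEdges.dominates {i j l : V} (hj : φ (Pi.single j 1) (σ i) ≠ 0) (hl : Γ.Adj j l) :
    l = i ∨ Γ.Adj i l := by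
  have h1 : φ (Pi.single l 1) ∈ Submodule.span F {φ (Pi.single j 1)} ⊔
      Pi.spanSubset F (Δ.neighborFinset (σ i) : Set W) := centralizer_le Δ hj (hφ j l hl)
  have h2 : Pi.spanSubset F (Δ.neighborFinset (σ i) : Set W) ≤
      (Pi.spanSubset F (insert i (Γ.neighborFinset i) : Finset V)).map
        (φ : (V → F) →ₗ[F] W → F) := by
    rw [hφ.map_star_eq hdeg hσ]
    exact le_sup_right
  obtain ⟨a, ha, b, hb, hab⟩ := Submodule.mem_sup.1 (sup_le_sup_left h2 _ h1)
  obtain ⟨c, rfl⟩ := Submodule.mem_span_singleton.1 ha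
  obtain ⟨w, hw, rfl⟩ := hb
  -- Here `w` is supported on `i` and its neighbours. As `l ≠ j`, the coordinate `l` of the
  -- right-hand side can only come from `w`.
  have h3 : c • Pi.single j 1 + w = Pi.single l 1 := φ.injective (by simpa using hab)
  by_contra! hcon
  have hwl : w l = 0 := Pi.mem_spanSubset_iff.1 hw l (by simpa using hcon)
  have h4 := congrFun h3 l
  simp [hwl, hl.ne'] at h4

/-- Elimination of the entries in the row `σ i` outside the column `i`. -/
theorem MapsEdges.eliminate (i : V) :
    ∃ φ' : (V → F) ≃ₗ[F] (W → F), MapsEdges Γ Δ φ' ∧ ∃ c : V → F,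
      ∀ j, φ' (Pi.single j 1) = φ (Pi.single j 1) - c j • φ (Pi.single i 1) ∧
        (j ≠ i → φ' (Pi.single j 1) (σ i) = 0) := by
  let c : V → F := fun j =>
    if j = i then 0 else φ (Pi.single j 1) (σ i) / φ (Pi.single i 1) (σ i)
  let f : Module.Dual F (V → F) := -∑ j, c j • LinearMap.proj j
  have hf : ∀ j, f (Pi.single j 1) = - c j := by
    intro j
    simp [f, Pi.single_apply]
  -- Since `c i = 0`, all column operations together are a single transvection, hence invertible.
  let φ' := (LinearEquiv.transvection (f := f) (v := Pi.single i 1)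
    (by rw [hf]; simp [c])).trans φ
  have hφ' : ∀ j, φ' (Pi.single j 1) = φ (Pi.single j 1) - c j • φ (Pi.single i 1) := by
    intro j
    simp [φ', LinearMap.transvection.apply, hf, sub_eq_add_neg]
  have hc : ∀ {j l}, c j ≠ 0 → Γ.Adj j l →
      Comm Δ (φ (Pi.single i 1)) (φ (Pi.single l 1)) := by
    intro j l hj hjl
    have : φ (Pi.single j 1) (σ i) ≠ 0 := by
      intro h
      simp [c, h] at hj
    rcases hφ.dominates hdeg hσ this hjl with rfl | h
    · exact Comm.refl _
    · exact hφ _ _ h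
  have hc' : ∀ {j l}, Γ.Adj j l →
      Comm Δ (-(c j) • φ (Pi.single i 1)) (φ (Pi.single l 1)) := by
    intro j l hjl
    by_cases hj : c j = 0
    · rw [hj, neg_zero, zero_smul]
      exact (Comm.zero _).symm
    · exact ((hc hj hjl).symm.smul _).symm
  refine ⟨φ', fun j l hjl => ?_, c, fun j => ⟨hφ' j, fun hj => ?_⟩⟩
  -- Expand bilinearly. The mixed terms commute because a non-zero `c j` makes `i` dominate `j`, and
  -- the last term involves only multiples of one vector.
  · rw [hφ', hφ', sub_eq_add_neg, sub_eq_add_neg, ← neg_smul, ← neg_smul]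
    refine Comm.add (Comm.symm (Comm.add (hφ _ _ hjl).symm (hc' hjl).symm)) (Comm.symm ?_)
    exact Comm.add (hc' hjl.symm) (((Comm.refl _).smul _).symm.smul _)
  · rw [hφ' j]
    have := hσ i
    simp [c, hj, div_mul_cancel₀ _ this]

end Diagonal

/-- Gaussian elimination by induction on `s`, outside which every row has at most one non-zero
entry. The diagonal `σ` is chosen afresh at each stage, since the elimination may destroy the old
one. -/
theorem nonempty_iso_of_sum_degree_le {Γ : SimpleGraph V} {Δ : SimpleGraph W}
    [DecidableRel Γ.Adj] [DecidableRel Δ.Adj] (hdeg : ∑ k, Δ.degree k ≤ ∑ i, Γ.degree i) (m : ℕ)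
    (φ : (V → F) ≃ₗ[F] (W → F)) (hφ : MapsEdges Γ Δ φ) (s : Finset W)
    (hs : ∀ k ∉ s, ∃ i, ∀ j, j ≠ i → φ (Pi.single j 1) k = 0) (hm : s.card = m) :
    Nonempty (Γ ≃g Δ) := by
  obtain ⟨σ, hσ⟩ := exists_diagonal φ
  induction m generalizing φ s σ with
  | zero =>
    rw [Finset.card_eq_zero] at hm
    subst hm
    -- No rows are left, so the only possible non-zero entry in each row is the diagonal one.
    have hzero : ∀ i j, j ≠ i → φ (Pi.single j 1) (σ i) = 0 := by
      intro i j hji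
      obtain ⟨i', hi'⟩ := hs (σ i) (by simp)
      have : i = i' := by
        by_contra h
        exact hσ i (hi' i h)
      exact hi' j (this ▸ hji)
    have hadj : ∀ i j, Γ.Adj i j → Δ.Adj (σ i) (σ j) := by
      intro i j hij
      by_contra hn
      have := hφ i j hij (σ i) (σ j) (σ.injective.ne hij.ne) hn
      rw [hzero i j hij.ne', hzero j i hij.ne, mul_zero, mul_eq_zero] at this
      exact this.elim (hσ i) (hσ j)
    refine ⟨⟨σ, fun {i j} => ⟨fun h => ?_, hadj i j⟩⟩⟩
    -- Adjacency is so far only preserved; equality of degrees makes neighbourhoods correspond, so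
    -- it is also reflected.
    have hsub : (Γ.neighborFinset i).map σ.toEmbedding ⊆ Δ.neighborFinset (σ i) := by
      intro k hk
      obtain ⟨l, hl, rfl⟩ := Finset.mem_map.1 hk
      exact (SimpleGraph.mem_neighborFinset _ _ _).2 (hadj i l (by simpa using hl))
    have heq := Finset.eq_of_subset_of_card_le hsub
      (by simp [hφ.degree_eq hdeg hσ i])
    have h' : σ j ∈ (Γ.neighborFinset i).map σ.toEmbedding := by
      rw [heq]
      simpa using h
    simpa using h'
  | succ m ih =>
    obtain ⟨k, hk⟩ : s.Nonempty := Finset.card_pos.1 (by omega)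
    obtain ⟨i, rfl⟩ := σ.surjective k
    obtain ⟨φ', hφ', c, hc⟩ := hφ.eliminate hdeg hσ i
    obtain ⟨τ, hτ⟩ := exists_diagonal φ'
    refine ih φ' hφ' (s.erase (σ i)) (fun k hks => ?_) (by rw [Finset.card_erase_of_mem hk]; omega)
      τ hτ
    by_cases hki : k = σ i
    · exact ⟨i, fun j hj => hki ▸ (hc j).2 hj⟩
    · obtain ⟨i', hi'⟩ := hs k (fun h => hks (Finset.mem_erase.2 ⟨hki, h⟩))
      obtain ⟨l, rfl⟩ := σ.surjective k
      have hl : l = i' := by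
        by_contra h
        exact hσ l (hi' l h)
      -- A cleared row has zero in column `i`, because its only non-zero entry is in column `i'`;
      -- subtracting multiples of column `i` leaves it unchanged.
      have hil : i ≠ i' := fun h => hki (by rw [hl, h])
      refine ⟨i', fun j hj => ?_⟩
      rw [(hc j).1]
      simp [hi' j hj, hi' i hil]

/-- Only the comparison of degree sums is taken from `ψ`, which need not be the inverse of `φ`. -/
theorem nonempty_iso_of_mapsEdges {Γ : SimpleGraph V} {Δ : SimpleGraph W}
    (φ : (V → F) ≃ₗ[F] (W → F)) (hφ : MapsEdges Γ Δ φ) (ψ : (W → F) ≃ₗ[F] (V → F))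
    (hψ : MapsEdges Δ Γ ψ) : Nonempty (Γ ≃g Δ) := by
  classical
  exact nonempty_iso_of_sum_degree_le hψ.sum_degree_le _ φ hφ Finset.univ (by simp) rfl

end GraphComm

/-! ## Presented algebras -/

theorem NonUnitalRingHom.map_zmod_smul {n : ℕ} {A B : Type*} [NonUnitalNonAssocRing A]
    [NonUnitalNonAssocRing B] [Module (ZMod n) A] [Module (ZMod n) B] (f : A →ₙ+* B) (c : ZMod n)
    (x : A) : f (c • x) = c • f x :=
  ZMod.map_smul f.toAddMonoidHom c x

theorem ZMod.isScalarTower_of_ring (n : ℕ) [NeZero n] (A : Type*) [NonUnitalNonAssocRing A]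
    [Module (ZMod n) A] : IsScalarTower (ZMod n) A A :=
  ⟨fun c x y => (ZMod.map_smul (AddMonoidHom.mulRight y) c x)⟩

theorem ZMod.smulCommClass_of_ring (n : ℕ) [NeZero n] (A : Type*) [NonUnitalNonAssocRing A]
    [Module (ZMod n) A] : SMulCommClass (ZMod n) A A :=
  ⟨fun c x y => (ZMod.map_smul (AddMonoidHom.mulLeft x) c y).symm⟩

namespace PresentedAlg

variable {p : ℕ} {X : Type}
  {r : FreeNonUnitalNonAssocAlgebra (ZMod (p ^ 3)) X →
    FreeNonUnitalNonAssocAlgebra (ZMod (p ^ 3)) X → Prop}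

/-- The projection from the free algebra. -/
noncomputable def proj : FreeNonUnitalNonAssocAlgebra (ZMod (p ^ 3)) X →ₙ+* PresentedAlg p X r where
  toFun y := RingCon.toQuotient (c := ringConGen r) y
  map_mul' _ _ := rfl
  map_add' _ _ := rfl
  map_zero' := rfl

theorem proj_surjective : Function.Surjective (proj (r := r)) := Quotient.mk''_surjective

theorem proj_of (x : X) : proj (r := r) (.of _ x) = gen x := rfl

theorem proj_eq {a b} (h : r a b) : proj (r := r) a = proj b :=
  Quotient.sound (RingCon.le_ringConGen _ _ h)

variable [Fact p.Prime] {A : Type} [NonUnitalNonAssocRing A] [Module (ZMod (p ^ 3)) A]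

theorem hom_ext {f g : PresentedAlg p X r →ₙ+* A} (h : ∀ x, f (gen x) = g (gen x)) : f = g := by
  have := ZMod.isScalarTower_of_ring (p ^ 3) A
  have := ZMod.smulCommClass_of_ring (p ^ 3) A
  have key : ∀ f : PresentedAlg p X r →ₙ+* A, ∃ F : FreeNonUnitalNonAssocAlgebra (ZMod (p ^ 3)) X
      →ₙₐ[ZMod (p ^ 3)] A, ∀ y, F y = f (proj y) := fun f =>
    ⟨{ f.comp proj with map_smul' := fun c x => NonUnitalRingHom.map_zmod_smul _ c x },
      fun _ => rfl⟩
  obtain ⟨F, hF⟩ := key f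
  obtain ⟨G, hG⟩ := key g
  have hFG : F = G := FreeNonUnitalNonAssocAlgebra.hom_ext _ fun x => by
    rw [hF, hG, proj_of, h]
  ext y
  obtain ⟨y, rfl⟩ := proj_surjective y
  rw [← hF, ← hG, hFG]

omit [Fact (Nat.Prime p)] [Module (ZMod (p ^ 3)) A] in
/-- A homomorphism from the free algebra that respects the relations induces a homomorphism. -/
theorem exists_hom_of_free (F : FreeNonUnitalNonAssocAlgebra (ZMod (p ^ 3)) X →ₙ+* A)
    (hF : ∀ a b, r a b → F a = F b) :
    ∃ f : PresentedAlg p X r →ₙ+* A, ∀ y, f (proj y) = F y := by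
  -- The kernel congruence of `F` contains the relations, hence the congruence that they generate.
  let c : RingCon (FreeNonUnitalNonAssocAlgebra (ZMod (p ^ 3)) X) :=
    { r := fun a b => F a = F b
      iseqv := ⟨fun _ => rfl, fun h => h.symm, fun h h' => h.trans h'⟩
      add' := fun h h' => by
        rw [map_add, map_add]
        exact congrArg₂ _ h h'
      mul' := fun h h' => by
        rw [map_mul, map_mul]
        exact congrArg₂ _ h h' }
  have hc : ∀ a b, ringConGen r a b → F a = F b := fun a b h =>
    (RingCon.ringConGen_le (c := c)).2 hF h
  refine ⟨{ toFun := Quotient.lift F hc, map_mul' := ?_, map_add' := ?_, map_zero' := ?_ },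
    fun _ => rfl⟩
  · intro x y
    obtain ⟨x, rfl⟩ := proj_surjective x
    obtain ⟨y, rfl⟩ := proj_surjective y
    exact map_mul F x y
  · exact map_zero F
  · intro x y
    obtain ⟨x, rfl⟩ := proj_surjective x
    obtain ⟨y, rfl⟩ := proj_surjective y
    exact map_add F x y

/-- The relations are to be checked for any linear multiplicative `F` with the prescribed values, so
applications need only the rules for homomorphisms, not the construction of the free algebra. -/
theorem exists_hom (f : X → A)
    (h : ∀ F : FreeNonUnitalNonAssocAlgebra (ZMod (p ^ 3)) X →ₙ+* A, (∀ x, F (.of _ x) = f x) →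
      (∀ (c : ZMod (p ^ 3)) y, F (c • y) = c • F y) → ∀ a b, r a b → F a = F b) :
    ∃ g : PresentedAlg p X r →ₙ+* A, ∀ x, g (gen x) = f x := by
  have := ZMod.isScalarTower_of_ring (p ^ 3) A
  have := ZMod.smulCommClass_of_ring (p ^ 3) A
  let F := FreeNonUnitalNonAssocAlgebra.lift (ZMod (p ^ 3)) f
  have hF : ∀ x, F (.of _ x) = f x := fun x =>
    FreeNonUnitalNonAssocAlgebra.lift_of_apply _ _ _
  obtain ⟨g, hg⟩ := exists_hom_of_free (F : FreeNonUnitalNonAssocAlgebra (ZMod (p ^ 3)) X →ₙ+* A)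
    (h F hF fun c y => map_smul F c y)
  exact ⟨g, fun x => (hg _).trans (hF x)⟩

/-- If all products of generators lie in the additive span of the generators, then this span is the
whole algebra. -/
theorem closure_range_gen
    (h : ∀ x y : X, (gen x * gen y : PresentedAlg p X r) ∈ AddSubgroup.closure (Set.range gen)) :
    AddSubgroup.closure (Set.range (gen (r := r))) = ⊤ := by
  set C := AddSubgroup.closure (Set.range (gen (r := r))) with hC
  have hmul : ∀ a ∈ C, ∀ b ∈ C, a * b ∈ C := by
    intro a ha b hb
    induction ha using AddSubgroup.closure_induction with
    | mem a ha =>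
      obtain ⟨x, rfl⟩ := ha
      induction hb using AddSubgroup.closure_induction with
      | mem b hb =>
        obtain ⟨y, rfl⟩ := hb
        exact h x y
      | zero => rw [mul_zero]; exact C.zero_mem
      | add a b _ _ iha ihb => rw [mul_add]; exact C.add_mem iha ihb
      | neg a _ iha => rw [mul_neg]; exact C.neg_mem iha
    | zero => rw [zero_mul]; exact C.zero_mem
    | add a b _ _ iha ihb => rw [add_mul]; exact C.add_mem iha ihb
    | neg a _ iha => rw [neg_mul]; exact C.neg_mem iha
  let S : NonUnitalSubring (PresentedAlg p X r) :=
    { C with mul_mem' := fun ha hb => hmul _ ha _ hb }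
  let _ : Module (ZMod (p ^ 3)) S := AddCommGroup.zmodModule fun x =>
    Subtype.ext (nsmul_eq_zero x.1)
  obtain ⟨g, hg⟩ := exists_hom (r := r) (A := S)
    (fun x => ⟨gen x, AddSubgroup.subset_closure ⟨x, rfl⟩⟩) (by
      intro F hF _ a b hab
      have hcomp : ∀ y, (F y).1 = proj (r := r) y := by
        have := ZMod.isScalarTower_of_ring (p ^ 3) (PresentedAlg p X r)
        have := ZMod.smulCommClass_of_ring (p ^ 3) (PresentedAlg p X r)
        let F₁ : FreeNonUnitalNonAssocAlgebra (ZMod (p ^ 3)) X →ₙₐ[ZMod (p ^ 3)]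
          PresentedAlg p X r := { (NonUnitalSubringClass.subtype S).comp F with
            map_smul' := fun c x => NonUnitalRingHom.map_zmod_smul _ c x }
        let F₂ : FreeNonUnitalNonAssocAlgebra (ZMod (p ^ 3)) X →ₙₐ[ZMod (p ^ 3)]
          PresentedAlg p X r := { proj (r := r) with
            map_smul' := fun c x => NonUnitalRingHom.map_zmod_smul _ c x }
        have : F₁ = F₂ := FreeNonUnitalNonAssocAlgebra.hom_ext _ fun x =>
          congrArg Subtype.val (hF x)
        exact fun y => DFunLike.congr_fun this y
      exact Subtype.ext (by rw [hcomp, hcomp, proj_eq hab]))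
  -- The map into `S` followed by the inclusion fixes the generators, so it is the identity and
  -- every element lies in `S`.
  have hid : (NonUnitalSubringClass.subtype S).comp g = NonUnitalRingHom.id _ :=
    hom_ext fun x => congrArg Subtype.val (hg x)
  rw [eq_top_iff]
  intro x _
  have := DFunLike.congr_fun hid x
  change (g x).1 = x at this
  rw [← this]
  exact (g x).2

end PresentedAlg

/-! ### Algebra isomorphism over `ZMod n` as ring isomorphism -/

section AlgIso

variable {n : ℕ} {A B C : Type} [NonUnitalNonAssocRing A] [Module (ZMod n) A]
  [NonUnitalNonAssocRing B] [Module (ZMod n) B] [NonUnitalNonAssocRing C] [Module (ZMod n) C]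

theorem AlgIso.of_ringHom (f : A →ₙ+* B) (hf : Function.Bijective f) : AlgIso (ZMod n) A B :=
  ⟨{ f with map_smul' := fun c x => f.map_zmod_smul c x }, hf⟩

theorem AlgIso.exists_ringEquiv (h : AlgIso (ZMod n) A B) : Nonempty (A ≃+* B) :=
  let ⟨f, hf⟩ := h
  ⟨{ Equiv.ofBijective f hf with map_mul' := map_mul f, map_add' := map_add f }⟩

theorem AlgIso.of_ringEquiv (f : A ≃+* B) : AlgIso (ZMod n) A B :=
  .of_ringHom { f with map_zero' := map_zero f } f.bijective

theorem AlgIso.symm (h : AlgIso (ZMod n) A B) : AlgIso (ZMod n) B A :=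
  let ⟨f⟩ := h.exists_ringEquiv
  .of_ringEquiv f.symm

theorem AlgIso.trans (h : AlgIso (ZMod n) A B) (h' : AlgIso (ZMod n) B C) : AlgIso (ZMod n) A C :=
  let ⟨f⟩ := h.exists_ringEquiv
  let ⟨g⟩ := h'.exists_ringEquiv
  .of_ringEquiv (f.trans g)

end AlgIso

/-! ### A criterion for additive bases -/

section AdditiveBasis

variable {ι M : Type} [Fintype ι] [DecidableEq ι] [AddCommGroup M] {b : ι → M} {d : ι → ℕ}
  [∀ k, NeZero (d k)]

theorem exists_sum_smul (hd : ∀ k, d k • b k = 0)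
    (hspan : AddSubgroup.closure (Set.range b) = ⊤) (x : M) :
    ∃ c : (k : ι) → Fin (d k), x = ∑ k, (c k : ℕ) • b k := by
  have hx : x ∈ AddSubgroup.closure (Set.range b) := hspan ▸ AddSubgroup.mem_top x
  suffices h : ∃ z : ι → ℤ, x = ∑ k, z k • b k by
    obtain ⟨z, rfl⟩ := h
    have hpos : ∀ k, (d k : ℤ) ≠ 0 := fun k => by exact_mod_cast NeZero.ne (d k)
    refine ⟨fun k => ⟨(z k % d k).toNat, ?_⟩, Finset.sum_congr rfl fun k _ => ?_⟩
    · have h1 := Int.emod_nonneg (z k) (hpos k)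
      have h2 := Int.emod_lt_of_pos (z k) (lt_of_le_of_ne (by positivity) (hpos k).symm)
      omega
    · have h1 := Int.emod_nonneg (z k) (hpos k)
      rw [← natCast_zsmul]
      simp only [Int.toNat_of_nonneg h1]
      conv_lhs => rw [← Int.emod_add_mul_ediv (z k) (d k)]
      rw [add_zsmul, mul_comm, mul_zsmul, natCast_zsmul, hd, zsmul_zero, add_zero]
  clear hspan
  induction hx using AddSubgroup.closure_induction with
  | mem x hx =>
    obtain ⟨k, rfl⟩ := hx
    exact ⟨Pi.single k 1, by simp [Pi.single_apply]⟩
  | zero => exact ⟨0, by simp⟩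
  | add x y _ _ hx hy =>
    obtain ⟨z, rfl⟩ := hx
    obtain ⟨w, rfl⟩ := hy
    exact ⟨z + w, by simp [add_zsmul, Finset.sum_add_distrib]⟩
  | neg x _ hx =>
    obtain ⟨z, rfl⟩ := hx
    exact ⟨-z, by simp⟩

variable (Φ : M →+ ((k : ι) → ZMod (d k)))

omit [∀ (k : ι), NeZero (d k)] in
theorem map_sum_smul_apply (hΦ : ∀ k, Φ (b k) = Pi.single k 1) (c : ι → ℕ) (k : ι) :
    Φ (∑ k, c k • b k) k = c k := by
  have : ∀ i, c i • Φ (b i) k = if i = k then (c k : ZMod (d k)) else 0 := by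
    intro i
    rw [hΦ]
    by_cases h : i = k
    · subst h
      simp
    · simp [h]
  rw [map_sum, Finset.sum_apply]
  simp only [map_nsmul, Pi.smul_apply, this]
  simp

/-- Spanning and the relations `d k • b k = 0` bound the group from above; a homomorphism `Φ` to the
model bounds it from below. This is how a presentation is shown not to collapse. -/
theorem bijective_of_basis (hd : ∀ k, d k • b k = 0)
    (hspan : AddSubgroup.closure (Set.range b) = ⊤) (hΦ : ∀ k, Φ (b k) = Pi.single k 1) :
    Function.Bijective Φ := by
  constructor
  · rw [injective_iff_map_eq_zero]
    intro x hx
    obtain ⟨c, rfl⟩ := exists_sum_smul hd hspan x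
    refine Finset.sum_eq_zero fun k _ => ?_
    have h := map_sum_smul_apply Φ hΦ (fun k => c k) k
    rw [hx, Pi.zero_apply] at h
    have h' := (ZMod.natCast_eq_zero_iff _ _).1 h.symm
    rw [Nat.eq_zero_of_dvd_of_lt h' (c k).2, zero_smul]
  · intro y
    refine ⟨∑ k, (y k).val • b k, funext fun k => ?_⟩
    rw [map_sum_smul_apply Φ hΦ, ZMod.natCast_zmod_val]

theorem isAdditiveBasis_of_map (hd : ∀ k, d k • b k = 0)
    (hspan : AddSubgroup.closure (Set.range b) = ⊤) (hΦ : ∀ k, Φ (b k) = Pi.single k 1) :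
    IsAdditiveBasis b d := by
  refine ⟨fun k => ?_, fun x => ?_⟩
  · refine Nat.dvd_antisymm (addOrderOf_dvd_of_nsmul_eq_zero (hd k)) ?_
    have h := congrArg Φ (addOrderOf_nsmul_eq_zero (b k))
    rw [map_nsmul, hΦ, map_zero] at h
    have h' := congrFun h k
    rw [Pi.smul_apply, Pi.single_eq_same, Pi.zero_apply, nsmul_one] at h'
    exact (ZMod.natCast_eq_zero_iff _ _).1 h'
  · obtain ⟨c, hc⟩ := exists_sum_smul hd hspan x
    refine ⟨c, hc, fun c' hc' => funext fun k => Fin.ext ?_⟩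
    have h1 := map_sum_smul_apply Φ hΦ (fun k => c k) k
    have h2 := map_sum_smul_apply Φ hΦ (fun k => c' k) k
    rw [← hc] at h1
    rw [← hc', h1, ZMod.natCast_eq_natCast_iff'] at h2
    rw [Nat.mod_eq_of_lt (c k).2, Nat.mod_eq_of_lt (c' k).2] at h2
    exact h2.symm

end AdditiveBasis

/-! ## The structure of H-algebras -/

section HOrder

variable (p : ℕ) {n : ℕ} (Γ : SimpleGraph (Fin n))

instance [Fact p.Prime] (k : HIndex n) : NeZero (hOrder p Γ k) := by
  have hp : p ≠ 0 := (Fact.out : p.Prime).ne_zero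
  cases k with
  | inl i => exact ⟨pow_ne_zero 3 hp⟩
  | inr e =>
    refine ⟨?_⟩
    rw [hOrder]
    split_ifs
    · exact hp
    · exact pow_ne_zero 2 hp

theorem hOrder_dvd (k : HIndex n) : hOrder p Γ k ∣ p ^ 3 := by
  cases k with
  | inl i => exact dvd_rfl
  | inr e =>
    rw [hOrder]
    split_ifs
    · exact dvd_pow_self p (by norm_num)
    · exact pow_dvd_pow p (by norm_num)

variable {p Γ}

theorem hOrder_edge {e : {e : Fin n × Fin n // e.1 < e.2}} (h : Γ.Adj e.1.1 e.1.2) :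
    hOrder p Γ (.inr e) = p := if_pos h

theorem hOrder_nonedge {e : {e : Fin n × Fin n // e.1 < e.2}} (h : ¬ Γ.Adj e.1.1 e.1.2) :
    hOrder p Γ (.inr e) = p ^ 2 := if_neg h

/-- Reduction of coefficients modulo the order of a basis element. -/
noncomputable def redHom (p : ℕ) (Γ : SimpleGraph (Fin n)) (k : HIndex n) :
    ZMod (p ^ 3) →+* ZMod (hOrder p Γ k) :=
  ZMod.castHom (hOrder_dvd p Γ k) _

theorem smul_redHom_edge {e : {e : Fin n × Fin n // e.1 < e.2}} (h : Γ.Adj e.1.1 e.1.2)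
    (c : ZMod (hOrder p Γ (.inr e))) : p • c = 0 := by
  rw [nsmul_eq_mul]
  have : ((p : ℕ) : ZMod (hOrder p Γ (.inr e))) = 0 := by
    rw [ZMod.natCast_eq_zero_iff, hOrder_edge h]
  rw [this, zero_mul]

theorem smul_redHom_nonedge {e : {e : Fin n × Fin n // e.1 < e.2}} (h : ¬ Γ.Adj e.1.1 e.1.2)
    (c : ZMod (hOrder p Γ (.inr e))) : p ^ 2 • c = 0 := by
  rw [nsmul_eq_mul]
  have : ((p ^ 2 : ℕ) : ZMod (hOrder p Γ (.inr e))) = 0 := by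
    rw [ZMod.natCast_eq_zero_iff, hOrder_nonedge h]
  rw [this, zero_mul]

/-- The reduction modulo `p` of integers modulo `p³`. -/
def modP (p : ℕ) : ZMod (p ^ 3) →+* ZMod p :=
  ZMod.castHom (dvd_pow_self p (by norm_num)) _

/-- At a non-edge the modulus is p², so divisibility of p·c by it gives divisibility of c by p. At
an edge the hypothesis on `c` would be empty, and this difference makes the graph visible. -/
theorem modP_eq_zero_of_smul_redHom [Fact p.Prime] {e : {e : Fin n × Fin n // e.1 < e.2}}
    (h : ¬ Γ.Adj e.1.1 e.1.2) {c : ZMod (p ^ 3)} (hc : p • redHom p Γ (.inr e) c = 0) :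
    modP p c = 0 := by
  have hp : p.Prime := Fact.out
  obtain ⟨m, rfl⟩ := ZMod.natCast_zmod_surjective c
  rw [map_natCast] at hc ⊢
  rw [nsmul_eq_mul, ← Nat.cast_mul, ZMod.natCast_eq_zero_iff, hOrder_nonedge h, pow_two] at hc
  rw [ZMod.natCast_eq_zero_iff]
  exact Nat.dvd_of_mul_dvd_mul_left hp.pos hc

end HOrder

/-! ### The model of an H-algebra -/

/-- A concrete model of the H-algebra of `Γ`: tuples of coefficients. -/
def HModel (p : ℕ) {n : ℕ} (Γ : SimpleGraph (Fin n)) : Type :=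
  (k : HIndex n) → ZMod (hOrder p Γ k)

namespace HModel

variable {p n : ℕ} {Γ : SimpleGraph (Fin n)}

noncomputable instance : AddCommGroup (HModel p Γ) :=
  inferInstanceAs (AddCommGroup ((k : HIndex n) → ZMod (hOrder p Γ k)))

/-- The coefficient of a vertex. -/
def vert (x : HModel p Γ) (i : Fin n) : ZMod (p ^ 3) := x (.inl i)

@[simp]
theorem vert_add (x y : HModel p Γ) (i : Fin n) : (x + y).vert i = x.vert i + y.vert i := rfl

@[simp]
theorem vert_zero (i : Fin n) : (0 : HModel p Γ).vert i = 0 := rfl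

@[ext]
theorem ext {x y : HModel p Γ} (h₁ : ∀ i, x.vert i = y.vert i) (h₂ : ∀ e, x (.inr e) = y (.inr e)) :
    x = y := by
  funext k
  cases k with
  | inl i => exact h₁ i
  | inr e => exact h₂ e

noncomputable instance : Mul (HModel p Γ) where
  mul x y := fun k => match k with
    | .inl _ => 0
    | .inr e => redHom p Γ (.inr e) (x.vert e.1.1 * y.vert e.1.2 - x.vert e.1.2 * y.vert e.1.1)

theorem mul_vert (x y : HModel p Γ) (i : Fin n) : (x * y).vert i = 0 := rfl

theorem mul_inr (x y : HModel p Γ) (e : {e : Fin n × Fin n // e.1 < e.2}) :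
    (x * y) (.inr e) =
      redHom p Γ (.inr e) (x.vert e.1.1 * y.vert e.1.2 - x.vert e.1.2 * y.vert e.1.1) := rfl

theorem add_inr (x y : HModel p Γ) (e : {e : Fin n × Fin n // e.1 < e.2}) :
    (x + y) (.inr e) = x (.inr e) + y (.inr e) := rfl

noncomputable instance : NonUnitalNonAssocRing (HModel p Γ) where
  left_distrib x y z := by
    ext i
    · simp [mul_vert]
    · simp only [add_inr, mul_inr, vert_add, ← map_add]
      congr 1
      ring
  right_distrib x y z := by
    ext i
    · simp [mul_vert]
    · simp only [add_inr, mul_inr, vert_add, ← map_add]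
      congr 1
      ring
  zero_mul x := by
    ext i
    · simp [mul_vert]
    · simp only [mul_inr, vert_zero, zero_mul, sub_zero, map_zero]
      rfl
  mul_zero x := by
    ext i
    · simp [mul_vert]
    · simp only [mul_inr, vert_zero, mul_zero, sub_zero, map_zero]
      rfl

noncomputable instance : Module (ZMod (p ^ 3)) (HModel p Γ) :=
  AddCommGroup.zmodModule fun x => funext fun k => by
    change p ^ 3 • x k = 0
    rw [nsmul_eq_mul, (ZMod.natCast_eq_zero_iff _ _).2 (hOrder_dvd p Γ k), zero_mul]

/-- The standard basis of the model. -/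
noncomputable def basis (p : ℕ) (Γ : SimpleGraph (Fin n)) (k : HIndex n) : HModel p Γ :=
  Pi.single (M := fun k => ZMod (hOrder p Γ k)) k 1

theorem basis_vert (i j : Fin n) :
    (basis p Γ (.inl i)).vert j = if j = i then 1 else 0 := by
  by_cases h : j = i
  · subst h
    rw [if_pos rfl]
    exact Pi.single_eq_same (M := fun k => ZMod (hOrder p Γ k)) (.inl j) 1
  · rw [if_neg h]
    exact Pi.single_eq_of_ne (M := fun k => ZMod (hOrder p Γ k))
      (fun h' => h (Sum.inl_injective h')) 1

theorem basis_inr_vert (e : {e : Fin n × Fin n // e.1 < e.2}) (j : Fin n) :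
    (basis p Γ (.inr e)).vert j = 0 :=
  Pi.single_eq_of_ne (M := fun k => ZMod (hOrder p Γ k)) (i := .inr e) (i' := .inl j) (by simp) 1

theorem basis_inr_inr (e e' : {e : Fin n × Fin n // e.1 < e.2}) :
    basis p Γ (.inr e) (.inr e') = if e' = e then 1 else 0 := by
  by_cases h : e' = e
  · subst h
    rw [if_pos rfl]
    exact Pi.single_eq_same (M := fun k => ZMod (hOrder p Γ k)) (.inr e') 1
  · rw [if_neg h]
    exact Pi.single_eq_of_ne (M := fun k => ZMod (hOrder p Γ k))
      (fun h' => h (Sum.inr_injective h')) 1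

theorem basis_mul_edge (e : {e : Fin n × Fin n // e.1 < e.2}) :
    basis p Γ (.inl e.1.1) * basis p Γ (.inl e.1.2) = basis p Γ (.inr e) := by
  refine HModel.ext (fun i => ?_) fun e' => ?_
  · rw [mul_vert, basis_inr_vert]
  · rw [mul_inr, basis_inr_inr]
    simp only [basis_vert]
    obtain ⟨⟨a, b⟩, hab⟩ := e
    obtain ⟨⟨c, d⟩, hcd⟩ := e'
    simp only [Subtype.mk.injEq, Prod.mk.injEq]
    simp only at hab hcd
    by_cases h1 : c = a ∧ d = b
    · obtain ⟨rfl, rfl⟩ := h1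
      simp [hab.ne, hab.ne']
    · rw [if_neg h1]
      -- The second term of the minor could be non-zero only at the reversed pair, which the
      -- ordering of pairs excludes.
      have h2 : ¬ (d = a ∧ c = b) := by
        rintro ⟨rfl, rfl⟩
        exact absurd hab (lt_asymm hcd)
      have e1 : ((if c = a then 1 else 0) * if d = b then 1 else 0 : ZMod (p ^ 3)) = 0 := by
        split_ifs <;> simp_all
      have e2 : ((if d = a then 1 else 0) * if c = b then 1 else 0 : ZMod (p ^ 3)) = 0 := by
        split_ifs <;> simp_all
      rw [e1, e2, sub_zero, map_zero]

theorem basis_mul_swap (i j : Fin n) :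
    basis p Γ (.inl i) * basis p Γ (.inl j) = -(basis p Γ (.inl j) * basis p Γ (.inl i)) := by
  refine HModel.ext (fun k => ?_) fun e => ?_
  · change _ = -((basis p Γ (.inl j) * basis p Γ (.inl i)).vert k)
    simp [mul_vert]
  · change _ = -((basis p Γ (.inl j) * basis p Γ (.inl i)) (.inr e))
    rw [mul_inr, mul_inr, ← map_neg]
    congr 1
    ring

theorem mul_eq_zero_of_vert {x y : HModel p Γ} (h : (∀ i, x.vert i = 0) ∨ ∀ i, y.vert i = 0) :
    x * y = 0 := by
  ext i
  · exact mul_vert _ _ _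
  · rw [mul_inr]
    rcases h with h | h <;> simp [h] <;> rfl

end HModel

/-! ### Products and orders in H-algebras, and comparison with the model -/

namespace HAlg

variable {p n : ℕ} {Γ : SimpleGraph (Fin n)}

/-- The generator of a vertex. -/
noncomputable abbrev v (p : ℕ) (Γ : SimpleGraph (Fin n)) (i : Fin n) : HAlg p Γ :=
  hBasis p Γ (.inl i)

/-- The generator of a pair of vertices. -/
noncomputable abbrev a (p : ℕ) (Γ : SimpleGraph (Fin n)) (e : {e : Fin n × Fin n // e.1 < e.2}) :
    HAlg p Γ := hBasis p Γ (.inr e)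

theorem v_mul_self (i : Fin n) : v p Γ i * v p Γ i = 0 := PresentedAlg.proj_eq (HRel.v_sq i)

theorem v_mul_v (e : {e : Fin n × Fin n // e.1 < e.2}) : v p Γ e.1.1 * v p Γ e.1.2 = a p Γ e :=
  PresentedAlg.proj_eq (HRel.v_mul e)

theorem v_mul_v_rev (e : {e : Fin n × Fin n // e.1 < e.2}) :
    v p Γ e.1.2 * v p Γ e.1.1 = -a p Γ e :=
  (PresentedAlg.proj_eq (HRel.v_mul_rev (Γ := Γ) e)).trans
    (map_neg (PresentedAlg.proj (r := HRel p Γ)) _)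

theorem a_mul (e : {e : Fin n × Fin n // e.1 < e.2}) (k : HIndex n) :
    a p Γ e * hBasis p Γ k = 0 := by
  cases k with
  | inl i => exact PresentedAlg.proj_eq (HRel.a_mul_v e i)
  | inr e' => exact PresentedAlg.proj_eq (HRel.a_mul_a e e')

theorem mul_a (e : {e : Fin n × Fin n // e.1 < e.2}) (k : HIndex n) :
    hBasis p Γ k * a p Γ e = 0 := by
  cases k with
  | inl i => exact PresentedAlg.proj_eq (HRel.v_mul_a i e)
  | inr e' => exact PresentedAlg.proj_eq (HRel.a_mul_a e' e)

theorem order_smul (k : HIndex n) : hOrder p Γ k • hBasis p Γ k = 0 := by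
  have hproj : ∀ (m : ℕ) x, PresentedAlg.proj (r := HRel p Γ) (m • x) =
      m • PresentedAlg.proj (r := HRel p Γ) x := fun m x => map_nsmul _ m x
  cases k with
  | inl i => exact PresentedAlg.nsmul_eq_zero _
  | inr e =>
    by_cases h : Γ.Adj e.1.1 e.1.2
    · rw [hOrder_edge h]
      exact (hproj _ _).symm.trans (PresentedAlg.proj_eq (HRel.edge e h))
    · rw [hOrder_nonedge h]
      exact (hproj _ _).symm.trans (PresentedAlg.proj_eq (HRel.nonedge e h))

/-- This removes the convention `i < j` at the price of a sign, which affects neither orders nor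
vanishing of products. -/
theorem v_mul_v_cases (i j : Fin n) : (i = j ∧ v p Γ i * v p Γ j = 0) ∨
    ∃ e : {e : Fin n × Fin n // e.1 < e.2}, ((e.1.1 = i ∧ e.1.2 = j) ∨ (e.1.1 = j ∧ e.1.2 = i)) ∧
      (v p Γ i * v p Γ j = a p Γ e ∨ v p Γ i * v p Γ j = -a p Γ e) := by
  rcases lt_trichotomy i j with h | rfl | h
  · exact .inr ⟨⟨(i, j), h⟩, .inl ⟨rfl, rfl⟩, .inl (v_mul_v ⟨(i, j), h⟩)⟩
  · exact .inl ⟨rfl, v_mul_self i⟩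
  · exact .inr ⟨⟨(j, i), h⟩, .inr ⟨rfl, rfl⟩, .inr (v_mul_v_rev ⟨(j, i), h⟩)⟩

theorem v_mul_v_swap (i j : Fin n) : v p Γ i * v p Γ j = -(v p Γ j * v p Γ i) := by
  rcases lt_trichotomy i j with h | rfl | h
  · have h1 := v_mul_v (p := p) (Γ := Γ) ⟨(i, j), h⟩
    have h2 := v_mul_v_rev (p := p) (Γ := Γ) ⟨(i, j), h⟩
    dsimp only at h1 h2
    rw [h1, h2, neg_neg]
  · rw [v_mul_self, neg_zero]
  · have h1 := v_mul_v (p := p) (Γ := Γ) ⟨(j, i), h⟩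
    have h2 := v_mul_v_rev (p := p) (Γ := Γ) ⟨(j, i), h⟩
    dsimp only at h1 h2
    rw [h1, h2]

theorem v_mul_v_mul (i j : Fin n) (k : HIndex n) : v p Γ i * v p Γ j * hBasis p Γ k = 0 := by
  rcases v_mul_v_cases (p := p) (Γ := Γ) i j with ⟨-, h⟩ | ⟨e, -, h | h⟩
  · rw [h, zero_mul]
  · rw [h, a_mul]
  · rw [h, neg_mul, a_mul, neg_zero]

theorem mul_v_mul_v (i j : Fin n) (k : HIndex n) : hBasis p Γ k * (v p Γ i * v p Γ j) = 0 := by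
  rcases v_mul_v_cases (p := p) (Γ := Γ) i j with ⟨-, h⟩ | ⟨e, -, h | h⟩
  · rw [h, mul_zero]
  · rw [h, mul_a]
  · rw [h, mul_neg, mul_a, neg_zero]

theorem v_mul_v_mul_v_mul_v (i j k l : Fin n) :
    v p Γ i * v p Γ j * (v p Γ k * v p Γ l) = 0 := by
  rcases v_mul_v_cases (p := p) (Γ := Γ) i j with ⟨-, h⟩ | ⟨e, -, h | h⟩
  · rw [h, zero_mul]
  · rw [h, mul_v_mul_v]
  · rw [h, neg_mul, mul_v_mul_v, neg_zero]

theorem smul_v_mul_v_edge {i j : Fin n} (hij : Γ.Adj i j) : p • (v p Γ i * v p Γ j) = 0 := by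
  rcases v_mul_v_cases (p := p) (Γ := Γ) i j with ⟨-, h⟩ | ⟨e, he, h⟩
  · rw [h, smul_zero]
  · have hadj : Γ.Adj e.1.1 e.1.2 := by
      rcases he with ⟨h1, h2⟩ | ⟨h1, h2⟩ <;> rw [h1, h2]
      · exact hij
      · exact hij.symm
    have h0 := order_smul (p := p) (Γ := Γ) (.inr e)
    rw [hOrder_edge hadj] at h0
    rcases h with h | h <;> rw [h]
    · exact h0
    · rw [smul_neg, h0, neg_zero]

theorem smul_v_mul_v_nonedge {i j : Fin n} (hij : ¬ Γ.Adj i j) :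
    p ^ 2 • (v p Γ i * v p Γ j) = 0 := by
  rcases v_mul_v_cases (p := p) (Γ := Γ) i j with ⟨-, h⟩ | ⟨e, he, h⟩
  · rw [h, smul_zero]
  · have hadj : ¬ Γ.Adj e.1.1 e.1.2 := by
      rcases he with ⟨h1, h2⟩ | ⟨h1, h2⟩ <;> rw [h1, h2]
      · exact hij
      · exact fun h => hij h.symm
    have h0 := order_smul (p := p) (Γ := Γ) (.inr e)
    rw [hOrder_nonedge hadj] at h0
    rcases h with h | h <;> rw [h]
    · exact h0
    · rw [smul_neg, h0, neg_zero]

theorem closure_range_hBasis [Fact p.Prime] :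
    AddSubgroup.closure (Set.range (hBasis p Γ)) = ⊤ := by
  refine PresentedAlg.closure_range_gen fun k l => ?_
  change hBasis p Γ k * hBasis p Γ l ∈ AddSubgroup.closure (Set.range (hBasis p Γ))
  cases k with
  | inr e => rw [a_mul]; exact zero_mem _
  | inl i =>
    cases l with
    | inr e => rw [mul_a]; exact zero_mem _
    | inl j =>
      rcases v_mul_v_cases (p := p) (Γ := Γ) i j with ⟨-, h⟩ | ⟨e, -, h | h⟩ <;> rw [h]
      · exact zero_mem _
      · exact AddSubgroup.subset_closure ⟨_, rfl⟩
      · exact neg_mem (AddSubgroup.subset_closure ⟨_, rfl⟩)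

theorem exists_toModel (p : ℕ) [Fact p.Prime] (Γ : SimpleGraph (Fin n)) :
    ∃ Φ : HAlg p Γ →ₙ+* HModel p Γ, ∀ k, Φ (hBasis p Γ k) = HModel.basis p Γ k := by
  refine PresentedAlg.exists_hom _ fun F hF _ a b hab => ?_
  induction hab with
  | v_sq i =>
    rw [map_mul, hF, map_zero]
    ext k
    · rfl
    · rw [HModel.mul_inr, mul_comm, sub_self, map_zero]
      rfl
  | v_mul e => rw [map_mul, hF, hF, hF, HModel.basis_mul_edge]
  | v_mul_rev e => rw [map_mul, map_neg, hF, hF, hF, HModel.basis_mul_swap, HModel.basis_mul_edge]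
  | a_mul_v e i =>
    rw [map_mul, hF, hF, map_zero]
    exact HModel.mul_eq_zero_of_vert (.inl (HModel.basis_inr_vert e))
  | v_mul_a i e =>
    rw [map_mul, hF, hF, map_zero]
    exact HModel.mul_eq_zero_of_vert (.inr (HModel.basis_inr_vert e))
  | a_mul_a e e' =>
    rw [map_mul, hF, hF, map_zero]
    exact HModel.mul_eq_zero_of_vert (.inl (HModel.basis_inr_vert e))
  | edge e h =>
    rw [map_nsmul, hF, map_zero]
    refine HModel.ext (fun k => ?_) fun e' => ?_
    · change p • (HModel.basis p Γ (.inr e)).vert k = 0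
      rw [HModel.basis_inr_vert, smul_zero]
    · change p • HModel.basis p Γ (.inr e) (.inr e') = 0
      rw [HModel.basis_inr_inr]
      split_ifs with he
      · subst he
        exact smul_redHom_edge h 1
      · exact smul_zero _
  | nonedge e h =>
    rw [map_nsmul, hF, map_zero]
    refine HModel.ext (fun k => ?_) fun e' => ?_
    · change p ^ 2 • (HModel.basis p Γ (.inr e)).vert k = 0
      rw [HModel.basis_inr_vert, smul_zero]
    · change p ^ 2 • HModel.basis p Γ (.inr e) (.inr e') = 0
      rw [HModel.basis_inr_inr]
      split_ifs with he
      · subst he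
        exact smul_redHom_nonedge h 1
      · exact smul_zero _

/-- The coefficients of an element with respect to the standard basis. -/
noncomputable def toModel (p : ℕ) [Fact p.Prime] (Γ : SimpleGraph (Fin n)) :
    HAlg p Γ →ₙ+* HModel p Γ := (exists_toModel p Γ).choose

variable [Fact p.Prime]

theorem toModel_hBasis (k : HIndex n) : toModel p Γ (hBasis p Γ k) = HModel.basis p Γ k :=
  (exists_toModel p Γ).choose_spec k

theorem toModel_bijective : Function.Bijective (toModel p Γ) :=
  bijective_of_basis (d := hOrder p Γ) (toModel p Γ).toAddMonoidHom order_smul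
    closure_range_hBasis toModel_hBasis

theorem isAdditiveBasis : IsAdditiveBasis (hBasis p Γ) (hOrder p Γ) :=
  isAdditiveBasis_of_map (d := hOrder p Γ) (toModel p Γ).toAddMonoidHom order_smul
    closure_range_hBasis toModel_hBasis

end HAlg

/-! ## Isomorphisms of H-algebras -/

namespace GraphComm

/-- Graphs are isomorphic if there is a bijection of sets that lie over `Fⁿ`, linear over `Fⁿ`,
under which adjacent basis vectors correspond to commuting vectors. -/
theorem nonempty_iso_of_equiv {V W F M N : Type*} [Field F] [Fintype V] [Fintype W] [DecidableEq V]
    [DecidableEq W] {Γ : SimpleGraph V} {Δ : SimpleGraph W} (f : M ≃ N) (π : M → V → F)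
    (ρ : N → W → F) (hπ : Function.Surjective π) (hρ : Function.Surjective ρ)
    (φ : (V → F) →ₗ[F] (W → F)) (hφ : ∀ x, φ (π x) = ρ (f x))
    (ψ : (W → F) →ₗ[F] (V → F)) (hψ : ∀ y, ψ (ρ y) = π (f.symm y))
    (g : V → M) (hg : ∀ i, π (g i) = Pi.single i 1) (h : W → N) (hh : ∀ i, ρ (h i) = Pi.single i 1)
    (hf : ∀ i j, Γ.Adj i j → Comm Δ (ρ (f (g i))) (ρ (f (g j))))
    (hf' : ∀ i j, Δ.Adj i j → Comm Γ (π (f.symm (h i))) (π (f.symm (h j)))) :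
    Nonempty (Γ ≃g Δ) := by
  have h1 : φ ∘ₗ ψ = LinearMap.id := LinearMap.ext fun y => by
    obtain ⟨y, rfl⟩ := hρ y
    simp [hφ, hψ]
  have h2 : ψ ∘ₗ φ = LinearMap.id := LinearMap.ext fun x => by
    obtain ⟨x, rfl⟩ := hπ x
    simp [hφ, hψ]
  refine nonempty_iso_of_mapsEdges (LinearEquiv.ofLinearMap φ ψ h1 h2) (fun i j hij => ?_)
    (LinearEquiv.ofLinearMap ψ φ h2 h1) (fun i j hij => ?_)
  · simp only [LinearEquiv.coe_ofLinearMap, ← hg, hφ]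
    exact hf i j hij
  · simp only [LinearEquiv.coe_ofLinearMap, ← hh, hψ]
    exact hf' i j hij

theorem exists_linearMap {V F X : Type*} [Field F] [Fintype V] [DecidableEq V] [AddCommGroup X]
    [Module F X] (c : V → X) : ∃ φ : (V → F) →ₗ[F] X, ∀ i, φ (Pi.single i 1) = c i :=
  ⟨(Pi.basisFun F V).constr F c, fun i => by
    rw [← Pi.basisFun_apply, Module.Basis.constr_basis]⟩

end GraphComm

namespace HAlg

variable {p n m : ℕ} [Fact p.Prime] {Γ : SimpleGraph (Fin n)} {Δ : SimpleGraph (Fin m)}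

/-- The vertex coefficients modulo `p`. -/
noncomputable def resid (p : ℕ) [Fact p.Prime] (Γ : SimpleGraph (Fin n)) :
    HAlg p Γ →+ (Fin n → ZMod p) where
  toFun x i := modP p ((toModel p Γ x).vert i)
  map_zero' := by
    funext i
    simp
  map_add' x y := by
    funext i
    simp

theorem resid_v (i : Fin n) : resid p Γ (v p Γ i) = Pi.single i 1 := by
  funext j
  change modP p ((toModel p Γ (v p Γ i)).vert j) = _
  rw [toModel_hBasis, HModel.basis_vert, Pi.single_apply]
  split_ifs <;> simp

theorem resid_mul (x y : HAlg p Γ) : resid p Γ (x * y) = 0 := by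
  funext j
  change modP p ((toModel p Γ (x * y)).vert j) = 0
  rw [map_mul, HModel.mul_vert, map_zero]

theorem resid_surjective : Function.Surjective (resid p Γ) := by
  intro y
  refine ⟨∑ i, (y i).val • v p Γ i, ?_⟩
  simp only [map_sum, map_nsmul, resid_v]
  funext j
  rw [Finset.sum_apply, Finset.sum_eq_single j]
  · simp only [Pi.smul_apply, Pi.single_eq_same, nsmul_one, ZMod.natCast_zmod_val]
  · intro i _ hij
    rw [Pi.smul_apply, Pi.single_eq_of_ne' hij, smul_zero]
  · simp

/-- At a non-edge the coefficient of `x * y` is a minor of the vertex coefficients modulo p². If p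
times it vanishes, the minor vanishes modulo p. -/
theorem comm_resid {x y : HAlg p Γ} (h : p • (x * y) = 0) :
    GraphComm.Comm Γ (resid p Γ x) (resid p Γ y) := by
  have key : ∀ e : {e : Fin n × Fin n // e.1 < e.2}, ¬ Γ.Adj e.1.1 e.1.2 →
      resid p Γ x e.1.1 * resid p Γ y e.1.2 = resid p Γ x e.1.2 * resid p Γ y e.1.1 := by
    intro e he
    have h1 := congrArg (toModel p Γ) h
    rw [map_nsmul, map_mul, map_zero] at h1
    have h2 := modP_eq_zero_of_smul_redHom he (congrFun h1 (.inr e))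
    rw [map_sub, map_mul, map_mul, sub_eq_zero] at h2
    exact h2
  intro k l hkl hn
  rcases lt_or_gt_of_ne hkl with h' | h'
  · exact key ⟨(k, l), h'⟩ hn
  · exact (key ⟨(l, k), h'⟩ fun h => hn h.symm).symm

/-- `φ` is prescribed on the basis vectors, and the identity is checked on additive generators. A
pair generator is a product, so its residue vanishes before and after applying `f`. -/
theorem exists_linearMap_resid (f : HAlg p Γ ≃+* HAlg p Δ) :
    ∃ φ : (Fin n → ZMod p) →ₗ[ZMod p] (Fin m → ZMod p),
      ∀ x, φ (resid p Γ x) = resid p Δ (f x) := by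
  obtain ⟨φ, hφ⟩ := GraphComm.exists_linearMap (F := ZMod p) fun i => resid p Δ (f (v p Γ i))
  refine ⟨φ, fun x => ?_⟩
  have hx : x ∈ AddSubgroup.closure (Set.range (hBasis p Γ)) :=
    closure_range_hBasis (p := p) (Γ := Γ) ▸ AddSubgroup.mem_top x
  induction hx using AddSubgroup.closure_induction with
  | mem x hx =>
    obtain ⟨k, rfl⟩ := hx
    cases k with
    | inl i => rw [resid_v, hφ]
    | inr e =>
      change φ (resid p Γ (a p Γ e)) = resid p Δ (f (a p Γ e))
      rw [← v_mul_v, resid_mul, map_mul, resid_mul, map_zero]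
  | zero => simp
  | add x y _ _ hx hy => simp [hx, hy]
  | neg x _ hx => simp [hx]

theorem nonempty_iso_of_algIso (h : AlgIso (ZMod (p ^ 3)) (HAlg p Γ) (HAlg p Δ)) :
    Nonempty (Γ ≃g Δ) := by
  obtain ⟨f⟩ := h.exists_ringEquiv
  obtain ⟨φ, hφ⟩ := exists_linearMap_resid f
  obtain ⟨ψ, hψ⟩ := exists_linearMap_resid f.symm
  refine GraphComm.nonempty_iso_of_equiv f.toEquiv (resid p Γ) (resid p Δ) resid_surjective
    resid_surjective φ hφ ψ hψ (v p Γ) resid_v (v p Δ) resid_v (fun i j hij => ?_) fun i j hij => ?_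
  · refine comm_resid ?_
    change p • (f (v p Γ i) * f (v p Γ j)) = 0
    rw [← map_mul, ← map_nsmul, smul_v_mul_v_edge hij, map_zero]
  · refine comm_resid ?_
    change p • (f.symm (v p Δ i) * f.symm (v p Δ j)) = 0
    rw [← map_mul, ← map_nsmul, smul_v_mul_v_edge hij, map_zero]

theorem exists_hom_of_iso (σ : Γ ≃g Δ) :
    ∃ f : HAlg p Γ →ₙ+* HAlg p Δ, ∀ i, f (v p Γ i) = v p Δ (σ i) := by
  obtain ⟨f, hf⟩ := PresentedAlg.exists_hom (p := p) (r := HRel p Γ) (A := HAlg p Δ)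
    (fun k => match k with
      | .inl i => v p Δ (σ i)
      -- As `σ` may reverse the order of two vertices, the image is given as a product and not as a
      -- generator with a sign.
      | .inr e => v p Δ (σ e.1.1) * v p Δ (σ e.1.2)) (by
    intro F hF _ a b hab
    induction hab with
    | v_sq i => rw [map_mul, hF, map_zero, v_mul_self]
    | v_mul e => rw [map_mul, hF, hF, hF]
    | v_mul_rev e => rw [map_mul, map_neg, hF, hF, hF, v_mul_v_swap]
    | a_mul_v e i => rw [map_mul, hF, hF, map_zero, v_mul_v_mul]
    | v_mul_a i e => rw [map_mul, hF, hF, map_zero, mul_v_mul_v]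
    | a_mul_a e e' => rw [map_mul, hF, hF, map_zero, v_mul_v_mul_v_mul_v]
    | edge e h => rw [map_nsmul, hF, map_zero, smul_v_mul_v_edge (σ.map_adj_iff.2 h)]
    | nonedge e h =>
      rw [map_nsmul, hF, map_zero, smul_v_mul_v_nonedge fun h' => h (σ.map_adj_iff.1 h')])
  exact ⟨f, fun i => hf (.inl i)⟩

theorem hom_eq_id (f : HAlg p Γ →ₙ+* HAlg p Γ) (hf : ∀ i, f (v p Γ i) = v p Γ i) (x : HAlg p Γ) :
    f x = x := by
  have : f = NonUnitalRingHom.id _ := PresentedAlg.hom_ext fun k => by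
    cases k with
    | inl i => exact hf i
    | inr e =>
      change f (a p Γ e) = a p Γ e
      rw [← v_mul_v, map_mul, hf, hf]
  rw [this]
  rfl

theorem algIso_of_iso (σ : Γ ≃g Δ) : AlgIso (ZMod (p ^ 3)) (HAlg p Γ) (HAlg p Δ) := by
  obtain ⟨f, hf⟩ := exists_hom_of_iso (p := p) σ
  obtain ⟨g, hg⟩ := exists_hom_of_iso (p := p) σ.symm
  refine .of_ringHom f (Function.bijective_iff_has_inverse.2 ⟨g, fun x => ?_, fun y => ?_⟩)
  · exact hom_eq_id (g.comp f) (fun i => by simp [hf, hg]) x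
  · exact hom_eq_id (f.comp g) (fun i => by simp [hf, hg]) y

theorem algIso_iff : AlgIso (ZMod (p ^ 3)) (HAlg p Γ) (HAlg p Δ) ↔ Nonempty (Γ ≃g Δ) :=
  ⟨nonempty_iso_of_algIso, fun ⟨σ⟩ => algIso_of_iso σ⟩

end HAlg

namespace AlgTable

variable {p n : ℕ} {Γ : SimpleGraph (Fin n)} {T : AlgTable p}

/-- `T` is the multiplication table of the H-algebra of `Γ` for the listing `b` of the standard
basis. -/
def IsTableOf (T : AlgTable p) (Γ : SimpleGraph (Fin n)) (b : Fin T.size ≃ HIndex n) : Prop :=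
  (∀ k, addOrderOf (hBasis p Γ (b k)) = p ^ (T.ord k : ℕ)) ∧
    ∀ i j, hBasis p Γ (b i) * hBasis p Γ (b j) = ∑ k, T.coef i j k • hBasis p Γ (b k)

/-- The relations of a table already bring every product into the span of the generators and bound
their orders. Hence the composite with the coefficient map of the H-algebra is bijective by
`bijective_of_basis`. -/
theorem IsTableOf.algIso [Fact p.Prime] {b : Fin T.size ≃ HIndex n} (h : T.IsTableOf Γ b) :
    AlgIso (ZMod (p ^ 3)) T.Alg (HAlg p Γ) := by
  obtain ⟨hord, hmul⟩ := h
  have hord' : ∀ k, hOrder p Γ (b k) = p ^ (T.ord k : ℕ) := fun k =>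
    (HAlg.isAdditiveBasis.1 (b k)).symm.trans (hord k)
  obtain ⟨f, hf⟩ := PresentedAlg.exists_hom (r := T.Rel) (fun k => hBasis p Γ (b k)) (by
    intro F hF hsmul x y hxy
    induction hxy with
    | mul i j =>
      rw [map_mul, hF, hF, hmul, map_sum]
      simp only [hsmul, hF]
    | order k =>
      rw [map_nsmul, hF, map_zero, ← hord', HAlg.order_smul])
  let g : HIndex n → T.Alg := fun k => PresentedAlg.gen (b.symm k)
  have hg : Set.range g = Set.range (PresentedAlg.gen (r := T.Rel)) :=
    b.symm.surjective.range_comp (PresentedAlg.gen (r := T.Rel))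
  have hbij : Function.Bijective ((HAlg.toModel p Γ).comp f) := by
    refine bijective_of_basis (ι := HIndex n) (M := T.Alg) (d := hOrder p Γ) (b := g)
      ((HAlg.toModel p Γ).comp f).toAddMonoidHom (fun k => ?_) ?_ fun k => ?_
    · have h1 : hOrder p Γ k = p ^ (T.ord (b.symm k) : ℕ) := by
        rw [← hord', Equiv.apply_symm_apply]
      rw [h1]
      exact (map_nsmul (PresentedAlg.proj (r := T.Rel)) _ _).symm.trans
        ((PresentedAlg.proj_eq (Rel.order (b.symm k))).trans (map_zero _))
    · rw [hg]
      refine PresentedAlg.closure_range_gen fun x y => ?_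
      have h1 : (PresentedAlg.gen x * PresentedAlg.gen y : T.Alg) =
          ∑ k, T.coef x y k • PresentedAlg.gen k := by
        refine (PresentedAlg.proj_eq (Rel.mul x y)).trans ((map_sum _ _ _).trans ?_)
        exact Finset.sum_congr rfl fun k _ => NonUnitalRingHom.map_zmod_smul _ _ _
      rw [h1]
      refine sum_mem fun k _ => ?_
      rw [← ZMod.natCast_zmod_val (T.coef x y k), Nat.cast_smul_eq_nsmul]
      exact nsmul_mem (AddSubgroup.subset_closure (Set.mem_range_self k)) _
    · change HAlg.toModel p Γ (f (PresentedAlg.gen (b.symm k))) = _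
      rw [hf, Equiv.apply_symm_apply, HAlg.toModel_hBasis]
      rfl
  have hsurj : Function.Surjective f := fun y => by
    obtain ⟨x, hx⟩ := hbij.2 (HAlg.toModel p Γ y)
    exact ⟨x, HAlg.toModel_bijective.1 hx⟩
  exact AlgIso.of_ringHom f
    ⟨fun x y hxy => hbij.1 (congrArg (HAlg.toModel p Γ) hxy), hsurj⟩

end AlgTable

open scoped commutatorElement

/-! ## H-groups -/

/-- A finitely generated abelian torsion group is finite. -/
theorem finite_closure_of_commute {G : Type*} [Group G] {s : Set G} (hs : s.Finite)
    (hcomm : ∀ x ∈ s, ∀ y ∈ s, x * y = y * x) {N : ℕ} (hN : N ≠ 0) (hpow : ∀ x ∈ s, x ^ N = 1) :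
    Finite (Subgroup.closure s) := by
  have := Subgroup.isMulCommutative_closure hcomm
  let _ : CommGroup (Subgroup.closure s) :=
    { (inferInstance : Group (Subgroup.closure s)) with mul_comm := mul_comm' }
  have hfg : Group.FG (Subgroup.closure s) := by
    have := Group.closure_finset_fg hs.toFinset
    rwa [hs.coe_toFinset] at this
  refine CommGroup.finite_of_fg_isMulTorsion _ fun x => ?_
  refine isOfFinOrder_iff_pow_eq_one.2 ⟨N, Nat.pos_of_ne_zero hN, ?_⟩
  obtain ⟨x, hx⟩ := x
  induction hx using Subgroup.closure_induction with
  | mem x hx => exact Subtype.ext (hpow x hx)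
  | one => exact one_pow N
  | mul x y hx hy ihx ihy =>
    have := mul_pow (⟨x, hx⟩ : Subgroup.closure s) ⟨y, hy⟩ N
    rw [ihx, ihy, one_mul] at this
    exact this
  | inv x hx ih =>
    have := inv_pow (⟨x, hx⟩ : Subgroup.closure s) N
    rw [ih, inv_one] at this
    exact this

section HSystem

variable {p n : ℕ} {Γ : SimpleGraph (Fin n)} {H : Type*} [Group H]

/-- The elements `f k` satisfy the defining relations of the H-group of `Γ`. -/
structure IsHSystem (p : ℕ) (Γ : SimpleGraph (Fin n)) (f : HIndex n → H) : Prop where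
  comm : ∀ e : {e : Fin n × Fin n // e.1 < e.2}, ⁅f (.inl e.1.1), f (.inl e.1.2)⁆ = f (.inr e)
  central : ∀ (e : {e : Fin n × Fin n // e.1 < e.2}) k, Commute (f (.inr e)) (f k)
  order : ∀ k, f k ^ hOrder p Γ k = 1

theorem lift_commWord {X : Type} (f : X → H) (x y : X) :
    FreeGroup.lift f (FreeGroup.mk (commWord x y)) = ⁅f x, f y⁆ := by
  simp [FreeGroup.lift_mk, commWord, commutatorElement_def, mul_assoc]

theorem lift_replicate {X : Type} (f : X → H) (x : X) (m : ℕ) :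
    FreeGroup.lift f (FreeGroup.mk (List.replicate m (x, true))) = f x ^ m := by
  simp [FreeGroup.lift_mk]

theorem lift_comm {X : Type} (f : X → H) (x y z : X) :
    FreeGroup.lift f (FreeGroup.mk (commWord x y ++ [(z, false)])) = ⁅f x, f y⁆ * (f z)⁻¹ := by
  simp [FreeGroup.lift_mk, commWord, commutatorElement_def, mul_assoc]

theorem IsHSystem.lift_eq_one {f : HIndex n → H} (h : IsHSystem p Γ f)
    {w : List (HIndex n × Bool)} (hw : HRelator p Γ w) : FreeGroup.lift f (FreeGroup.mk w) = 1 := by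
  cases hw with
  | comm e => rw [lift_comm, h.comm, mul_inv_cancel]
  | central_a e e' => rw [lift_commWord, commutatorElement_eq_one_iff_commute]; exact h.central _ _
  | central_g e i => rw [lift_commWord, commutatorElement_eq_one_iff_commute]; exact h.central _ _
  | pow_g i => rw [lift_replicate]; exact h.order (.inl i)
  | edge e he =>
    rw [lift_replicate, ← hOrder_edge (p := p) he]
    exact h.order (.inr e)
  | nonedge e he =>
    rw [lift_replicate, ← hOrder_nonedge (p := p) he]
    exact h.order (.inr e)

theorem IsHSystem.of_lift_eq_one {f : HIndex n → H}
    (h : ∀ w, HRelator p Γ w → FreeGroup.lift f (FreeGroup.mk w) = 1) : IsHSystem p Γ f where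
  comm e := by
    have := h _ (.comm e)
    rwa [lift_comm, mul_inv_eq_one] at this
  central e k := by
    rw [← commutatorElement_eq_one_iff_commute, ← lift_commWord]
    cases k with
    | inl i => exact h _ (.central_g e i)
    | inr e' => exact h _ (.central_a e e')
  order k := by
    rw [← lift_replicate]
    cases k with
    | inl i => exact h _ (.pow_g i)
    | inr e =>
      by_cases he : Γ.Adj e.1.1 e.1.2
      · rw [hOrder_edge he]
        exact h _ (.edge e he)
      · rw [hOrder_nonedge he]
        exact h _ (.nonedge e he)

variable {f : HIndex n → H} (h : IsHSystem p Γ f)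
include h

theorem IsHSystem.commutator_cases (i j : Fin n) : (i = j ∧ ⁅f (.inl i), f (.inl j)⁆ = 1) ∨
    ∃ e : {e : Fin n × Fin n // e.1 < e.2}, ((e.1.1 = i ∧ e.1.2 = j) ∨ (e.1.1 = j ∧ e.1.2 = i)) ∧
      (⁅f (.inl i), f (.inl j)⁆ = f (.inr e) ∨ ⁅f (.inl i), f (.inl j)⁆ = (f (.inr e))⁻¹) := by
  rcases lt_trichotomy i j with hij | rfl | hij
  · exact .inr ⟨⟨(i, j), hij⟩, .inl ⟨rfl, rfl⟩, .inl (h.comm ⟨(i, j), hij⟩)⟩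
  · exact .inl ⟨rfl, commutatorElement_self _⟩
  · refine .inr ⟨⟨(j, i), hij⟩, .inr ⟨rfl, rfl⟩, .inr ?_⟩
    rw [← h.comm, commutatorElement_inv]

theorem IsHSystem.commute_commutator (i j : Fin n) (k : HIndex n) :
    Commute ⁅f (.inl i), f (.inl j)⁆ (f k) := by
  rcases h.commutator_cases i j with ⟨-, h'⟩ | ⟨e, -, h' | h'⟩ <;> rw [h']
  · exact Commute.one_left _
  · exact h.central e k
  · exact (h.central e k).inv_left

theorem IsHSystem.commutator_pow_edge {i j : Fin n} (hij : Γ.Adj i j) :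
    ⁅f (.inl i), f (.inl j)⁆ ^ p = 1 := by
  rcases h.commutator_cases i j with ⟨-, h'⟩ | ⟨e, he, h'⟩
  · rw [h', one_pow]
  · have hadj : Γ.Adj e.1.1 e.1.2 := by
      rcases he with ⟨h1, h2⟩ | ⟨h1, h2⟩ <;> rw [h1, h2]
      · exact hij
      · exact hij.symm
    have h0 := h.order (.inr e)
    rw [hOrder_edge hadj] at h0
    rcases h' with h' | h' <;> rw [h']
    · exact h0
    · rw [inv_pow, h0, inv_one]

theorem IsHSystem.commutator_pow_nonedge {i j : Fin n} (hij : ¬ Γ.Adj i j) :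
    ⁅f (.inl i), f (.inl j)⁆ ^ p ^ 2 = 1 := by
  rcases h.commutator_cases i j with ⟨-, h'⟩ | ⟨e, he, h'⟩
  · rw [h', one_pow]
  · have hadj : ¬ Γ.Adj e.1.1 e.1.2 := by
      rcases he with ⟨h1, h2⟩ | ⟨h1, h2⟩ <;> rw [h1, h2]
      · exact hij
      · exact fun h => hij h.symm
    have h0 := h.order (.inr e)
    rw [hOrder_nonedge hadj] at h0
    rcases h' with h' | h' <;> rw [h']
    · exact h0
    · rw [inv_pow, h0, inv_one]

/-- The pair generators go to commutators, which absorbs the inverse that appears when `σ` reverses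
the order of two vertices. -/
theorem IsHSystem.comap {m : ℕ} {Δ : SimpleGraph (Fin m)} (σ : Δ ≃g Γ) :
    IsHSystem p Δ (fun k : HIndex m => match k with
      | .inl i => f (.inl (σ i))
      | .inr e => ⁅f (.inl (σ e.1.1)), f (.inl (σ e.1.2))⁆) where
  comm e := rfl
  central e k := by
    cases k with
    | inl i => exact h.commute_commutator _ _ _
    | inr e' =>
      have h1 := h.commute_commutator (σ e.1.1) (σ e.1.2) (.inl (σ e'.1.1))
      have h2 := h.commute_commutator (σ e.1.1) (σ e.1.2) (.inl (σ e'.1.2))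
      change Commute _ ⁅f _, f _⁆
      rw [commutatorElement_def (f (.inl (σ e'.1.1)))]
      exact ((h1.mul_right h2).mul_right h1.inv_right).mul_right h2.inv_right
  order k := by
    cases k with
    | inl i => exact h.order (.inl (σ i))
    | inr e =>
      by_cases he : Δ.Adj e.1.1 e.1.2
      · rw [hOrder_edge he]
        exact h.commutator_pow_edge (σ.map_adj_iff.2 he)
      · rw [hOrder_nonedge he]
        exact h.commutator_pow_nonedge fun h' => he (σ.map_adj_iff.1 h')

end HSystem

namespace HGroup

variable {p n m : ℕ} {Γ : SimpleGraph (Fin n)} {Δ : SimpleGraph (Fin m)}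

/-- The standard generators. -/
def gen (p : ℕ) (Γ : SimpleGraph (Fin n)) (k : HIndex n) : HGroup p Γ := PresentedGroup.of k

theorem isHSystem_gen : IsHSystem p Γ (gen p Γ) := by
  refine .of_lift_eq_one fun w hw => ?_
  have h1 : FreeGroup.lift (gen p Γ) = PresentedGroup.mk _ := by
    ext k
    rw [FreeGroup.lift_apply_of]
    rfl
  rw [h1]
  exact PresentedGroup.one_of_mem ⟨w, hw, rfl⟩

theorem exists_hom {H : Type*} [Group H] {f : HIndex n → H} (h : IsHSystem p Γ f) :
    ∃ F : HGroup p Γ →* H, ∀ k, F (gen p Γ k) = f k :=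
  ⟨PresentedGroup.toGroup (f := f) (by
    rintro _ ⟨w, hw, rfl⟩
    exact h.lift_eq_one hw), fun _ => PresentedGroup.toGroup.of _⟩

theorem hom_ext {H : Type*} [Group H] {F F' : HGroup p Γ →* H}
    (h : ∀ i, F (gen p Γ (.inl i)) = F' (gen p Γ (.inl i))) : F = F' := by
  refine PresentedGroup.ext fun k => ?_
  cases k with
  | inl i => exact h i
  | inr e =>
    change F (gen p Γ (.inr e)) = F' (gen p Γ (.inr e))
    rw [← isHSystem_gen.comm, map_commutatorElement, map_commutatorElement, h, h]

theorem exists_hom_of_iso (σ : Γ ≃g Δ) :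
    ∃ F : HGroup p Γ →* HGroup p Δ, ∀ i, F (gen p Γ (.inl i)) = gen p Δ (.inl (σ i)) := by
  obtain ⟨F, hF⟩ := exists_hom ((isHSystem_gen (p := p) (Γ := Δ)).comap σ)
  exact ⟨F, fun i => hF (.inl i)⟩

theorem nonempty_mulEquiv_of_iso (σ : Γ ≃g Δ) : Nonempty (HGroup p Γ ≃* HGroup p Δ) := by
  obtain ⟨F, hF⟩ := exists_hom_of_iso (p := p) σ
  obtain ⟨F', hF'⟩ := exists_hom_of_iso (p := p) σ.symm
  exact ⟨MonoidHom.toMulEquiv F F' (hom_ext fun i => by simp [hF, hF'])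
    (hom_ext fun i => by simp [hF, hF'])⟩

/-- The pair generators generate a central subgroup `Z` with abelian quotient. Both groups are
generated by finitely many commuting elements whose orders divide p³. -/
theorem finite [Fact p.Prime] : Finite (HGroup p Γ) := by
  have hN : p ^ 3 ≠ 0 := pow_ne_zero 3 (Fact.out : p.Prime).ne_zero
  have hsys := isHSystem_gen (p := p) (Γ := Γ)
  have hpow : ∀ k, gen p Γ k ^ p ^ 3 = 1 := by
    intro k
    obtain ⟨c, hc⟩ := hOrder_dvd p Γ k
    rw [hc, pow_mul, hsys.order, one_pow]
  set Z : Subgroup (HGroup p Γ) := Subgroup.closure (Set.range fun e => gen p Γ (.inr e)) with hZ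
  have hZc : Z ≤ Subgroup.center (HGroup p Γ) := by
    rw [hZ, Subgroup.closure_le]
    rintro _ ⟨e, rfl⟩
    rw [SetLike.mem_coe, Subgroup.mem_center_iff]
    intro x
    have := PresentedGroup.generated_by _ (Subgroup.centralizer {gen p Γ (.inr e)}) (fun k => by
      rw [Subgroup.mem_centralizer_singleton_iff]
      exact (hsys.central e k).symm) x
    rw [Subgroup.mem_centralizer_singleton_iff] at this
    exact this
  have hnorm : Z.Normal := ⟨fun x hx g => by
    rwa [Subgroup.mem_center_iff.1 (hZc hx) g, mul_inv_cancel_right]⟩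
  have h1 : Finite Z := by
    refine finite_closure_of_commute (Set.finite_range _) ?_ hN ?_
    · rintro _ ⟨e, rfl⟩ _ ⟨e', rfl⟩
      exact hsys.central e _
    · rintro _ ⟨e, rfl⟩
      exact hpow _
  have h2 : Finite (HGroup p Γ ⧸ Z) := by
    let q := QuotientGroup.mk' Z
    have hq : ∀ e, q (gen p Γ (.inr e)) = 1 := fun e =>
      (QuotientGroup.eq_one_iff _).2 (Subgroup.subset_closure ⟨e, rfl⟩)
    have h3 : Finite (Subgroup.closure (Set.range fun k => q (gen p Γ k))) := by
      refine finite_closure_of_commute (Set.finite_range _) ?_ hN ?_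
      · rintro _ ⟨k, rfl⟩ _ ⟨l, rfl⟩
        change Commute (q _) (q _)
        cases k with
        | inr e => rw [hq]; exact Commute.one_left _
        | inl i =>
          cases l with
          | inr e => rw [hq]; exact Commute.one_right _
          | inl j =>
            rw [← commutatorElement_eq_one_iff_commute, ← map_commutatorElement]
            rcases hsys.commutator_cases i j with ⟨-, h⟩ | ⟨e, -, h | h⟩ <;> rw [h]
            · exact map_one q
            · exact hq e
            · rw [map_inv, hq, inv_one]
      · rintro _ ⟨k, rfl⟩
        change q _ ^ _ = 1
        rw [← map_pow, hpow, map_one]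
    have h4 : Subgroup.closure (Set.range fun k => q (gen p Γ k)) = ⊤ := by
      have : (Set.range fun k => q (gen p Γ k)) = q '' Set.range (gen p Γ) :=
        (Set.range_comp q (gen p Γ))
      rw [this, ← MonoidHom.map_closure]
      have h5 : Subgroup.closure (Set.range (gen p Γ)) = ⊤ := PresentedGroup.closure_range_of _
      rw [h5, ← MonoidHom.range_eq_map, MonoidHom.range_eq_top]
      exact QuotientGroup.mk'_surjective Z
    rw [h4] at h3
    exact Finite.of_equiv _ Subgroup.topEquiv.toEquiv
  exact Finite.of_subgroup_quotient Z

end HGroup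

/-- A concrete model of the H-group of `Γ`: tuples of exponents. -/
structure HGroupModel (p : ℕ) {n : ℕ} (Γ : SimpleGraph (Fin n)) where
  /-- the exponents of the vertices -/
  vert : Fin n → ZMod (p ^ 3)
  /-- the exponents of the pairs -/
  pair : (e : {e : Fin n × Fin n // e.1 < e.2}) → ZMod (hOrder p Γ (.inr e))

namespace HGroupModel

variable {p n : ℕ} {Γ : SimpleGraph (Fin n)}

/-- The cocycle that defines the multiplication. -/
noncomputable def cocycle (x y : Fin n → ZMod (p ^ 3)) (e : {e : Fin n × Fin n // e.1 < e.2}) :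
    ZMod (hOrder p Γ (.inr e)) := redHom p Γ (.inr e) (x e.1.1 * y e.1.2)

theorem cocycle_add_left (x x' y : Fin n → ZMod (p ^ 3)) :
    cocycle (Γ := Γ) (x + x') y = cocycle x y + cocycle x' y := by
  funext e
  simp [cocycle, add_mul]

theorem cocycle_add_right (x y y' : Fin n → ZMod (p ^ 3)) :
    cocycle (Γ := Γ) x (y + y') = cocycle x y + cocycle x y' := by
  funext e
  simp [cocycle, mul_add]

theorem cocycle_zero_left (y : Fin n → ZMod (p ^ 3)) : cocycle (Γ := Γ) 0 y = 0 := by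
  funext e
  simp [cocycle]

theorem cocycle_zero_right (x : Fin n → ZMod (p ^ 3)) : cocycle (Γ := Γ) x 0 = 0 := by
  funext e
  simp [cocycle]

theorem cocycle_neg_left (x y : Fin n → ZMod (p ^ 3)) :
    cocycle (Γ := Γ) (-x) y = -cocycle x y := by
  funext e
  simp [cocycle]

theorem cocycle_nsmul_left (m : ℕ) (x y : Fin n → ZMod (p ^ 3)) :
    cocycle (Γ := Γ) (m • x) y = m • cocycle x y := by
  funext e
  simp [cocycle, mul_assoc]

noncomputable instance : Mul (HGroupModel p Γ) where
  mul x y := ⟨x.vert + y.vert, x.pair + y.pair + cocycle x.vert y.vert⟩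

noncomputable instance : One (HGroupModel p Γ) := ⟨⟨0, 0⟩⟩

noncomputable instance : Inv (HGroupModel p Γ) where
  inv x := ⟨-x.vert, -x.pair + cocycle x.vert x.vert⟩

theorem ext {x y : HGroupModel p Γ} (h : x.vert = y.vert) (h' : x.pair = y.pair) : x = y := by
  cases x
  cases y
  simp_all

theorem mul_vert (x y : HGroupModel p Γ) : (x * y).vert = x.vert + y.vert := rfl

theorem mul_pair (x y : HGroupModel p Γ) :
    (x * y).pair = x.pair + y.pair + cocycle x.vert y.vert := rfl

theorem one_vert : (1 : HGroupModel p Γ).vert = 0 := rfl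

theorem one_pair : (1 : HGroupModel p Γ).pair = 0 := rfl

noncomputable instance : Group (HGroupModel p Γ) :=
  Group.ofLeftAxioms
    (fun x y z => ext (by simp only [mul_vert, add_assoc]) (by
      simp only [mul_vert, mul_pair, cocycle_add_left, cocycle_add_right]
      abel))
    (fun x => ext (by simp only [mul_vert, one_vert, zero_add]) (by
      simp only [mul_pair, one_vert, one_pair, zero_add, cocycle_zero_left, add_zero]))
    (fun x => ext (neg_add_cancel _) (by
      change (-x.pair + cocycle x.vert x.vert) + x.pair + cocycle (-x.vert) x.vert = 0
      rw [cocycle_neg_left]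
      abel))

/-- By bilinearity the corrections in a power are multiples of `cocycle x.vert x.vert`. This
vanishes for the standard generators, as the cocycle pairs only distinct coordinates. -/
theorem pow_eq {x : HGroupModel p Γ} (hx : cocycle (Γ := Γ) x.vert x.vert = 0) (m : ℕ) :
    x ^ m = ⟨m • x.vert, m • x.pair⟩ := by
  induction m with
  | zero => exact ext (by simp [one_vert]) (by simp [one_pair])
  | succ m ih =>
    rw [pow_succ, ih]
    refine ext ?_ ?_
    · rw [mul_vert, add_nsmul, one_nsmul]
    · rw [mul_pair, cocycle_nsmul_left, hx, smul_zero, add_zero]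
      exact (succ_nsmul x.pair m).symm

/-- The value of the commutator. -/
noncomputable def commVal (x y : Fin n → ZMod (p ^ 3)) : HGroupModel p Γ :=
  ⟨0, cocycle x y - cocycle y x⟩

/-- Antisymmetrising the cocycle yields the same minors as the product in the H-algebra. -/
theorem commutator_eq (x y : HGroupModel p Γ) : ⁅x, y⁆ = commVal x.vert y.vert := by
  rw [commutatorElement_def, mul_inv_eq_iff_eq_mul, mul_inv_eq_iff_eq_mul]
  refine ext ?_ ?_
  · simp only [mul_vert, commVal]
    abel
  · simp only [mul_vert, mul_pair, commVal, zero_add, cocycle_zero_left]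
    abel

open Classical in
/-- The standard generators of the model. -/
noncomputable def gen (p : ℕ) (Γ : SimpleGraph (Fin n)) : HIndex n → HGroupModel p Γ
  | .inl i => ⟨Pi.single i 1, 0⟩
  | .inr e => ⟨0, Pi.single e 1⟩

theorem cocycle_single (i j : Fin n) (e : {e : Fin n × Fin n // e.1 < e.2}) :
    cocycle (Γ := Γ) (Pi.single i (1 : ZMod (p ^ 3))) (Pi.single j 1) e =
      if e.1.1 = i ∧ e.1.2 = j then 1 else 0 := by
  rw [cocycle, Pi.single_apply, Pi.single_apply]
  split_ifs <;> simp_all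

theorem isHSystem_gen : IsHSystem p Γ (gen p Γ) where
  comm e := by
    classical
    rw [commutator_eq]
    refine ext rfl (funext fun e' => ?_)
    simp only [commVal, gen, Pi.sub_apply, cocycle_single]
    obtain ⟨⟨a, b⟩, hab⟩ := e
    obtain ⟨⟨c, d⟩, hcd⟩ := e'
    simp only at hab hcd ⊢
    have h2 : ¬ (c = b ∧ d = a) := by
      rintro ⟨rfl, rfl⟩
      exact absurd hab (lt_asymm hcd)
    rw [if_neg h2, sub_zero]
    by_cases h1 : c = a ∧ d = b
    · obtain ⟨rfl, rfl⟩ := h1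
      rw [if_pos ⟨rfl, rfl⟩, Pi.single_eq_same]
    · rw [if_neg h1, Pi.single_eq_of_ne]
      simpa using h1
  central e k := by
    refine ext ?_ ?_
    · rw [mul_vert, mul_vert, add_comm]
    · rw [mul_pair, mul_pair]
      simp only [gen, cocycle_zero_left, cocycle_zero_right]
      abel
  order k := by
    cases k with
    | inl i =>
      rw [pow_eq]
      · refine ext (funext fun j => ?_) (smul_zero _)
        change p ^ 3 • (Pi.single i (1 : ZMod (p ^ 3)) : Fin n → ZMod (p ^ 3)) j = 0
        rw [nsmul_eq_mul, ZMod.natCast_self, zero_mul]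
      · funext e
        change cocycle (Pi.single i 1) (Pi.single i 1) e = 0
        rw [cocycle_single, if_neg]
        rintro ⟨h1, h2⟩
        exact e.2.ne (h1.trans h2.symm)
    | inr e =>
      rw [pow_eq (cocycle_zero_left _)]
      refine ext (smul_zero _) (funext fun e' => ?_)
      classical
      change hOrder p Γ (.inr e) • (Pi.single e 1 : ∀ e, ZMod (hOrder p Γ (.inr e))) e' = 0
      by_cases he : e' = e
      · subst he
        rw [nsmul_eq_mul, ZMod.natCast_self, zero_mul]
      · rw [Pi.single_eq_of_ne he, smul_zero]

end HGroupModel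

/-! ### Residues in H-groups, and recovery of the graph -/

namespace HGroup

variable {p n m : ℕ} {Γ : SimpleGraph (Fin n)} {Δ : SimpleGraph (Fin m)}

/-- The homomorphism to the model. -/
noncomputable def toModel (p : ℕ) (Γ : SimpleGraph (Fin n)) : HGroup p Γ →* HGroupModel p Γ :=
  (exists_hom HGroupModel.isHSystem_gen).choose

theorem toModel_gen (k : HIndex n) : toModel p Γ (gen p Γ k) = HGroupModel.gen p Γ k :=
  (exists_hom HGroupModel.isHSystem_gen).choose_spec k

/-- The vertex exponents modulo `p`. -/
noncomputable def resid (p : ℕ) (Γ : SimpleGraph (Fin n)) :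
    HGroup p Γ →* Multiplicative (Fin n → ZMod p) where
  toFun x := .ofAdd fun i => modP p ((toModel p Γ x).vert i)
  map_one' := by
    rw [map_one, HGroupModel.one_vert]
    simp only [Pi.zero_apply, map_zero]
    rfl
  map_mul' x y := by
    rw [map_mul, HGroupModel.mul_vert]
    simp only [Pi.add_apply, map_add]
    rfl

theorem resid_gen (i : Fin n) :
    (resid p Γ (gen p Γ (.inl i))).toAdd = Pi.single i 1 := by
  funext j
  change modP p ((toModel p Γ (gen p Γ (.inl i))).vert j) = _
  rw [toModel_gen]
  simp only [HGroupModel.gen, Pi.single_apply]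
  split_ifs <;> simp

theorem resid_commutator (x y : HGroup p Γ) : resid p Γ ⁅x, y⁆ = 1 := by
  rw [map_commutatorElement, commutatorElement_eq_one_iff_commute]
  exact mul_comm _ _

theorem comm_resid [Fact p.Prime] {x y : HGroup p Γ} (h : ⁅x, y⁆ ^ p = 1) :
    GraphComm.Comm Γ (resid p Γ x).toAdd (resid p Γ y).toAdd := by
  have key : ∀ e : {e : Fin n × Fin n // e.1 < e.2}, ¬ Γ.Adj e.1.1 e.1.2 →
      (resid p Γ x).toAdd e.1.1 * (resid p Γ y).toAdd e.1.2 =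
        (resid p Γ x).toAdd e.1.2 * (resid p Γ y).toAdd e.1.1 := by
    intro e he
    have h1 := congrArg (toModel p Γ) h
    rw [map_pow, map_commutatorElement, map_one, HGroupModel.commutator_eq,
      HGroupModel.pow_eq (HGroupModel.cocycle_zero_left _)] at h1
    have h2 := congrFun (congrArg HGroupModel.pair h1) e
    change p • (redHom p Γ (.inr e) _ - redHom p Γ (.inr e) _) = 0 at h2
    rw [← map_sub] at h2
    have h3 := modP_eq_zero_of_smul_redHom he h2
    rw [map_sub, map_mul, map_mul, sub_eq_zero] at h3
    exact h3.trans (mul_comm _ _)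
  intro k l hkl hn
  rcases lt_or_gt_of_ne hkl with h' | h'
  · exact key ⟨(k, l), h'⟩ hn
  · exact (key ⟨(l, k), h'⟩ fun h => hn h.symm).symm

variable [Fact p.Prime]

/-- The group is not abelian, so the coordinates are adjusted one after another by powers of
generators. -/
theorem resid_surjective :
    Function.Surjective fun x => (resid p Γ x).toAdd := by
  have h : ∀ s : Finset (Fin n), ∀ y : Fin n → ZMod p, (∀ i ∉ s, y i = 0) →
      ∃ x, (resid p Γ x).toAdd = y := by
    intro s
    induction s using Finset.induction_on with
    | empty =>
      intro y hy
      exact ⟨1, by rw [map_one]; exact (funext fun i => hy i (by simp)).symm⟩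
    | insert i s hi ih =>
      intro y hy
      obtain ⟨x, hx⟩ := ih (y - Pi.single i (y i)) (fun j hj => by
        by_cases hji : j = i
        · subst hji
          simp
        · simp [hji, hy j (by simp [hji, hj])])
      refine ⟨x * gen p Γ (.inl i) ^ (y i).val, ?_⟩
      rw [map_mul, toAdd_mul, hx, map_pow, toAdd_pow, resid_gen, ← Pi.single_smul, nsmul_one,
        ZMod.natCast_zmod_val, sub_add_cancel]
  exact fun y => h Finset.univ y (by simp)

theorem exists_linearMap_resid (f : HGroup p Γ ≃* HGroup p Δ) :
    ∃ φ : (Fin n → ZMod p) →ₗ[ZMod p] (Fin m → ZMod p),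
      ∀ x, φ (resid p Γ x).toAdd = (resid p Δ (f x)).toAdd := by
  obtain ⟨φ, hφ⟩ := GraphComm.exists_linearMap (F := ZMod p)
    fun i => (resid p Δ (f (gen p Γ (.inl i)))).toAdd
  refine ⟨φ, fun x => ?_⟩
  have hx : x ∈ Subgroup.closure (Set.range (gen p Γ)) :=
    (PresentedGroup.closure_range_of _).symm ▸ Subgroup.mem_top x
  induction hx using Subgroup.closure_induction with
  | mem x hx =>
    obtain ⟨k, rfl⟩ := hx
    cases k with
    | inl i => rw [resid_gen, hφ]
    | inr e =>
      rw [← isHSystem_gen.comm, resid_commutator, map_commutatorElement f, resid_commutator,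
        toAdd_one, toAdd_one, map_zero]
  | one => simp
  | mul x y _ _ hx hy => simp [hx, hy]
  | inv x _ hx => simp [hx]

theorem nonempty_iso_of_mulEquiv (f : HGroup p Γ ≃* HGroup p Δ) : Nonempty (Γ ≃g Δ) := by
  obtain ⟨φ, hφ⟩ := exists_linearMap_resid f
  obtain ⟨ψ, hψ⟩ := exists_linearMap_resid f.symm
  refine GraphComm.nonempty_iso_of_equiv f.toEquiv _ _ resid_surjective resid_surjective φ hφ ψ hψ
    (fun i => gen p Γ (.inl i)) resid_gen (fun i => gen p Δ (.inl i)) resid_gen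
    (fun i j hij => ?_) fun i j hij => ?_
  · refine comm_resid ?_
    change ⁅f _, f _⁆ ^ p = 1
    rw [← map_commutatorElement, ← map_pow, isHSystem_gen.commutator_pow_edge hij, map_one]
  · refine comm_resid ?_
    change ⁅f.symm _, f.symm _⁆ ^ p = 1
    rw [← map_commutatorElement, ← map_pow, isHSystem_gen.commutator_pow_edge hij, map_one]

theorem nonempty_mulEquiv_iff : Nonempty (HGroup p Γ ≃* HGroup p Δ) ↔ Nonempty (Γ ≃g Δ) :=
  ⟨fun ⟨f⟩ => nonempty_iso_of_mulEquiv f, fun ⟨σ⟩ => nonempty_mulEquiv_of_iso σ⟩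

end HGroup

namespace GroupPres

/-- `P` is the standard presentation of the H-group of `Γ` for the numbering `b` of the
generators. -/
def IsPresOf (p : ℕ) (P : GroupPres) {n : ℕ} (Γ : SimpleGraph (Fin n))
    (b : Fin P.size ≃ HIndex n) : Prop :=
  ∀ w : List (HIndex n × Bool), HRelator p Γ w ↔ ∃ u ∈ P.rels, w = u.map (Prod.map b id)

theorem IsPresOf.nonempty_mulEquiv {p : ℕ} {P : GroupPres} {n : ℕ} {Γ : SimpleGraph (Fin n)}
    {b : Fin P.size ≃ HIndex n} (h : IsPresOf p P Γ b) : Nonempty (P.Grp ≃* HGroup p Γ) := by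
  have hset : FreeGroup.freeGroupCongr b '' (FreeGroup.mk '' {w | w ∈ P.rels}) =
      FreeGroup.mk '' {w | HRelator p Γ w} := by
    rw [Set.image_image]
    ext x
    constructor
    · rintro ⟨u, hu, rfl⟩
      exact ⟨u.map (Prod.map b id), (h _).2 ⟨u, hu, rfl⟩, rfl⟩
    · rintro ⟨w, hw, rfl⟩
      obtain ⟨u, hu, rfl⟩ := (h w).1 hw
      exact ⟨u, hu, rfl⟩
  have := PresentedGroup.equivPresentedGroup (FreeGroup.mk '' {w | w ∈ P.rels}) b
  rw [hset] at this
  exact ⟨this⟩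

end GroupPres

/-! ## The multigraph of a group -/

section Multigraph

variable {G H : Type u} [Group G] [Group H]

open Classical in
theorem groupMultigraph_iso_of_mulEquiv (φ : G ≃* H) :
    (groupMultigraph G).Iso (groupMultigraph H) := by
  refine ⟨Equiv.sumCongr φ.toEquiv (Equiv.prodCongr φ.toEquiv (Equiv.prodCongr φ.toEquiv
    φ.toEquiv)), ?_⟩
  have h : ∀ x y, (φ x = φ y) = (x = y) := fun x y => propext φ.apply_eq_iff_eq
  rintro (a | ⟨u, v, w⟩) (b | ⟨u', v', w'⟩)
  · rfl
  · change (if φ a = φ u' then 1 else 0) +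
      (if φ a = φ v' then (if φ u' * φ v' = φ w' then 2 else 1) else 0) = _
    rw [← map_mul, h, h, h]
    rfl
  · change (if φ u * φ v = φ w ∧ φ b = φ w then 1 else 0) = _
    rw [← map_mul, h, h]
    rfl
  · rfl

/-- This characterises the elements within the multigraph: `a` sends three edges to `(a, a, a * a)`,
whereas a triple sends at most one edge to any vertex. -/
theorem two_le_mult_iff (x : G ⊕ G × G × G) :
    (∃ y, 2 ≤ (groupMultigraph G).mult x y) ↔ ∃ a, x = .inl a := by
  constructor
  · rintro ⟨y, hy⟩
    rcases x with a | ⟨u, v, w⟩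
    · exact ⟨a, rfl⟩
    · rcases y with b | ⟨u', v', w'⟩
      · simp only [groupMultigraph] at hy
        split_ifs at hy <;> omega
      · simp [groupMultigraph] at hy
  · rintro ⟨a, rfl⟩
    exact ⟨.inr (a, a, a * a), by simp [groupMultigraph]⟩

theorem exists_eq_inl_iff {f : G ⊕ G × G × G ≃ H ⊕ H × H × H}
    (hf : ∀ x y, (groupMultigraph H).mult (f x) (f y) = (groupMultigraph G).mult x y)
    (x : G ⊕ G × G × G) : (∃ b, f x = .inl b) ↔ ∃ a, x = .inl a := by
  rw [← two_le_mult_iff, ← two_le_mult_iff, f.surjective.exists]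
  simp only [hf]

theorem nonempty_mulEquiv_of_groupMultigraph_iso
    (h : (groupMultigraph G).Iso (groupMultigraph H)) : Nonempty (G ≃* H) := by
  classical
  obtain ⟨f, hf⟩ := h
  choose φ hφ using fun a => (exists_eq_inl_iff hf (.inl a)).2 ⟨a, rfl⟩
  have hbij : Function.Bijective φ := by
    refine ⟨fun a b hab => ?_, fun b => ?_⟩
    · have : f (.inl a) = f (.inl b) := by rw [hφ, hφ, hab]
      exact Sum.inl_injective (f.injective this)
    · obtain ⟨a, ha⟩ := (exists_eq_inl_iff hf (f.symm (.inl b))).1 ⟨b, f.apply_symm_apply _⟩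
      refine ⟨a, Sum.inl_injective (β := H × H × H) ?_⟩
      rw [← hφ, ← ha, f.apply_symm_apply]
  refine ⟨MulEquiv.ofBijective (MonoidHom.mk' φ fun u v => ?_) hbij⟩
  rcases hx : f (.inr (u, v, u * v)) with b | ⟨u', v', w'⟩
  · obtain ⟨a, ha⟩ := (exists_eq_inl_iff hf _).1 ⟨b, hx⟩
    cases ha
  · have h1 := hf (.inr (u, v, u * v)) (.inl (u * v))
    have h2 := hf (.inl u) (.inr (u, v, u * v))
    have h3 := hf (.inl v) (.inr (u, v, u * v))
    rw [hx, hφ] at h1 h2 h3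
    simp only [groupMultigraph, and_self, if_true, ite_eq_left_iff, zero_ne_one, imp_false,
      not_not] at h1 h2 h3
    rw [if_pos h1.1] at h2 h3
    -- By `h1` the image triple is a true product, so `φ u` sends it one edge for being `u'` and two
    -- for being `v'`. In `G` the number sent by `u` is one or three, hence odd.
    have hu : φ u = u' := by
      by_contra hne
      rw [if_neg hne] at h2
      split_ifs at h2 <;> omega
    -- The element `v` sends at least two edges, and at most one is possible without `φ v = v'`.
    have hv : φ v = v' := by
      by_contra hne
      rw [if_neg hne] at h3
      split_ifs at h3 <;> omega
    rw [h1.2, hu, hv, h1.1]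

theorem nonempty_mulEquiv_iff_groupMultigraph_iso :
    Nonempty (G ≃* H) ↔ (groupMultigraph G).Iso (groupMultigraph H) :=
  ⟨fun ⟨φ⟩ => groupMultigraph_iso_of_mulEquiv φ, nonempty_mulEquiv_of_groupMultigraph_iso⟩

omit [Group G] in
theorem card_groupMultigraph_le [Fintype G] :
    Fintype.card (G ⊕ G × G × G) ≤ 2 * Fintype.card G ^ 3 := by
  simp only [Fintype.card_sum, Fintype.card_prod]
  have := Nat.le_self_pow (three_ne_zero) (Fintype.card G)
  calc _ = Fintype.card G + Fintype.card G ^ 3 := by ring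
    _ ≤ _ := by omega

/-- Each triple receives at most three edges and sends at most one, and every edge has a triple at
exactly one end. -/
theorem sum_mult_groupMultigraph_le [Fintype G] :
    ∑ x, ∑ y, (groupMultigraph G).mult x y ≤ 4 * Fintype.card G ^ 3 := by
  classical
  have hin : ∀ t : G × G × G, ∑ a, (groupMultigraph G).mult (.inl a) (.inr t) ≤ 3 := by
    rintro ⟨u, v, w⟩
    simp only [groupMultigraph, Finset.sum_add_distrib, Finset.sum_ite_eq', Finset.mem_univ,
      if_true]
    split_ifs <;> omega
  have hout : ∀ t : G × G × G, ∑ a, (groupMultigraph G).mult (.inr t) (.inl a) ≤ 1 := by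
    rintro ⟨u, v, w⟩
    refine (Finset.sum_le_sum (g := fun a => if a = w then 1 else 0) fun a _ => ?_).trans
      (by simp)
    simp only [groupMultigraph]
    split_ifs with h1 h2 h2
    · exact le_rfl
    · exact absurd h1.2 h2
    all_goals omega
  have h0 : ∀ a b : G, (groupMultigraph G).mult (.inl a) (.inl b) = 0 := fun _ _ => rfl
  have h1 : ∀ s t : G × G × G, (groupMultigraph G).mult (.inr s) (.inr t) = 0 := fun _ _ => rfl
  simp only [Fintype.sum_sum_type, h0, h1, Finset.sum_const_zero, zero_add, add_zero]
  rw [Finset.sum_comm, ← Finset.sum_add_distrib]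
  calc _ ≤ ∑ _t : G × G × G, 4 := Finset.sum_le_sum fun t _ => add_le_add (hin t) (hout t)
    _ = 4 * Fintype.card G ^ 3 := by
      simp only [Finset.sum_const, Finset.card_univ, Fintype.card_prod, smul_eq_mul]
      ring

end Multigraph

/-! ## The size of the presentations -/

theorem card_hIndex_le (n : ℕ) : Fintype.card (HIndex n) ≤ n ^ 2 := by
  -- Vertices occupy the diagonal, which no pair with `e.1 < e.2` meets.
  have hinj : Function.Injective (Sum.elim (fun i => (i, i)) Subtype.val : HIndex n → _) := by
    refine Function.Injective.sumElim (fun i j h => (Prod.ext_iff.1 h).1)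
      Subtype.val_injective ?_
    rintro i ⟨e, he⟩ rfl
    exact lt_irrefl _ he
  have := Fintype.card_le_of_injective _ hinj
  rwa [Fintype.card_prod, Fintype.card_fin, ← sq] at this

section Relators

variable {p n : ℕ} {Γ : SimpleGraph (Fin n)}

-- The index type has at most n² + n²·n² + n² elements, which gives the bound 3n⁴.
open Classical in
theorem setOf_hRelator_subset : {w | HRelator p Γ w} ⊆
    Set.range fun k : {e : Fin n × Fin n // e.1 < e.2} ⊕
      ({e : Fin n × Fin n // e.1 < e.2} × HIndex n) ⊕ HIndex n => match k with
        | .inl e => commWord (.inl e.1.1) (.inl e.1.2) ++ [(.inr e, false)]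
        | .inr (.inl (e, l)) => commWord (.inr e) l
        | .inr (.inr l) => List.replicate (hOrder p Γ l) (l, true) := by
  rintro w (e | ⟨e, e'⟩ | ⟨e, i⟩ | i | ⟨e, h⟩ | ⟨e, h⟩)
  · exact ⟨.inl e, rfl⟩
  · exact ⟨.inr (.inl (e, .inr e')), rfl⟩
  · exact ⟨.inr (.inl (e, .inl i)), rfl⟩
  · exact ⟨.inr (.inr (.inl i)), rfl⟩
  · exact ⟨.inr (.inr (.inr e)), by simp only [hOrder_edge h]⟩
  · exact ⟨.inr (.inr (.inr e)), by simp only [hOrder_nonedge h]⟩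

theorem finite_setOf_hRelator : {w | HRelator p Γ w}.Finite :=
  (Set.finite_range _).subset setOf_hRelator_subset

theorem ncard_setOf_hRelator_le : {w | HRelator p Γ w}.ncard ≤ 3 * n ^ 4 := by
  have h1 := Set.ncard_le_ncard (setOf_hRelator_subset (p := p) (Γ := Γ)) (Set.finite_range _)
  refine h1.trans ?_
  rw [← Set.image_univ]
  refine (Set.ncard_image_le Set.finite_univ).trans ?_
  rw [Set.ncard_univ, Nat.card_eq_fintype_card, Fintype.card_sum, Fintype.card_sum,
    Fintype.card_prod]
  have h2 := card_hIndex_le n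
  have h3 : Fintype.card {e : Fin n × Fin n // e.1 < e.2} ≤ n ^ 2 := by
    rw [Fintype.card_sum] at h2
    omega
  have h4 : n ^ 2 ≤ n ^ 4 := by
    rcases Nat.eq_zero_or_pos n with rfl | h
    · rfl
    · exact Nat.pow_le_pow_right h (by norm_num)
  have h5 := Nat.mul_le_mul h3 h2
  rw [← pow_add, show 2 + 2 = 4 from rfl] at h5
  omega

theorem HRelator.length_le [Fact p.Prime] {w : List (HIndex n × Bool)} (h : HRelator p Γ w) :
    w.length ≤ p ^ 3 := by
  have h2 : 2 ≤ p := (Fact.out : p.Prime).two_le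
  -- The relators other than powers have at most five letters.
  have h8 : 2 ^ 3 ≤ p ^ 3 := Nat.pow_le_pow_left h2 3
  cases h with
  | pow_g => rw [List.length_replicate]
  | edge => rw [List.length_replicate]; exact Nat.le_self_pow three_ne_zero p
  | nonedge => rw [List.length_replicate]; exact Nat.pow_le_pow_right (by omega) (by norm_num)
  | _ => simp only [commWord, List.length_append, List.length_cons, List.length_nil]; omega

end Relators

/-! ## Definable relations -/

namespace StackProgram

variable {X A : Type} {enc : X → List A} {k : ℕ}

open Classical in
/-- Relations between an instance, given as a word by `enc`, and `k` variables, that can be decided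
by bounded loops. -/
def Dec (enc : X → List A) (k : ℕ) (φ : X → Ctx k → Prop) : Prop :=
  Num enc k fun x c => if φ x c then 1 else 0

theorem Num.sum {e : X → Ctx k → ℕ} {f : X → Ctx k → ℕ → ℕ} (he : Num enc k e)
    (hf : Num enc (k + 1) fun x c => f x c.1 c.2) :
    Num enc k fun x c => ∑ i ∈ Finset.range (e x c), f x c i := .sum' he hf

theorem Num.mul {f g : X → Ctx k → ℕ} (hf : Num enc k f) (hg : Num enc k g) :
    Num enc k fun x c => f x c * g x c := by
  have := Num.sum (f := fun x c _ => g x c) hf hg.weak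
  simpa using this

theorem Dec.of_ne_zero {f : X → Ctx k → ℕ} (hf : Num enc k f) : Dec enc k fun x c => f x c ≠ 0 := by
  unfold Dec
  convert Num.sub (.const 1) (Num.sub (.const 1) hf) using 4
  split_ifs <;> omega

theorem Dec.of_iff {f : X → Ctx k → ℕ} {φ : X → Ctx k → Prop} (hf : Num enc k f)
    (h : ∀ x c, φ x c ↔ f x c ≠ 0) : Dec enc k φ := by
  have : φ = fun x c => f x c ≠ 0 := by
    funext x c
    exact propext (h x c)
  rw [this]
  exact .of_ne_zero hf

theorem Dec.congr {φ ψ : X → Ctx k → Prop} (hφ : Dec enc k φ) (h : ∀ x c, ψ x c ↔ φ x c) :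
    Dec enc k ψ := by
  have : ψ = φ := by
    funext x c
    exact propext (h x c)
  rwa [this]

theorem Num.congr {f g : X → Ctx k → ℕ} (hf : Num enc k f) (h : ∀ x c, g x c = f x c) :
    Num enc k g := by
  have : g = f := by
    funext x c
    exact h x c
  rwa [this]

theorem Dec.not {φ : X → Ctx k → Prop} (hφ : Dec enc k φ) : Dec enc k fun x c => ¬ φ x c := by
  refine .of_iff (.sub (.const 1) hφ) fun x c => ?_
  split_ifs with h <;> simp [h]

theorem Dec.and {φ ψ : X → Ctx k → Prop} (hφ : Dec enc k φ) (hψ : Dec enc k ψ) :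
    Dec enc k fun x c => φ x c ∧ ψ x c := by
  refine .of_iff (.mul hφ hψ) fun x c => ?_
  split_ifs with h h' <;> simp_all

theorem Dec.or {φ ψ : X → Ctx k → Prop} (hφ : Dec enc k φ) (hψ : Dec enc k ψ) :
    Dec enc k fun x c => φ x c ∨ ψ x c := by
  refine .of_iff (.add hφ hψ) fun x c => ?_
  split_ifs with h h' <;> simp_all

theorem Dec.lt {f g : X → Ctx k → ℕ} (hf : Num enc k f) (hg : Num enc k g) :
    Dec enc k fun x c => f x c < g x c :=
  .of_iff (.sub hg hf) fun x c => by omega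

theorem Dec.eq {f g : X → Ctx k → ℕ} (hf : Num enc k f) (hg : Num enc k g) :
    Dec enc k fun x c => f x c = g x c :=
  .of_iff (.sub (.const 1) (.add (.sub hg hf) (.sub hf hg))) fun x c => by omega

theorem Dec.ex {e : X → Ctx k → ℕ} {φ : X → Ctx k → ℕ → Prop} (he : Num enc k e)
    (hφ : Dec enc (k + 1) fun x c => φ x c.1 c.2) :
    Dec enc k fun x c => ∃ i < e x c, φ x c i := by
  classical
  refine .of_iff (.sum' he hφ) fun x c => ?_
  simp

theorem Dec.all {e : X → Ctx k → ℕ} {φ : X → Ctx k → ℕ → Prop} (he : Num enc k e)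
    (hφ : Dec enc (k + 1) fun x c => φ x c.1 c.2) :
    Dec enc k fun x c => ∀ i < e x c, φ x c i :=
  (Dec.ex (φ := fun x c i => ¬ φ x c i) he hφ.not).not.congr fun x c => by push Not; rfl

theorem Dec.sym (S : A → Prop) {f : X → Ctx k → ℕ} (hf : Num enc k f) :
    Dec enc k fun x c => ∃ a ∈ (enc x)[f x c]?, S a := by
  unfold Dec
  convert Num.sym' S hf

open Classical in
theorem Num.count {e : X → Ctx k → ℕ} {φ : X → Ctx k → ℕ → Prop} (he : Num enc k e)
    (hφ : Dec enc (k + 1) fun x c => φ x c.1 c.2) :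
    Num enc k fun x c => Nat.count (φ x c) (e x c) :=
  (Num.sum' he hφ).congr fun x c => by
    rw [Nat.count_eq_card_filter_range, Finset.card_filter]

section Out

variable {B : Type}

theorem Out.congr {s t : X → Ctx k → List B} (hs : Out enc B k s) (h : ∀ x c, t x c = s x c) :
    Out enc B k t := by
  have : t = s := by
    funext x c
    exact h x c
  rwa [this]

theorem Out.for {e : X → Ctx k → ℕ} {t : X → Ctx k → ℕ → List B} (he : Num enc k e)
    (ht : Out enc B (k + 1) fun x c => t x c.1 c.2) :
    Out enc B k fun x c => (List.range (e x c)).flatMap (t x c) := .flatMap' he ht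

/-- A branch is a loop whose number of rounds is the truth value of the condition. -/
theorem Out.ite {φ : X → Ctx k → Prop} [∀ x c, Decidable (φ x c)]
    {s t : X → Ctx k → List B} (hφ : Dec enc k φ)
    (hs : Out enc B k s) (ht : Out enc B k t) :
    Out enc B k fun x c => if φ x c then s x c else t x c := by
  refine (Out.append (.flatMap' hφ hs.weak) (.flatMap' hφ.not ht.weak)).congr fun x c => ?_
  by_cases h : φ x c <;> simp [h]

theorem Out.replicate {e : X → Ctx k → ℕ} (he : Num enc k e) (b : B) :
    Out enc B k fun x c => List.replicate (e x c) b :=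
  (Out.flatMap' he (.emit b)).congr fun x c => by
    simp [List.flatMap_def]

theorem Out.map {B' : Type} (u : B → B') {t : X → Ctx k → List B} (ht : Out enc B k t) :
    Out enc B' k fun x c => (t x c).map u := by
  induction ht with
  | nil => exact .nil
  | emit b => exact .emit (u b)
  | weak _ ih => exact ih.weak
  | append _ _ ihs iht => exact (Out.append ihs iht).congr fun x c => List.map_append
  | flatMap' he _ ih => exact (Out.flatMap' he ih).congr fun x c => List.map_flatMap

end Out

/-! ## Readable words and graphs -/

/-- The letters of the word `w x` can be read from the word `enc x`. -/
structure Access {A' : Type} (enc : X → List A) (w : X → List A') : Prop where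
  len {k : ℕ} : Num enc k fun x _ => (w x).length
  sym {k : ℕ} (S : A' → Prop) {e : X → Ctx k → ℕ} (he : Num enc k e) :
    Dec enc k fun x c => ∃ a ∈ (w x)[e x c]?, S a

section Pair

variable {A' : Type}

theorem exists_mem_getElem?_pairWord_left (u v : List A') (S : A' → Prop) (i : ℕ) :
    (∃ a ∈ u[i]?, S a) ↔ i < u.length ∧ ∃ a ∈ (pairWord u v)[i]?, ∃ b ∈ a, S b := by
  by_cases h : i < u.length
  · rw [pairWord, List.getElem?_append_left (by simpa using h)]
    simp [h]
  · simp [h]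

theorem getElem?_pairWord_right (u v : List A') (i : ℕ) :
    (pairWord u v)[u.length + 1 + i]? = (v[i]?).map some := by
  rw [pairWord, List.getElem?_append_right (by simp; omega), List.length_map,
    show u.length + 1 + i - u.length = i + 1 by omega, List.getElem?_cons_succ, List.getElem?_map]

theorem getElem?_pairWord_mid (u v : List A') :
    (pairWord u v)[u.length]? = some none := by
  rw [pairWord, List.getElem?_append_right (by simp), List.length_map, Nat.sub_self,
    List.getElem?_cons_zero]

theorem length_pairWord (u v : List A') : (pairWord u v).length = u.length + 1 + v.length := by
  simp [pairWord]
  omega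

/-- The separator stands at position `u.length`, so `i` lies in the first word when no separator has
occurred up to `i`. This makes the length of the first word computable by counting. -/
theorem lt_length_iff_pairWord (u v : List A') (i : ℕ) :
    i < u.length ↔ ∀ j < i + 1, ∃ a ∈ (pairWord u v)[j]?, ∃ b ∈ a, True := by
  constructor
  · intro h j hj
    exact ((exists_mem_getElem?_pairWord_left u v (fun _ => True) j).1
      ⟨_, List.getElem?_eq_getElem (by omega), trivial⟩).2
  · intro h
    by_contra hi
    obtain ⟨a, ha, b, hb, -⟩ := h u.length (by omega)
    rw [getElem?_pairWord_mid] at ha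
    cases ha
    cases hb

variable (u v : X → List A')

theorem num_length_left :
    Num (fun x => pairWord (u x) (v x)) k fun x _ => (u x).length := by
  classical
  refine (Num.count (φ := fun x _ i => ∀ j < i + 1, ∃ a ∈ (pairWord (u x) (v x))[j]?, ∃ b ∈ a, True)
    .len (.all (.add .last (.const 1)) (.sym (fun a => ∃ b ∈ a, True) .last))).congr fun x c => ?_
  simp only [← lt_length_iff_pairWord]
  rw [Nat.count_eq_card_filter_range, length_pairWord]
  have : (Finset.range ((u x).length + 1 + (v x).length)).filter (· < (u x).length) =
      Finset.range (u x).length := by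
    ext i
    simp only [Finset.mem_filter, Finset.mem_range]
    omega
  rw [this, Finset.card_range]

theorem access_left : Access (fun x => pairWord (u x) (v x)) u where
  len := num_length_left u v
  sym S _ he := (Dec.and (.lt he (num_length_left u v)) (.sym (fun a => ∃ b ∈ a, S b) he)).congr
    fun x _ => exists_mem_getElem?_pairWord_left (u x) (v x) S _

theorem access_right : Access (fun x => pairWord (u x) (v x)) v where
  len := (Num.sub .len (.add (num_length_left u v) (.const 1))).congr fun x c => by
    rw [length_pairWord]
    omega
  sym S e he := (Dec.sym (fun a => ∃ b ∈ a, S b)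
    (.add (.add (num_length_left u v) (.const 1)) he)).congr fun x c => by
      rw [getElem?_pairWord_right]
      simp

end Pair

/-- Adjacency of numbers as vertices of a graph. -/
def adjNat (Γ : FinGraph) (i j : ℕ) : Prop :=
  ∃ (hi : i < Γ.1) (hj : j < Γ.1), Γ.2.Adj ⟨i, hi⟩ ⟨j, hj⟩

/-- The graph `Γ x` can be read from the word `enc x`. -/
structure GraphAccess (enc : X → List A) (Γ : X → FinGraph) : Prop where
  order {k : ℕ} : Num enc k fun x _ => (Γ x).1
  adj {k : ℕ} {e f : X → Ctx k → ℕ} (he : Num enc k e) (hf : Num enc k f) :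
    Dec enc k fun x c => adjNat (Γ x) (e x c) (f x c)

/-- Graphs can be read from the objects of `I` by `g`, and written as objects by `mk`, so that
isomorphism is preserved in both directions. -/
structure GraphCoding {I : Type} (enc : I → List A) (iso : I → I → Prop) (g : I → FinGraph)
    (mk : FinGraph → I) : Prop where
  iso_iff (i j : I) : iso i j ↔ Nonempty ((g i).2 ≃g (g j).2)
  iso_mk_iff (Γ Δ : FinGraph) : iso (mk Γ) (mk Δ) ↔ Nonempty (Γ.2 ≃g Δ.2)
  read {X B : Type} {enc' : X → List B} {h : X → I} (H : Access enc' fun x => enc (h x)) :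
    GraphAccess enc' fun x => g (h x)
  write {X B : Type} {enc' : X → List B} {Γ : X → FinGraph} (H : GraphAccess enc' Γ) :
    Out enc' A 0 fun x _ => enc (mk (Γ x))

/-- Both graphs are read from the pair of words and written in the other coding; the oracle's answer
is then the answer. -/
theorem GraphCoding.reducible {I J A B : Type} [Finite A] [Finite B] {enc : I → List A}
    {enc' : J → List B} {iso : I → I → Prop} {iso' : J → J → Prop} {g : I → FinGraph}
    {g' : J → FinGraph} {mk : FinGraph → I} {mk' : FinGraph → J} (h : GraphCoding enc iso g mk)
    (h' : GraphCoding enc' iso' g' mk') (hinj : Function.Injective enc)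
    (hinj' : Function.Injective enc') :
    isoProblem I A enc hinj iso ≤ᴾₜ isoProblem J B enc' hinj' iso' := by
  refine reducible_of_out (hQ := ⟨(none : Option B)⟩) (P := isoProblem I A enc hinj iso)
    (Q := isoProblem J B enc' hinj' iso')
    (fun x : I × I => ((mk' (g x.1), mk' (g x.2)) : J × J)) ?_ fun x => ?_
  · have h1 := h'.write (h.read (access_left (fun x : I × I => enc x.1) fun x => enc x.2))
    have h2 := h'.write (h.read (access_right (fun x : I × I => enc x.1) fun x => enc x.2))
    exact .append (h1.map some) (.append (.emit none) (h2.map some))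
  · exact (h.iso_iff _ _).trans (h'.iso_mk_iff _ _).symm

end StackProgram

/-! ## Reading and writing adjacency matrices -/

theorem List.getElem?_flatMap_of_length {ι A : Type*} {f : ι → List A} {m : ℕ}
    (hf : ∀ a, (f a).length = m) (l : List ι) (i : ℕ) {j : ℕ} (hj : j < m) :
    (l.flatMap f)[i * m + j]? = l[i]?.bind fun a => (f a)[j]? := by
  induction l generalizing i with
  | nil => simp
  | cons a l ih =>
    rw [List.flatMap_cons]
    cases i with
    | zero =>
      rw [Nat.zero_mul, Nat.zero_add, List.getElem?_append_left (by rw [hf]; exact hj)]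
      rfl
    | succ i =>
      rw [List.getElem?_append_right (by rw [hf, Nat.succ_mul]; omega), hf,
        show (i + 1) * m + j - m = i * m + j by rw [Nat.succ_mul]; omega, ih,
        List.getElem?_cons_succ]

open Classical in
theorem List.count_getElem?_eq_countP {A : Type*} (w : List A) (S : A → Bool) :
    Nat.count (fun i => ∃ a ∈ w[i]?, S a) w.length = w.countP S := by
  induction w with
  | nil => simp
  | cons a w ih =>
    rw [List.length_cons, Nat.count_succ', List.countP_cons, ← ih]
    simp

theorem List.flatMap_finRange {B : Type*} (n : ℕ) (f : ℕ → List B) :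
    (List.finRange n).flatMap (fun i : Fin n => f i) = (List.range n).flatMap f := by
  have h : (List.finRange n).map Fin.val = List.range n := List.map_coe_finRange_eq_range
  rw [← h, List.flatMap_map]

namespace StackProgram

variable {X A : Type} {enc : X → List A} {k : ℕ}

open Classical in
theorem Access.countP {A' : Type} {w : X → List A'} (H : Access enc w) (S : A' → Bool) :
    Num enc k fun x _ => (w x).countP S :=
  (Num.count (φ := fun x _ i => ∃ a ∈ (w x)[i]?, S a) H.len
    (H.sym (fun a => S a) .last)).congr fun x _ => by
    rw [← List.count_getElem?_eq_countP]
    congr!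

theorem countP_word (Γ : FinGraph) : Γ.word.countP Option.isNone = Γ.1 := by
  simp [FinGraph.word, List.countP_flatMap, List.countP_map, Function.comp_def]

/-- Each row of the matrix has `Γ.1 + 1` letters because of its end mark. -/
theorem adjNat_iff_word (Γ : FinGraph) (i j : ℕ) : adjNat Γ i j ↔
    (i < Γ.1 ∧ j < Γ.1) ∧ ∃ a ∈ Γ.word[i * (Γ.1 + 1) + j]?, a = some true := by
  classical
  by_cases hi : i < Γ.1
  · by_cases hj : j < Γ.1
    · rw [FinGraph.word, List.getElem?_flatMap_of_length (m := Γ.1 + 1) (by simp) _ _ (by omega)]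
      simp [adjNat, hi, hj, List.getElem?_append_left]
    · simp [adjNat, hj]
  · simp [adjNat, hi]

theorem graphAccess_of_word {h : X → FinGraph} (H : Access enc fun x => (h x).word) :
    GraphAccess enc h := by
  have hn : ∀ k, Num enc k fun x _ => (h x).1 := fun k =>
    (H.countP Option.isNone).congr fun x _ => (countP_word (h x)).symm
  exact ⟨hn _, fun he hf => (Dec.and (.and (.lt he (hn _)) (.lt hf (hn _)))
    (H.sym (fun a => a = some true) (.add (.mul he (.add (hn _) (.const 1))) hf))).congr
      fun x c => adjNat_iff_word _ _ _⟩

open Classical in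
theorem word_eq (Γ : FinGraph) : Γ.word = (List.range Γ.1).flatMap fun i =>
    ((List.range Γ.1).flatMap fun j => if adjNat Γ i j then [some true] else [some false]) ++
      [none] := by
  rw [← List.flatMap_finRange, FinGraph.word]
  refine congrArg (fun f => List.flatMap f _) (funext fun i => ?_)
  rw [← List.flatMap_finRange, List.map_eq_flatMap]
  refine congrArg (fun f => List.flatMap f _ ++ _) (funext fun j => ?_)
  by_cases h : Γ.2.Adj i j <;> simp [adjNat, h]

theorem GraphAccess.out_word {Γ : X → FinGraph} (H : GraphAccess enc Γ) :
    Out enc (Option Bool) 0 fun x _ => (Γ x).word := by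
  classical
  have h1 : Out enc (Option Bool) 1 fun x c => (List.range (Γ x).1).flatMap fun j =>
      if adjNat (Γ x) c.2 j then [some true] else [some false] :=
    .for H.order (.ite (H.adj (.weak .last) .last) (.emit _) (.emit _))
  exact (Out.for H.order (.append h1 (.emit none))).congr fun x c => word_eq _

theorem graphCoding_word :
    GraphCoding FinGraph.word (fun Γ Δ => Nonempty (Γ.2 ≃g Δ.2)) id id where
  iso_iff _ _ := Iff.rfl
  iso_mk_iff _ _ := Iff.rfl
  read := graphAccess_of_word
  write := GraphAccess.out_word

/-! ## Renumbering vertices -/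

open Classical in
/-- The graph on the numbers `x < N` in `V`, renumbered from `0`, with adjacency given by `R`. -/
noncomputable def renumber (N : ℕ) (V : ℕ → Prop) (R : ℕ → ℕ → Prop) : FinGraph :=
  ⟨Nat.count V N, SimpleGraph.fromRel fun i j => ∃ x < N, ∃ y < N, (V x ∧ V y) ∧
    (Nat.count V x = i ∧ Nat.count V y = j) ∧ R x y⟩

/-- `s` enumerates the numbers that satisfy `V` below `N`, and `Nat.count` closes the gaps between
them. -/
theorem nonempty_iso_renumber {n : ℕ} {Γ : SimpleGraph (Fin n)} {N : ℕ} {V : ℕ → Prop}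
    {R : ℕ → ℕ → Prop} {s : Fin n → ℕ} (hs : Function.Injective s)
    (hV : ∀ x < N, V x ↔ ∃ i, s i = x) (hN : ∀ i, s i < N)
    (hR : ∀ i j, R (s i) (s j) ↔ Γ.Adj i j) : Nonempty (Γ ≃g (renumber N V R).2) := by
  classical
  have hsV : ∀ i, V (s i) := fun i => (hV _ (hN i)).2 ⟨i, rfl⟩
  have hinj : ∀ i j, Nat.count V (s i) = Nat.count V (s j) → i = j := fun i j h =>
    hs (Nat.count_injective (hsV i) (hsV j) h)
  let φ : Fin n → Fin (Nat.count V N) := fun i =>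
    ⟨Nat.count V (s i), Nat.count_strict_mono (hsV i) (hN i)⟩
  have hφ : Function.Bijective φ := by
    refine ⟨fun i j h => hinj i j (Fin.ext_iff.1 h), fun j => ?_⟩
    have hlt : Nat.nth V j < N := Nat.nth_lt_of_lt_count j.2
    have hcard : ∀ hf : (Set.ofPred V).Finite, (j : ℕ) < hf.toFinset.card := fun hf =>
      j.2.trans_le (Nat.count_le_card hf N)
    have hmem : V (Nat.nth V j) := Nat.nth_mem _ hcard
    obtain ⟨i, hi⟩ := (hV _ hlt).1 hmem
    refine ⟨i, Fin.ext ?_⟩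
    change Nat.count V (s i) = j
    rw [hi, Nat.count_nth hcard]
  refine ⟨⟨Equiv.ofBijective φ hφ, fun {i j} => ?_⟩⟩
  have key : ∀ i j, (∃ x < N, ∃ y < N, (V x ∧ V y) ∧
      (Nat.count V x = φ i ∧ Nat.count V y = φ j) ∧ R x y) ↔ Γ.Adj i j := by
    intro i j
    rw [← hR]
    constructor
    · rintro ⟨x, hx, y, hy, ⟨hVx, hVy⟩, ⟨h1, h2⟩, h⟩
      rwa [Nat.count_injective hVx (hsV i) h1, Nat.count_injective hVy (hsV j) h2] at h
    · exact fun h => ⟨_, hN i, _, hN j, ⟨hsV i, hsV j⟩, ⟨rfl, rfl⟩, h⟩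
  have key' : (φ i ≠ φ j ∧ (_ ∨ _)) ↔ (i ≠ j ∧ (Γ.Adj i j ∨ Γ.Adj j i)) :=
    and_congr hφ.1.ne_iff (or_congr (key i j) (key j i))
  refine Iff.trans key' ?_
  exact ⟨fun h => h.2.elim id fun h => h.symm, fun h => ⟨h.ne, .inl h⟩⟩

/-- The original number of a vertex is found by bounded search for the value of `Nat.count`, so the
renumbering is never inverted explicitly. -/
theorem graphAccess_renumber {N : X → ℕ} {V : X → ℕ → Prop} {R : X → ℕ → ℕ → Prop}
    (hN : ∀ k, Num enc k fun x _ => N x)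
    (hV : ∀ k (e : X → Ctx k → ℕ), Num enc k e → Dec enc k fun x c => V x (e x c))
    (hR : ∀ k (e f : X → Ctx k → ℕ), Num enc k e → Num enc k f →
      Dec enc k fun x c => R x (e x c) (f x c)) :
    GraphAccess enc fun x => renumber (N x) (V x) (R x) := by
  classical
  have hcount : ∀ k (e : X → Ctx k → ℕ), Num enc k e →
      Num enc k fun x c => Nat.count (V x) (e x c) := fun k e he =>
    Num.count (φ := fun x _ i => V x i) he (hV _ _ .last)
  have hadj : ∀ k (e f : X → Ctx k → ℕ), Num enc k e → Num enc k f →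
      Dec enc k fun x c => ∃ a < N x, ∃ b < N x, (V x a ∧ V x b) ∧
        (Nat.count (V x) a = e x c ∧ Nat.count (V x) b = f x c) ∧ R x a b := fun k e f he hf =>
    .ex (hN _) <| .ex (hN _) <| .and (.and (hV _ _ (.weak .last)) (hV _ _ .last)) <|
      .and (.and (.eq (hcount _ _ (.weak .last)) he.weak.weak)
        (.eq (hcount _ _ .last) hf.weak.weak)) (hR _ _ _ (.weak .last) .last)
  refine ⟨hcount _ _ (hN _), fun {k e f} he hf => ?_⟩
  refine (Dec.and (.and (.lt he (hcount _ _ (hN _))) (.lt hf (hcount _ _ (hN _))))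
    (.and (Dec.eq he hf).not (.or (hadj _ _ _ he hf) (hadj _ _ _ hf he)))).congr fun x c => ?_
  simp only [adjNat, renumber, SimpleGraph.fromRel_adj]
  exact ⟨fun ⟨hi, hj, hne, h⟩ => ⟨⟨hi, hj⟩, fun h' => hne (Fin.ext h'), h⟩,
    fun ⟨⟨hi, hj⟩, hne, h⟩ => ⟨hi, hj, fun h' => hne (Fin.ext_iff.1 h'), h⟩⟩

end StackProgram

/-! ## Reading multiplication tables -/

theorem redHom_eq_zero_iff {p n : ℕ} [Fact p.Prime] {Γ : SimpleGraph (Fin n)}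
    {e : {e : Fin n × Fin n // e.1 < e.2}} (h : Γ.Adj e.1.1 e.1.2) (c : ZMod (p ^ 3)) :
    redHom p Γ (.inr e) c = 0 ↔ modP p c = 0 := by
  obtain ⟨m, rfl⟩ := ZMod.natCast_zmod_surjective c
  rw [map_natCast, map_natCast, ZMod.natCast_eq_zero_iff, ZMod.natCast_eq_zero_iff, hOrder_edge h]

theorem HAlg.toModel_sum_smul {p n : ℕ} {Γ : SimpleGraph (Fin n)} [Fact p.Prime]
    (c : HIndex n → ZMod (p ^ 3)) (k : HIndex n) :
    toModel p Γ (∑ l, c l • hBasis p Γ l) k = redHom p Γ k (c k) := by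
  let ev : HModel p Γ →+ ZMod (hOrder p Γ k) :=
    Pi.evalAddMonoidHom (fun k => ZMod (hOrder p Γ k)) k
  change ev (toModel p Γ (∑ l, c l • hBasis p Γ l)) = _
  have hl : ∀ l, ev (toModel p Γ (c l • hBasis p Γ l)) =
      redHom p Γ k (c l) * HModel.basis p Γ l k := by
    intro l
    rw [NonUnitalRingHom.map_zmod_smul, toModel_hBasis, ← ZMod.natCast_zmod_val (c l),
      Nat.cast_smul_eq_nsmul, map_nsmul, map_natCast, ← nsmul_eq_mul]
    rfl
  rw [map_sum, map_sum, Finset.sum_congr rfl fun l _ => hl l, Finset.sum_eq_single k]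
  · rw [HModel.basis, Pi.single_eq_same, mul_one]
  · intro l _ hlk
    rw [HModel.basis, Pi.single_eq_of_ne hlk.symm, mul_zero]
  · exact fun h => absurd (Finset.mem_univ k) h

namespace AlgTable

variable {p n : ℕ} [Fact p.Prime] {Γ : SimpleGraph (Fin n)} {T : AlgTable p}
  {b : Fin T.size ≃ HIndex n}

theorem IsTableOf.hOrder_eq (h : T.IsTableOf Γ b) (k : Fin T.size) :
    hOrder p Γ (b k) = p ^ (T.ord k : ℕ) := (HAlg.isAdditiveBasis.1 (b k)).symm.trans (h.1 k)

theorem IsTableOf.ord_vertex (h : T.IsTableOf Γ b) {k : Fin T.size} :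
    T.ord k = 3 ↔ ∃ i, b.symm (.inl i) = k := by
  have hp : 1 < p := (Fact.out : p.Prime).one_lt
  have h1 := h.hOrder_eq k
  constructor
  · intro h3
    rw [h3] at h1
    cases hb : b k with
    | inl i => exact ⟨i, by rw [← hb, b.symm_apply_apply]⟩
    | inr e =>
      rw [hb] at h1
      by_cases he : Γ.Adj e.1.1 e.1.2
      · rw [hOrder_edge he] at h1
        have := Nat.pow_right_injective hp ((pow_one p).trans h1)
        cases this
      · rw [hOrder_nonedge he] at h1
        have := Nat.pow_right_injective hp h1
        cases this
  · rintro ⟨i, rfl⟩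
    rw [b.apply_symm_apply] at h1
    exact Fin.ext (Nat.pow_right_injective hp h1).symm

theorem IsTableOf.ord_edge (h : T.IsTableOf Γ b) {k : Fin T.size} :
    T.ord k = 1 ↔ ∃ e : {e : Fin n × Fin n // e.1 < e.2}, Γ.Adj e.1.1 e.1.2 ∧
      b.symm (.inr e) = k := by
  have hp : 1 < p := (Fact.out : p.Prime).one_lt
  have h1 := h.hOrder_eq k
  constructor
  · intro h3
    rw [h3] at h1
    cases hb : b k with
    | inl i =>
      rw [hb] at h1
      have := Nat.pow_right_injective hp h1
      cases this
    | inr e =>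
      rw [hb] at h1
      by_cases he : Γ.Adj e.1.1 e.1.2
      · exact ⟨e, he, by rw [← hb, b.symm_apply_apply]⟩
      · rw [hOrder_nonedge he] at h1
        have := Nat.pow_right_injective hp h1
        cases this
  · rintro ⟨e, he, rfl⟩
    rw [b.apply_symm_apply, hOrder_edge he] at h1
    exact Fin.ext (Nat.pow_right_injective hp ((pow_one p).trans h1)).symm

/-- A table determines the coefficient at an element of order p only modulo p, hence the test by
`modP`. Among edge generators, the product of two vertices has a non-zero coefficient only at their
own pair. -/
theorem IsTableOf.adj_iff (h : T.IsTableOf Γ b) (i j : Fin n) :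
    (∃ k, T.ord k = 1 ∧ modP p (T.coef (b.symm (.inl i)) (b.symm (.inl j)) k) ≠ 0) ↔
      Γ.Adj i j := by
  have key : ∀ e : {e : Fin n × Fin n // e.1 < e.2}, Γ.Adj e.1.1 e.1.2 →
      (modP p (T.coef (b.symm (.inl i)) (b.symm (.inl j)) (b.symm (.inr e))) ≠ 0 ↔
        (e.1.1 = i ∧ e.1.2 = j) ∨ (e.1.1 = j ∧ e.1.2 = i)) := by
    intro e he
    have h1 := h.2 (b.symm (.inl i)) (b.symm (.inl j))
    rw [b.apply_symm_apply, b.apply_symm_apply,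
      ← b.symm.sum_comp (fun k => T.coef _ _ k • hBasis p Γ (b k))] at h1
    simp only [b.apply_symm_apply] at h1
    have h2 := congrFun (congrArg (HAlg.toModel p Γ) h1) (.inr e)
    rw [HAlg.toModel_sum_smul, map_mul, HModel.mul_inr, HAlg.toModel_hBasis, HAlg.toModel_hBasis,
      HModel.basis_vert, HModel.basis_vert, HModel.basis_vert, HModel.basis_vert, ← sub_eq_zero,
      ← map_sub, redHom_eq_zero_iff he, map_sub, sub_eq_zero] at h2
    rw [← h2]
    have hne := e.2.ne
    have hne' := e.2.ne'
    by_cases h3 : e.1.1 = i <;> by_cases h4 : e.1.2 = j <;> by_cases h5 : e.1.1 = j <;>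
      by_cases h6 : e.1.2 = i <;> simp_all
  constructor
  · rintro ⟨k, hk, hc⟩
    obtain ⟨e, he, rfl⟩ := h.ord_edge.1 hk
    rcases (key e he).1 hc with ⟨h1, h2⟩ | ⟨h1, h2⟩
    · rwa [h1, h2] at he
    · rw [h1, h2] at he
      exact he.symm
  · intro hij
    rcases lt_or_gt_of_ne hij.ne with h' | h'
    · exact ⟨_, h.ord_edge.2 ⟨⟨(i, j), h'⟩, hij, rfl⟩, (key ⟨(i, j), h'⟩ hij).2 (.inl ⟨rfl, rfl⟩)⟩
    · exact ⟨_, h.ord_edge.2 ⟨⟨(j, i), h'⟩, hij.symm, rfl⟩,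
        (key ⟨(j, i), h'⟩ hij.symm).2 (.inr ⟨rfl, rfl⟩)⟩

omit [Fact p.Prime] in
theorem getElem?_word_ord (k : Fin T.size) : T.word[(k : ℕ)]? = some (.inl (T.ord k)) := by
  rw [word, List.getElem?_append_left (by simp)]
  simp

omit [Fact p.Prime] in
theorem getElem?_word_coef (i j k : Fin T.size) :
    T.word[T.size + (i * (T.size * T.size) + (j * T.size + k))]? = some (.inr (T.coef i j k)) := by
  have hjk : (j : ℕ) * T.size + k < T.size * T.size := by
    calc (j : ℕ) * T.size + k < j * T.size + T.size := by omega
      _ = (j + 1) * T.size := by ring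
      _ ≤ T.size * T.size := Nat.mul_le_mul_right _ (by omega)
  rw [word, List.getElem?_append_right (by simp), List.length_map, List.length_ofFn,
    Nat.add_sub_cancel_left, List.getElem?_flatMap_of_length (m := T.size * T.size)
      (by simp) _ _ hjk]
  have hi : (List.finRange T.size)[(i : ℕ)]? = some i := by simp
  rw [hi]
  simp only [Option.bind_some]
  rw [List.getElem?_flatMap_of_length (m := T.size) (by simp) _ _ k.2]
  simp

omit [Fact p.Prime] in
theorem countP_word : T.word.countP Sum.isLeft = T.size := by
  rw [word, List.countP_append, List.countP_eq_length.2 (by simp), List.countP_eq_zero.2]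
  · simp
  · simp only [List.mem_flatMap, List.mem_map]
    rintro a ⟨_, _, _, _, _, _, rfl⟩
    simp

/-- The graph that is read from a table. -/
noncomputable def graph (T : AlgTable p) : FinGraph :=
  StackProgram.renumber T.size (fun x => ∃ a ∈ T.word[x]?, a = .inl 3) fun x y =>
    ∃ k < T.size, (∃ a ∈ T.word[k]?, a = .inl 1) ∧
      ∃ a ∈ T.word[T.size + (x * (T.size * T.size) + (y * T.size + k))]?,
        ∃ c, a = .inr c ∧ modP p c ≠ 0

theorem IsTableOf.nonempty_iso_graph (h : T.IsTableOf Γ b) : Nonempty (Γ ≃g T.graph.2) := by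
  refine StackProgram.nonempty_iso_renumber (s := fun i => (b.symm (.inl i) : ℕ))
    (fun i j hij => by simpa using Fin.ext hij) (fun x hx => ?_) (fun i => Fin.is_lt _)
    fun i j => ?_
  · have := getElem?_word_ord (T := T) ⟨x, hx⟩
    simp only [this, Option.mem_some, exists_eq_left', Sum.inl.injEq, h.ord_vertex, Fin.ext_iff]
  · rw [← h.adj_iff]
    constructor
    · rintro ⟨k, hk, hk1, hk2⟩
      refine ⟨⟨k, hk⟩, ?_, ?_⟩
      · have := getElem?_word_ord (T := T) ⟨k, hk⟩
        simpa [this] using hk1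
      · have := getElem?_word_coef (T := T) (b.symm (.inl i)) (b.symm (.inl j)) ⟨k, hk⟩
        simpa [this] using hk2
    · rintro ⟨k, hk1, hk2⟩
      refine ⟨k, k.2, ?_, ?_⟩
      · simpa [getElem?_word_ord] using hk1
      · simpa [getElem?_word_coef] using hk2

theorem graphAccess_graph {X A : Type} {enc : X → List A} {h : X → AlgTable p}
    (H : StackProgram.Access enc fun x => (h x).word) :
    StackProgram.GraphAccess enc fun x => (h x).graph := by
  open StackProgram in
  have hN : ∀ k, Num enc k fun x _ => (h x).size := fun k =>
    (H.countP Sum.isLeft).congr fun x _ => countP_word.symm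
  refine graphAccess_renumber hN (fun k e he => H.sym (fun a => a = .inl 3) he)
    fun k e f he hf => ?_
  exact .ex (hN _) (.and (H.sym (fun a => a = .inl 1) .last)
    (H.sym (fun a => ∃ c, a = .inr c ∧ modP p c ≠ 0) (.add (hN _)
      (.add (.mul he.weak (.mul (hN _) (hN _))) (.add (.mul hf.weak (hN _)) .last)))))

end AlgTable

/-! ## Numbering the standard generators -/

namespace HIndex

variable {n : ℕ}

/-- The smaller vertex of a pair; the vertex itself for a vertex. -/
def lo : HIndex n → ℕ := Sum.elim (fun i => i) fun e => e.1.1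

/-- The larger vertex of a pair; the vertex itself for a vertex. -/
def hi : HIndex n → ℕ := Sum.elim (fun i => i) fun e => e.1.2

theorem lo_le_hi (k : HIndex n) : lo k ≤ hi k := by
  cases k with
  | inl i => exact le_rfl
  | inr e => exact e.2.le

theorem hi_lt (k : HIndex n) : hi k < n := by
  cases k with
  | inl i => exact i.2
  | inr e => exact e.1.2.2

theorem ext {k l : HIndex n} (h₁ : lo k = lo l) (h₂ : hi k = hi l) : k = l := by
  rcases k with i | ⟨⟨i, j⟩, hij⟩ <;> rcases l with i' | ⟨⟨i', j'⟩, hij'⟩ <;>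
    simp only [lo, hi, Sum.elim_inl, Sum.elim_inr] at h₁ h₂
  · rw [Fin.ext h₁]
  · have : (i' : ℕ) < j' := hij'
    omega
  · have : (i : ℕ) < j := hij
    omega
  · obtain rfl := Fin.ext h₁
    obtain rfl := Fin.ext h₂
    rfl

theorem exists_of_le {a b : ℕ} (hab : a ≤ b) (hb : b < n) :
    ∃ k : HIndex n, lo k = a ∧ hi k = b := by
  rcases hab.lt_or_eq with h | rfl
  · exact ⟨.inr ⟨(⟨a, hab.trans_lt hb⟩, ⟨b, hb⟩), h⟩, rfl, rfl⟩
  · exact ⟨.inl ⟨a, hb⟩, rfl, rfl⟩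

/-- The number of pairs `a ≤ b < n`. -/
def tri (n : ℕ) : ℕ := ∑ t ∈ Finset.range n, (t + 1)

theorem tri_succ (n : ℕ) : tri (n + 1) = tri n + (n + 1) := Finset.sum_range_succ _ _

theorem tri_mono : Monotone tri := monotone_nat_of_le_succ fun n => by rw [tri_succ]; omega

theorem exists_eq_tri_add {x : ℕ} (hx : x < tri n) : ∃ b < n, ∃ a ≤ b, x = tri b + a := by
  induction n with
  | zero => exact absurd hx (Nat.not_lt_zero x)
  | succ n ih =>
    rcases lt_or_ge x (tri n) with h | h
    · obtain ⟨b, hb, h⟩ := ih h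
      exact ⟨b, hb.trans (Nat.lt_succ_self n), h⟩
    · rw [tri_succ] at hx
      exact ⟨n, Nat.lt_succ_self n, x - tri n, by omega, by omega⟩

theorem tri_add_lt {a b : ℕ} (hab : a ≤ b) (hb : b < n) : tri b + a < tri n := by
  have := tri_mono hb
  rw [Nat.succ_eq_add_one, tri_succ] at this
  omega

/-- The pairs `a ≤ b < n` in the order of the numbers `tri b + a`. -/
def pairs (n : ℕ) : List (ℕ × ℕ) :=
  (List.range n).flatMap fun b => (List.range (b + 1)).map fun a => (a, b)

theorem pairs_succ (n : ℕ) :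
    pairs (n + 1) = pairs n ++ (List.range (n + 1)).map fun a => (a, n) := by
  have h := List.range_succ (n := n)
  rw [pairs, h, List.flatMap_append, List.flatMap_singleton, ← h]
  rfl

theorem length_pairs (n : ℕ) : (pairs n).length = tri n := by
  induction n with
  | zero => rfl
  | succ n ih =>
    rw [pairs_succ, List.length_append, ih, tri_succ, List.length_map, List.length_range]

theorem getElem?_pairs {a b : ℕ} (hab : a ≤ b) (hb : b < n) :
    (pairs n)[tri b + a]? = some (a, b) := by
  induction n with
  | zero => exact absurd hb (Nat.not_lt_zero b)
  | succ n ih =>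
    rw [pairs_succ]
    rcases (Nat.lt_succ_iff.1 hb).lt_or_eq with h | rfl
    · rw [List.getElem?_append_left (by rw [length_pairs]; exact tri_add_lt hab h), ih h]
    · rw [List.getElem?_append_right (by rw [length_pairs]; omega), length_pairs,
        Nat.add_sub_cancel_left, List.getElem?_map, List.getElem?_range (Nat.lt_succ_of_le hab)]
      rfl

/-- The number of a standard generator. -/
def code (k : HIndex n) : Fin (tri n) := ⟨tri (hi k) + lo k, tri_add_lt (lo_le_hi k) (hi_lt k)⟩

theorem code_bijective : Function.Bijective (code (n := n)) := by
  refine ⟨fun k l h => ?_, fun x => ?_⟩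
  · have h1 := getElem?_pairs (lo_le_hi k) (hi_lt k)
    have h2 : tri (hi k) + lo k = tri (hi l) + lo l := Fin.ext_iff.1 h
    rw [h2, getElem?_pairs (lo_le_hi l) (hi_lt l), Option.some_inj, Prod.ext_iff] at h1
    exact ext h1.1.symm h1.2.symm
  · obtain ⟨b, hb, a, ha, hx⟩ := exists_eq_tri_add x.2
    obtain ⟨k, rfl, rfl⟩ := exists_of_le ha hb
    exact ⟨k, Fin.ext hx.symm⟩

/-- The standard generators, numbered. -/
noncomputable def numbering (n : ℕ) : Fin (tri n) ≃ HIndex n :=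
  (Equiv.ofBijective code code_bijective).symm

theorem map_numbering :
    (List.finRange (tri n)).map (fun x => (lo (numbering n x), hi (numbering n x))) = pairs n := by
  refine List.ext_getElem? fun x => ?_
  by_cases hx : x < tri n
  · obtain ⟨k, hk⟩ := (numbering n).symm.surjective ⟨x, hx⟩
    have h1 : (List.finRange (tri n))[x]? = some ⟨x, hx⟩ := by simp [hx]
    rw [List.getElem?_map, h1, ← hk, Option.map_some, Equiv.apply_symm_apply,
      ← getElem?_pairs (lo_le_hi k) (hi_lt k)]
    have h2 : tri (hi k) + lo k = x := Fin.ext_iff.1 hk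
    rw [h2]
  · rw [List.getElem?_eq_none (by simpa using hx), List.getElem?_eq_none]
    rw [length_pairs]
    exact not_lt.1 hx

/-- A listing in the order of the numbers becomes two nested bounded loops, so the bijection
`numbering` need not be computed by a program. -/
theorem flatMap_numbering {B : Type*} (G : ℕ → ℕ → List B) :
    (List.finRange (tri n)).flatMap (fun x => G (lo (numbering n x)) (hi (numbering n x))) =
      (List.range n).flatMap fun b => (List.range (b + 1)).flatMap fun a => G a b := by
  have h := congrArg (fun l => List.flatMap (fun q => G q.1 q.2) l) (map_numbering (n := n))
  simp only [List.flatMap_map] at h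
  rw [h, pairs, List.flatMap_assoc]
  simp only [List.flatMap_map]

end HIndex

namespace StackProgram

variable {X A B : Type} {enc : X → List A} {k : ℕ}

theorem Num.tri {e : X → Ctx k → ℕ} (he : Num enc k e) :
    Num enc k fun x c => HIndex.tri (e x c) := .sum he (.add .last (.const 1))

theorem Out.pairs {G : X → Ctx k → ℕ → ℕ → List B} {e : X → Ctx k → ℕ} (he : Num enc k e)
    (hG : Out enc B (k + 2) fun x c => G x c.1.1 c.2 c.1.2) :
    Out enc B k fun x c => (List.range (e x c)).flatMap fun b =>
      (List.range (b + 1)).flatMap fun a => G x c a b :=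
  .for he (.for (.add .last (.const 1)) hG)

end StackProgram

/-! ## Writing multiplication tables -/

namespace AlgTable

open Classical in
/-- The order of the generator with vertices `a ≤ b`. -/
noncomputable def ordOf (Γ : FinGraph) (a b : ℕ) : Fin 4 :=
  if a = b then 3 else if StackProgram.adjNat Γ a b then 1 else 2

/-- The structure constants of the standard basis. -/
def coefOf (p a b c d e f : ℕ) : ZMod (p ^ 3) :=
  if a = b ∧ c = d ∧ e < f ∧ e = a ∧ f = c then 1
  else if a = b ∧ c = d ∧ e < f ∧ e = c ∧ f = a then -1 else 0

/-- The multiplication table of the standard basis of the H-algebra of a graph. -/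
noncomputable def ofGraph (p : ℕ) (Γ : FinGraph) : AlgTable p where
  size := HIndex.tri Γ.1
  ord x := ordOf Γ (HIndex.lo (HIndex.numbering _ x)) (HIndex.hi (HIndex.numbering _ x))
  coef x y z := coefOf p (HIndex.lo (HIndex.numbering _ x)) (HIndex.hi (HIndex.numbering _ x))
    (HIndex.lo (HIndex.numbering _ y)) (HIndex.hi (HIndex.numbering _ y))
    (HIndex.lo (HIndex.numbering _ z)) (HIndex.hi (HIndex.numbering _ z))

theorem hBasis_mul_hBasis {p n : ℕ} (Γ : SimpleGraph (Fin n)) (k l : HIndex n) :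
    hBasis p Γ k * hBasis p Γ l = ∑ m : HIndex n, coefOf p (HIndex.lo k) (HIndex.hi k)
      (HIndex.lo l) (HIndex.hi l) (HIndex.lo m) (HIndex.hi m) • hBasis p Γ m := by
  have hzero : ∀ {x : HAlg p Γ}, x = 0 → (∀ m : HIndex n, coefOf p (HIndex.lo k) (HIndex.hi k)
      (HIndex.lo l) (HIndex.hi l) (HIndex.lo m) (HIndex.hi m) = 0) →
      x = ∑ m : HIndex n, coefOf p (HIndex.lo k) (HIndex.hi k)
      (HIndex.lo l) (HIndex.hi l) (HIndex.lo m) (HIndex.hi m) • hBasis p Γ m := by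
    intro x hx h
    rw [hx]
    simp only [h, zero_smul, Finset.sum_const_zero]
  rcases k with i | e
  swap
  · refine hzero (HAlg.a_mul e l) fun m => ?_
    have := Fin.lt_def.1 e.2
    rw [coefOf, if_neg, if_neg] <;> simp only [HIndex.lo, HIndex.hi, Sum.elim_inr] <;> omega
  rcases l with j | e
  swap
  · refine hzero (HAlg.mul_a e _) fun m => ?_
    have := Fin.lt_def.1 e.2
    rw [coefOf, if_neg, if_neg] <;> simp only [HIndex.lo, HIndex.hi, Sum.elim_inr] <;> omega
  rcases lt_trichotomy i j with hij | rfl | hij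
  · rw [Finset.sum_eq_single (.inr ⟨(i, j), hij⟩)]
    · rw [coefOf, if_pos ⟨rfl, rfl, hij, rfl, rfl⟩, one_smul]
      exact HAlg.v_mul_v ⟨(i, j), hij⟩
    · intro m _ hm
      rw [coefOf, if_neg, if_neg, zero_smul]
      · rintro ⟨-, -, h1, h2, h3⟩
        rw [h2, h3] at h1
        exact absurd hij (lt_asymm h1)
      · rintro ⟨-, -, h1, h2, h3⟩
        exact hm (HIndex.ext h2 h3)
    · exact fun h => absurd (Finset.mem_univ _) h
  · refine hzero (HAlg.v_mul_self i) fun m => ?_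
    rw [coefOf, if_neg, if_neg] <;> omega
  · rw [Finset.sum_eq_single (.inr ⟨(j, i), hij⟩)]
    · rw [coefOf, if_neg, if_pos ⟨rfl, rfl, hij, rfl, rfl⟩, neg_one_smul]
      · exact HAlg.v_mul_v_rev ⟨(j, i), hij⟩
      · rintro ⟨-, -, -, h2, -⟩
        exact hij.ne (Fin.ext h2)
    · intro m _ hm
      rw [coefOf, if_neg, if_neg, zero_smul]
      · rintro ⟨-, -, h1, h2, h3⟩
        exact hm (HIndex.ext h2 h3)
      · rintro ⟨-, -, h1, h2, h3⟩
        rw [h2, h3] at h1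
        exact absurd hij (lt_asymm h1)
    · exact fun h => absurd (Finset.mem_univ _) h

theorem hOrder_eq_pow_ordOf (p : ℕ) (Γ : FinGraph) (k : HIndex Γ.1) :
    hOrder p Γ.2 k = p ^ (ordOf Γ (HIndex.lo k) (HIndex.hi k) : ℕ) := by
  cases k with
  | inl i =>
    have h1 : HIndex.lo (.inl i : HIndex Γ.1) = HIndex.hi (.inl i : HIndex Γ.1) := rfl
    rw [ordOf, if_pos h1]
    rfl
  | inr e =>
    have h1 : HIndex.lo (.inr e : HIndex Γ.1) ≠ HIndex.hi (.inr e : HIndex Γ.1) := e.2.ne ∘ Fin.ext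
    have h2 : StackProgram.adjNat Γ (HIndex.lo (.inr e : HIndex Γ.1))
        (HIndex.hi (.inr e : HIndex Γ.1)) ↔ Γ.2.Adj e.1.1 e.1.2 :=
      ⟨fun ⟨_, _, h⟩ => h, fun h => ⟨e.1.1.2, e.1.2.2, h⟩⟩
    by_cases h : Γ.2.Adj e.1.1 e.1.2
    · rw [ordOf, if_neg h1, if_pos (h2.2 h), hOrder_edge h]
      exact (pow_one p).symm
    · rw [ordOf, if_neg h1, if_neg (mt h2.1 h), hOrder_nonedge h]
      rfl

theorem isTableOf_ofGraph {p : ℕ} [Fact p.Prime] (Γ : FinGraph) :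
    (ofGraph p Γ).IsTableOf Γ.2 (HIndex.numbering Γ.1) := by
  refine ⟨fun x => ?_, fun x y => ?_⟩
  · exact (HAlg.isAdditiveBasis.1 _).trans (hOrder_eq_pow_ordOf p Γ _)
  · rw [hBasis_mul_hBasis, ← (HIndex.numbering Γ.1).sum_comp]
    rfl

-- The word is brought into the form of nested loops and branches over constant letters, as `Out`
-- requires.
open Classical in
theorem word_ofGraph (p : ℕ) (Γ : FinGraph) : (ofGraph p Γ).word =
    ((List.range Γ.1).flatMap fun b => (List.range (b + 1)).flatMap fun a =>
      if a = b then [.inl 3] else if StackProgram.adjNat Γ a b then [.inl 1] else [.inl 2]) ++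
    (List.range Γ.1).flatMap fun b => (List.range (b + 1)).flatMap fun a =>
    (List.range Γ.1).flatMap fun d => (List.range (d + 1)).flatMap fun c =>
    (List.range Γ.1).flatMap fun f => (List.range (f + 1)).flatMap fun e =>
      if a = b ∧ c = d ∧ e < f ∧ e = a ∧ f = c then [.inr 1]
      else if a = b ∧ c = d ∧ e < f ∧ e = c ∧ f = a then [.inr (-1)] else [.inr 0] := by
  have h1 : ∀ a b, (if a = b then [.inl 3] else
      if StackProgram.adjNat Γ a b then [.inl 1] else [.inl 2] : List (Fin 4 ⊕ ZMod (p ^ 3))) =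
      [.inl (ordOf Γ a b)] := by
    intro a b
    rw [ordOf]
    split_ifs <;> rfl
  have h2 : ∀ a b c d e f, (if a = b ∧ c = d ∧ e < f ∧ e = a ∧ f = c then [.inr 1]
      else if a = b ∧ c = d ∧ e < f ∧ e = c ∧ f = a then [.inr (-1)] else [.inr 0] :
      List (Fin 4 ⊕ ZMod (p ^ 3))) = [.inr (coefOf p a b c d e f)] := by
    intro a b c d e f
    rw [coefOf]
    split_ifs <;> rfl
  simp only [h1, h2]
  rw [← HIndex.flatMap_numbering (n := Γ.1) fun a b => [Sum.inl (ordOf Γ a b)]]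
  simp only [← HIndex.flatMap_numbering (n := Γ.1)]
  rw [word, List.ofFn_eq_map, List.map_map, List.map_eq_flatMap]
  simp only [List.map_eq_flatMap]
  rfl

section Out

open StackProgram

variable {X A : Type} {enc : X → List A}

theorem out_word_ofGraph (p : ℕ) {Γ : X → FinGraph} (H : GraphAccess enc Γ) :
    Out enc (Fin 4 ⊕ ZMod (p ^ 3)) 0 fun x _ => (ofGraph p (Γ x)).word := by
  classical
  refine Out.congr (.append (.pairs H.order (.ite (.eq .last (.weak .last)) (.emit _)
      (.ite (H.adj .last (.weak .last)) (.emit _) (.emit _))))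
    (.pairs H.order (.pairs H.order (.pairs H.order (.ite ?_ (.emit _)
      (.ite ?_ (.emit _) (.emit _))))))) fun x _ => word_ofGraph p (Γ x)
  · exact .and (.eq (.weak (.weak (.weak (.weak .last))))
      (.weak (.weak (.weak (.weak (.weak .last))))))
      (.and (.eq (.weak (.weak .last)) (.weak (.weak (.weak .last))))
      (.and (.lt .last (.weak .last)) (.and (.eq .last (.weak (.weak (.weak (.weak .last)))))
        (.eq (.weak .last) (.weak (.weak .last))))))
  · exact .and (.eq (.weak (.weak (.weak (.weak .last))))
      (.weak (.weak (.weak (.weak (.weak .last))))))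
      (.and (.eq (.weak (.weak .last)) (.weak (.weak (.weak .last))))
      (.and (.lt .last (.weak .last)) (.and (.eq .last (.weak (.weak .last)))
        (.eq (.weak .last) (.weak (.weak (.weak (.weak .last))))))))

theorem graphCoding (p : ℕ) [Fact p.Prime] :
    GraphCoding (fun T : {T : AlgTable p // T.IsHTable} => T.1.word)
      (fun T₁ T₂ => AlgIso (ZMod (p ^ 3)) T₁.1.Alg T₂.1.Alg) (fun T => T.1.graph)
      fun Γ => ⟨ofGraph p Γ, Γ.1, Γ.2, _, isTableOf_ofGraph Γ⟩ where
  iso_iff := by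
    rintro ⟨T, n, Γ, b, h : T.IsTableOf Γ b⟩ ⟨T', n', Γ', b', h' : T'.IsTableOf Γ' b'⟩
    obtain ⟨σ⟩ := h.nonempty_iso_graph
    obtain ⟨σ'⟩ := h'.nonempty_iso_graph
    have h1 : AlgIso (ZMod (p ^ 3)) T.Alg T'.Alg ↔ Nonempty (Γ ≃g Γ') := by
      rw [← HAlg.algIso_iff (p := p)]
      exact ⟨fun h2 => h.algIso.symm.trans (h2.trans h'.algIso),
        fun h2 => h.algIso.trans (h2.trans h'.algIso.symm)⟩
    exact h1.trans ⟨fun ⟨τ⟩ => ⟨(σ.symm.trans τ).trans σ'⟩, fun ⟨τ⟩ => ⟨(σ.trans τ).trans σ'.symm⟩⟩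
  iso_mk_iff Γ Δ := by
    rw [← HAlg.algIso_iff (p := p)]
    have h := (isTableOf_ofGraph (p := p) Γ).algIso
    have h' := (isTableOf_ofGraph (p := p) Δ).algIso
    exact ⟨fun h2 => h.symm.trans (h2.trans h'), fun h2 => h.trans (h2.trans h'.symm)⟩
  read := graphAccess_graph
  write := out_word_ofGraph p

end Out

end AlgTable

/-! ## Reading presentations -/

namespace GroupPres

/-- A relator with numbers as generators, written letter by letter. -/
def natWord (v : List (ℕ × Bool)) : List PresSym :=
  (v.flatMap fun x => List.replicate x.1 .tick ++ [.letter x.2]) ++ [.endmark]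

theorem natWord_cons (x : ℕ × Bool) (v : List (ℕ × Bool)) :
    natWord (x :: v) = List.replicate x.1 .tick ++ .letter x.2 :: natWord v := by
  simp [natWord]

theorem relWord_eq {N : ℕ} (u : List (Fin N × Bool)) :
    relWord u = natWord (u.map (Prod.map Fin.val id)) := by
  rw [relWord, natWord, List.flatMap_map]
  rfl

/-- The code of relators is self-delimiting: ticks end at a letter, and letters end at the end mark.
-/
theorem natWord_append_inj {u u' : List (ℕ × Bool)} {l l' : List PresSym}
    (h : natWord u ++ l = natWord u' ++ l') : u = u' := by
  induction u generalizing u' with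
  | nil =>
    cases u' with
    | nil => rfl
    | cons x u' =>
      rw [natWord_cons, List.append_assoc] at h
      exact absurd (replicate_tick_inj (a := 0) (by simp) (by simp) h).2.1 (by simp)
  | cons y u ih =>
    rw [natWord_cons, List.append_assoc] at h
    cases u' with
    | nil => exact absurd (replicate_tick_inj (b := 0) (by simp) (by simp) h).2.1 (by simp)
    | cons x u' =>
      rw [natWord_cons, List.append_assoc] at h
      obtain ⟨h1, h2, h3⟩ := replicate_tick_inj (by simp) (by simp) h
      rw [ih h3, Prod.ext h1 (by simpa using h2)]

theorem cons_infix_append_iff {A : Type*} {a : A} {t l l' : List A} (h : a ∉ l) :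
    a :: t <:+: l ++ l' ↔ a :: t <:+: l' := by
  induction l with
  | nil => rfl
  | cons b l ih =>
    rw [List.mem_cons, not_or] at h
    rw [List.cons_append, List.infix_cons_iff, ih h.2, or_iff_right]
    exact fun h' => h.1 (List.cons_prefix_cons.1 h').1

/-- End marks occur only at boundaries of relators, so an occurrence of this pattern starts at a
boundary; since the code is self-delimiting, it is one entire relator. -/
theorem endmark_infix_iff (v : List (ℕ × Bool)) (vs : List (List (ℕ × Bool))) :
    .endmark :: natWord v <:+: .endmark :: vs.flatMap natWord ↔ v ∈ vs := by
  induction vs with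
  | nil =>
    simp only [List.flatMap_nil, List.not_mem_nil, iff_false]
    intro h
    have := h.length_le
    simp [natWord] at this
  | cons u vs ih =>
    have hu : natWord u = (u.flatMap fun x => List.replicate x.1 .tick ++ [.letter x.2]) ++
      [.endmark] := rfl
    have h1 : .endmark ∉ u.flatMap fun x => List.replicate x.1 PresSym.tick ++ [.letter x.2] := by
      simp
    rw [List.infix_cons_iff, List.mem_cons, List.flatMap_cons, List.cons_prefix_cons]
    refine or_congr ⟨fun h => ?_, ?_⟩ ?_
    · obtain ⟨l, hl⟩ := h.2
      exact natWord_append_inj hl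
    · rintro rfl
      exact ⟨rfl, List.prefix_append _ _⟩
    · rw [hu, List.append_assoc, cons_infix_append_iff h1]
      exact ih

/-- The word `v` in the numbers of the generators is a relator. -/
def HasRel (P : GroupPres) (v : List (ℕ × Bool)) : Prop :=
  v ∈ P.rels.map (List.map (Prod.map Fin.val id))

theorem word_eq (P : GroupPres) : P.word = List.replicate P.size .tick ++
    .endmark :: (P.rels.map (List.map (Prod.map Fin.val id))).flatMap natWord := by
  have h : (relWord : List (Fin P.size × Bool) → _) =
      fun u => natWord (u.map (Prod.map Fin.val id)) := funext relWord_eq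
  rw [word, List.flatMap_map, h]

theorem hasRel_iff (P : GroupPres) (v : List (ℕ × Bool)) : P.HasRel v ↔
    ∃ s < P.word.length, (∃ a ∈ P.word[s]?, a = .endmark) ∧ natWord v <+: P.word.drop (s + 1) := by
  rw [HasRel, ← endmark_infix_iff, ← cons_infix_append_iff (l := List.replicate P.size .tick)
    (by simp), ← word_eq]
  constructor
  · rintro ⟨l, l', h⟩
    refine ⟨l.length, ?_, ?_, l', ?_⟩ <;> rw [← h]
    · simp
    · simp
    · simp [List.drop_append]
  · rintro ⟨s, hs, ⟨a, ha, rfl⟩, l, hl⟩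
    refine ⟨P.word.take s, l, ?_⟩
    obtain ⟨hs', ha⟩ := List.getElem?_eq_some_iff.1 ha
    rw [List.append_assoc, List.cons_append, hl, ← ha, ← List.drop_eq_getElem_cons hs',
      List.take_append_drop]

end GroupPres

namespace StackProgram

variable {X A : Type} {enc : X → List A} {k : ℕ} {w : X → List PresSym}

theorem cons_prefix_drop_iff {B : Type*} {a : B} {t l : List B} {s : ℕ} :
    a :: t <+: l.drop s ↔ (∃ b ∈ l[s]?, b = a) ∧ t <+: l.drop (s + 1) := by
  rcases lt_or_ge s l.length with h | h
  · rw [List.drop_eq_getElem_cons h, List.cons_prefix_cons, List.getElem?_eq_getElem h]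
    simp [eq_comm]
  · rw [List.drop_eq_nil_of_le h, List.getElem?_eq_none h]
    simp

theorem replicate_append_prefix_drop_iff {B : Type*} {a : B} {t l : List B} {s e : ℕ} :
    List.replicate e a ++ t <+: l.drop s ↔
      (∀ i < e, ∃ b ∈ l[s + i]?, b = a) ∧ t <+: l.drop (s + e) := by
  induction e generalizing s with
  | zero => simp
  | succ e ih =>
    rw [List.replicate_succ, List.cons_append, cons_prefix_drop_iff, ih, Nat.forall_lt_succ_left,
      and_assoc]
    simp only [Nat.add_zero, Nat.add_comm, Nat.add_left_comm]

/-- The number of letters of `v` is fixed and only the generator numbers vary. Each letter therefore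
costs one bounded test, and the next test starts at a computable position. -/
theorem dec_natWord_prefix (H : Access enc w) (v : List ((X → Ctx k → ℕ) × Bool))
    (hv : ∀ q ∈ v, Num enc k q.1) {s : X → Ctx k → ℕ} (hs : Num enc k s) :
    Dec enc k fun x c =>
      GroupPres.natWord (v.map fun q => (q.1 x c, q.2)) <+: (w x).drop (s x c) := by
  induction v generalizing s with
  | nil =>
    refine (H.sym (fun a => a = .endmark) hs).congr fun x c => ?_
    change [PresSym.endmark] <+: _ ↔ _
    rw [cons_prefix_drop_iff, and_iff_left List.nil_prefix]
  | cons q v ih =>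
    have hq := hv q List.mem_cons_self
    refine ((Dec.all (φ := fun x c i => ∃ a ∈ (w x)[s x c + i]?, a = .tick) hq
      (H.sym (fun a => a = .tick) (.add hs.weak .last))).and
      ((H.sym (fun a => a = .letter q.2) (.add hs hq)).and
        (ih (fun q hq => hv q (List.mem_cons_of_mem _ hq)) (.add (.add hs hq) (.const 1))))).congr
      fun x c => ?_
    rw [List.map_cons, GroupPres.natWord_cons, replicate_append_prefix_drop_iff,
      cons_prefix_drop_iff]

theorem dec_hasRel {h : X → GroupPres} (H : Access enc fun x => (h x).word)
    (v : List ((X → Ctx k → ℕ) × Bool)) (hv : ∀ q ∈ v, Num enc k q.1) :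
    Dec enc k fun x c => (h x).HasRel (v.map fun q => (q.1 x c, q.2)) := by
  have h1 := dec_natWord_prefix H (v.map fun q => (fun x (c : Ctx (k + 1)) => q.1 x c.1, q.2))
    (by
      simp only [List.mem_map]
      rintro _ ⟨q, hq, rfl⟩
      exact (hv q hq).weak) (.add .last (.const 1))
  simp only [List.map_map] at h1
  exact (Dec.ex (φ := fun x c s => (∃ a ∈ (h x).word[s]?, a = .endmark) ∧
    GroupPres.natWord (v.map fun q => (q.1 x c, q.2)) <+: (h x).word.drop (s + 1)) H.len
    ((H.sym (fun a => a = .endmark) .last).and h1)).congr fun x c => GroupPres.hasRel_iff _ _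

end StackProgram

namespace GroupPres

section Relators

variable {p n : ℕ} {Γ : SimpleGraph (Fin n)}

theorem hRelator_replicate {k : HIndex n} :
    HRelator p Γ (List.replicate (hOrder p Γ k) (k, true)) := by
  cases k with
  | inl i => exact .pow_g i
  | inr e =>
    by_cases he : Γ.Adj e.1.1 e.1.2
    · rw [hOrder_edge he]
      exact .edge e he
    · rw [hOrder_nonedge he]
      exact .nonedge e he

theorem commWord_append_ne_replicate {X : Type} {x y z : X} {l : List (X × Bool)} {m : ℕ} :
    commWord x y ++ l ≠ List.replicate m (z, true) := by
  intro h
  have h1 : (x, false) ∈ List.replicate m (z, true) := by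
    rw [← h]
    simp [commWord]
  cases List.eq_of_mem_replicate h1

/-- All relators except powers contain an inverse letter, so power relators reveal the orders. The
empty word must be excluded because it does not mention `k`. -/
theorem hRelator_replicate_iff {k : HIndex n} {m : ℕ} (hm : m ≠ 0) :
    HRelator p Γ (List.replicate m (k, true)) ↔ m = hOrder p Γ k := by
  constructor
  · intro h
    have key : ∀ {l : HIndex n}, List.replicate m (k, true) =
        List.replicate (hOrder p Γ l) (l, true) → m = hOrder p Γ k := by
      intro l h
      obtain ⟨h1, h2⟩ := List.replicate_inj.1 h
      rcases h2 with h2 | h2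
      · exact absurd h2 hm
      · have h3 : k = l := (Prod.ext_iff.1 h2).1
        rw [h1, h3]
    generalize hw : List.replicate m (k, true) = w at h
    cases h with
    | comm e => exact absurd hw.symm commWord_append_ne_replicate
    | central_a e e' => exact absurd hw.symm (commWord_append_ne_replicate (l := []))
    | central_g e i => exact absurd hw.symm (commWord_append_ne_replicate (l := []))
    | pow_g i => exact key (l := .inl i) hw
    | edge e he => exact key (l := .inr e) (by rw [hOrder_edge he, hw])
    | nonedge e he => exact key (l := .inr e) (by rw [hOrder_nonedge he, hw])
  · rintro rfl
    exact hRelator_replicate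

/-- The centrality relators have only four letters and the power relators have no inverses. -/
theorem hRelator_comm_iff {k l m : HIndex n} :
    HRelator p Γ (commWord k l ++ [(m, false)]) ↔ ∃ e : {e : Fin n × Fin n // e.1 < e.2},
      k = .inl e.1.1 ∧ l = .inl e.1.2 ∧ m = .inr e := by
  constructor
  · intro h
    generalize hw : commWord k l ++ [(m, false)] = w at h
    cases h with
    | comm e =>
      have h1 : k = .inl e.1.1 ∧ l = .inl e.1.2 ∧ k = .inl e.1.1 ∧ l = .inl e.1.2 ∧ m = .inr e := by
        simpa [commWord] using hw
      exact ⟨e, h1.1, h1.2.1, h1.2.2.2.2⟩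
    | central_a e e' => simp [commWord] at hw
    | central_g e i => simp [commWord] at hw
    | pow_g i => exact absurd hw commWord_append_ne_replicate
    | edge e he => exact absurd hw commWord_append_ne_replicate
    | nonedge e he => exact absurd hw commWord_append_ne_replicate
  · rintro ⟨e, rfl, rfl, rfl⟩
    exact .comm e

end Relators

section Graph

variable {p n : ℕ} {P : GroupPres} {Γ : SimpleGraph (Fin n)} {b : Fin P.size ≃ HIndex n}

theorem IsPresOf.hasRel_iff (h : IsPresOf p P Γ b) (w : List (HIndex n × Bool)) :
    P.HasRel (w.map (Prod.map (fun k => (b.symm k : ℕ)) id)) ↔ HRelator p Γ w := by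
  rw [h, HasRel, List.mem_map]
  have hb : Prod.map b id ∘ Prod.map b.symm id = (id : HIndex n × Bool → _) := by
    rw [Prod.map_comp_map, b.self_comp_symm]
    rfl
  have h1 : w.map (Prod.map (fun k => (b.symm k : ℕ)) id) =
      (w.map (Prod.map b.symm id)).map (Prod.map Fin.val id) := by
    rw [List.map_map]
    rfl
  have hinj : Function.Injective (List.map (Prod.map (Fin.val : Fin P.size → ℕ) (id : Bool → _))) :=
    List.map_injective_iff.2 (Fin.val_injective.prodMap Function.injective_id)
  constructor
  · rintro ⟨u, hu, hw⟩
    refine ⟨u, hu, ?_⟩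
    rw [hinj (hw.trans h1), List.map_map, hb, List.map_id]
  · rintro ⟨u, hu, rfl⟩
    refine ⟨u, hu, ?_⟩
    simp [h1, Function.comp_def, Prod.map]

theorem HasRel.lt_size {v : List (ℕ × Bool)} (h : P.HasRel v) {x : ℕ × Bool} (hx : x ∈ v) :
    x.1 < P.size := by
  obtain ⟨u, -, rfl⟩ := List.mem_map.1 h
  obtain ⟨y, -, rfl⟩ := List.mem_map.1 hx
  exact y.1.2

theorem HasRel.lt_size_of_replicate {m x : ℕ} (hm : m ≠ 0)
    (h : P.HasRel (List.replicate m (x, true))) : x < P.size :=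
  h.lt_size (List.mem_replicate.2 ⟨hm, rfl⟩)

theorem size_le_length_word (P : GroupPres) : P.size ≤ P.word.length := by
  simp [word]

/-- The number `x` is that of a vertex. -/
def IsVertex (p : ℕ) (P : GroupPres) (x : ℕ) : Prop := P.HasRel (List.replicate (p ^ 3) (x, true))

/-- The commutator of the generators `x` and `y` has order `p`. -/
def IsEdge (p : ℕ) (P : GroupPres) (x y : ℕ) : Prop :=
  ∃ z < P.word.length, (P.HasRel [(x, true), (y, true), (x, false), (y, false), (z, false)] ∨
    P.HasRel [(y, true), (x, true), (y, false), (x, false), (z, false)]) ∧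
    P.HasRel (List.replicate p (z, true))

/-- The graph that is read from a presentation. -/
noncomputable def graph (p : ℕ) (P : GroupPres) : FinGraph :=
  StackProgram.renumber P.word.length (IsVertex p P) (IsEdge p P)

variable [Fact p.Prime]

omit [Fact p.Prime] in
theorem IsPresOf.hasRel_replicate (h : IsPresOf p P Γ b) (k : HIndex n) {m : ℕ} (hm : m ≠ 0) :
    P.HasRel (List.replicate m ((b.symm k : ℕ), true)) ↔ m = hOrder p Γ k := by
  rw [← hRelator_replicate_iff hm, ← h.hasRel_iff, List.map_replicate]
  rfl

/-- Both orders of two vertices are tried in `IsEdge`, since only one of their commutators is named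
by a relator. The length of the word serves as the search bound because it is readable and at least
the number of generators. -/
theorem IsPresOf.nonempty_iso_graph (h : IsPresOf p P Γ b) : Nonempty (Γ ≃g (graph p P).2) := by
  have hp : 1 < p := (Fact.out : p.Prime).one_lt
  have hp0 : p ≠ 0 := (Fact.out : p.Prime).ne_zero
  refine StackProgram.nonempty_iso_renumber (s := fun i => (b.symm (.inl i) : ℕ))
    (fun i j hij => by simpa using Fin.ext hij) (fun x _ => ?_)
    (fun i => (Fin.is_lt _).trans_le P.size_le_length_word) fun i j => ?_
  · by_cases hx : x < P.size
    swap
    · refine iff_of_false (fun h => hx (HasRel.lt_size_of_replicate (pow_ne_zero 3 hp0) h)) ?_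
      rintro ⟨i, rfl⟩
      exact hx (Fin.is_lt _)
    obtain ⟨k, hk⟩ := b.symm.surjective ⟨x, hx⟩
    obtain rfl : (b.symm k : ℕ) = x := Fin.ext_iff.1 hk
    rw [IsVertex, h.hasRel_replicate k (pow_ne_zero 3 hp0)]
    cases k with
    | inl i => exact iff_of_true rfl ⟨i, rfl⟩
    | inr e =>
      refine iff_of_false (fun h1 => ?_) ?_
      · by_cases he : Γ.Adj e.1.1 e.1.2
        · rw [hOrder_edge he] at h1
          have := Nat.pow_right_injective hp (h1.trans (pow_one p).symm)
          cases this
        · rw [hOrder_nonedge he] at h1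
          have := Nat.pow_right_injective hp h1
          cases this
      · rintro ⟨i, hi⟩
        have := b.symm.injective (Fin.ext hi)
        cases this
  · have hcomm : ∀ k l m : HIndex n, P.HasRel [((b.symm k : ℕ), true), ((b.symm l : ℕ), true),
        ((b.symm k : ℕ), false), ((b.symm l : ℕ), false), ((b.symm m : ℕ), false)] ↔
        ∃ e : {e : Fin n × Fin n // e.1 < e.2}, k = .inl e.1.1 ∧ l = .inl e.1.2 ∧ m = .inr e := by
      intro k l m
      rw [← hRelator_comm_iff (p := p) (Γ := Γ), ← h.hasRel_iff]
      rfl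
    have hedge : ∀ e : {e : Fin n × Fin n // e.1 < e.2},
        P.HasRel (List.replicate p ((b.symm (.inr e) : ℕ), true)) ↔ Γ.Adj e.1.1 e.1.2 := by
      intro e
      rw [h.hasRel_replicate _ hp0]
      by_cases he : Γ.Adj e.1.1 e.1.2
      · exact iff_of_true (hOrder_edge he).symm he
      · refine iff_of_false (fun h1 => ?_) he
        rw [hOrder_nonedge he] at h1
        have := Nat.pow_right_injective hp ((pow_one p).trans h1)
        cases this
    constructor
    · rintro ⟨z, -, h1, h2⟩
      obtain ⟨m, hm⟩ := b.symm.surjective ⟨z, h2.lt_size_of_replicate hp0⟩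
      obtain rfl : (b.symm m : ℕ) = z := Fin.ext_iff.1 hm
      rcases h1 with h1 | h1
      · obtain ⟨e, hi, hj, rfl⟩ := (hcomm _ _ _).1 h1
        rw [Sum.inl_injective hi, Sum.inl_injective hj]
        exact (hedge e).1 h2
      · obtain ⟨e, hj, hi, rfl⟩ := (hcomm _ _ _).1 h1
        rw [Sum.inl_injective hi, Sum.inl_injective hj]
        exact ((hedge e).1 h2).symm
    · intro hij
      rcases lt_or_gt_of_ne hij.ne with h' | h'
      · exact ⟨_, (b.symm (.inr ⟨(i, j), h'⟩)).2.trans_le P.size_le_length_word,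
          .inl ((hcomm _ _ _).2 ⟨_, rfl, rfl, rfl⟩),
          (hedge ⟨(i, j), h'⟩).2 hij⟩
      · exact ⟨_, (b.symm (.inr ⟨(j, i), h'⟩)).2.trans_le P.size_le_length_word,
          .inr ((hcomm _ _ _).2 ⟨_, rfl, rfl, rfl⟩),
          (hedge ⟨(j, i), h'⟩).2 hij.symm⟩

end Graph

section Access

open StackProgram

variable {X A : Type} {enc : X → List A} {h : X → GroupPres}

theorem graphAccess_graph (p : ℕ) (H : Access enc fun x => (h x).word) :
    GraphAccess enc fun x => graph p (h x) := by
  have hrep : ∀ m k (e : X → Ctx k → ℕ), Num enc k e →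
      Dec enc k fun x c => (h x).HasRel (List.replicate m (e x c, true)) := fun m k e he =>
    (dec_hasRel H (List.replicate m (e, true)) (fun q hq => by
      rw [List.eq_of_mem_replicate hq]
      exact he)).congr fun x c => by rw [List.map_replicate]
  have hcomm : ∀ k (e f g : X → Ctx k → ℕ), Num enc k e → Num enc k f → Num enc k g →
      Dec enc k fun x c => (h x).HasRel [(e x c, true), (f x c, true), (e x c, false),
        (f x c, false), (g x c, false)] := fun k e f g he hf hg =>
    dec_hasRel H [(e, true), (f, true), (e, false), (f, false), (g, false)] (by simp [he, hf, hg])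
  refine graphAccess_renumber (fun _ => H.len) (hrep _) fun k e f he hf => ?_
  exact .ex H.len (.and (.or (hcomm _ _ _ _ he.weak hf.weak .last)
    (hcomm _ _ _ _ hf.weak he.weak .last)) (hrep _ _ _ .last))

end Access

/-! ## Writing presentations -/

section Writing

variable {n : ℕ}

/-- The standard generators, listed in the order of their numbers. -/
noncomputable def gens (n : ℕ) : List (HIndex n) :=
  (List.finRange (HIndex.tri n)).map (HIndex.numbering n)

theorem mem_gens (k : HIndex n) : k ∈ gens n :=
  List.mem_map.2 ⟨(HIndex.numbering n).symm k, List.mem_finRange _, Equiv.apply_symm_apply _ _⟩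

/-- The relators that belong to one generator. -/
noncomputable def relatorsAt (p : ℕ) (Γ : SimpleGraph (Fin n)) :
    HIndex n → List (List (HIndex n × Bool))
  | .inl i => [List.replicate (p ^ 3) (.inl i, true)]
  | .inr e => [commWord (.inl e.1.1) (.inl e.1.2) ++ [(.inr e, false)],
      List.replicate (hOrder p Γ (.inr e)) (.inr e, true)] ++
      (gens n).map fun l => commWord (.inr e) l

theorem exists_mem_relatorsAt_iff {p : ℕ} {Γ : SimpleGraph (Fin n)} {w : List (HIndex n × Bool)} :
    (∃ k, w ∈ relatorsAt p Γ k) ↔ HRelator p Γ w := by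
  constructor
  · rintro ⟨i | e, h⟩
    · rw [List.mem_singleton.1 h]
      exact .pow_g i
    · rcases List.mem_append.1 h with h | h
      · rcases List.mem_pair.1 h with rfl | rfl
        · exact .comm e
        · exact hRelator_replicate
      · obtain ⟨l, -, rfl⟩ := List.mem_map.1 h
        cases l with
        | inl i => exact .central_g e i
        | inr e' => exact .central_a e e'
  · rintro (e | ⟨e, e'⟩ | ⟨e, i⟩ | i | ⟨e, h⟩ | ⟨e, h⟩)
    · exact ⟨.inr e, List.mem_append_left _ (by simp)⟩
    · exact ⟨.inr e, List.mem_append_right _ (List.mem_map_of_mem (mem_gens (.inr e')))⟩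
    · exact ⟨.inr e, List.mem_append_right _ (List.mem_map_of_mem (mem_gens (.inl i)))⟩
    · exact ⟨.inl i, List.mem_singleton_self _⟩
    · exact ⟨.inr e, List.mem_append_left _ (by simp [hOrder_edge h])⟩
    · exact ⟨.inr e, List.mem_append_left _ (by simp [hOrder_nonedge h])⟩

/-- The standard presentation of the H-group of a graph. -/
noncomputable def ofGraph (p : ℕ) (Γ : FinGraph) : GroupPres where
  size := HIndex.tri Γ.1
  rels := ((gens Γ.1).flatMap (relatorsAt p Γ.2)).map (List.map (Prod.map HIndex.code id))

theorem isPresOf_ofGraph (p : ℕ) (Γ : FinGraph) :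
    IsPresOf p (ofGraph p Γ) Γ.2 (HIndex.numbering Γ.1) := by
  have h : Prod.map (HIndex.numbering Γ.1) id ∘ Prod.map HIndex.code id =
      (id : HIndex Γ.1 × Bool → _) := by
    rw [Prod.map_comp_map]
    exact congrArg (fun f => Prod.map f id) (HIndex.numbering Γ.1).self_comp_symm
  intro w
  rw [← exists_mem_relatorsAt_iff]
  change _ ↔ ∃ u ∈ ((gens Γ.1).flatMap (relatorsAt p Γ.2)).map (List.map (Prod.map HIndex.code id)),
    w = u.map (Prod.map (HIndex.numbering Γ.1) id)
  simp only [List.mem_map, List.mem_flatMap, exists_exists_and_eq_and, List.map_map, h, List.map_id]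
  constructor
  · rintro ⟨k, hk⟩
    exact ⟨w, ⟨k, mem_gens k, hk⟩, rfl⟩
  · rintro ⟨w, ⟨k, -, hk⟩, rfl⟩
    exact ⟨k, hk⟩

open Classical in
/-- The word listing the relators that belong to the generator with vertices `a ≤ b`. -/
noncomputable def relatorsWord (p : ℕ) (Γ : FinGraph) (a b : ℕ) : List PresSym :=
  if a = b then natWord (List.replicate (p ^ 3) (HIndex.tri b + a, true)) else
    natWord [(HIndex.tri a + a, true), (HIndex.tri b + b, true), (HIndex.tri a + a, false),
      (HIndex.tri b + b, false), (HIndex.tri b + a, false)] ++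
    ((if StackProgram.adjNat Γ a b then natWord (List.replicate p (HIndex.tri b + a, true))
      else natWord (List.replicate (p ^ 2) (HIndex.tri b + a, true))) ++
    (List.range Γ.1).flatMap fun d => (List.range (d + 1)).flatMap fun c =>
      natWord [(HIndex.tri b + a, true), (HIndex.tri d + c, true), (HIndex.tri b + a, false),
        (HIndex.tri d + c, false)])

/-- The vertex `a` is the pair with both entries `a`, so its number is `HIndex.tri a + a`; this lets
relators be written by arithmetic on numbers alone. -/
theorem flatMap_relatorsAt (p : ℕ) (Γ : FinGraph) (k : HIndex Γ.1) :
    ((relatorsAt p Γ.2 k).flatMap fun w => relWord (w.map (Prod.map HIndex.code id))) =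
      relatorsWord p Γ (HIndex.lo k) (HIndex.hi k) := by
  have hrep : ∀ m (l : HIndex Γ.1),
      relWord ((List.replicate m (l, true)).map (Prod.map HIndex.code id)) =
        natWord (List.replicate m (HIndex.tri (HIndex.hi l) + HIndex.lo l, true)) := by
    intro m l
    rw [relWord_eq, List.map_replicate, List.map_replicate]
    rfl
  cases k with
  | inl i =>
    have h1 : HIndex.lo (.inl i : HIndex Γ.1) = HIndex.hi (.inl i : HIndex Γ.1) := rfl
    rw [relatorsWord, if_pos h1, relatorsAt, List.flatMap_singleton, hrep]
  | inr e =>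
    have h1 : HIndex.lo (.inr e : HIndex Γ.1) ≠ HIndex.hi (.inr e : HIndex Γ.1) := e.2.ne ∘ Fin.ext
    have h2 : StackProgram.adjNat Γ (HIndex.lo (.inr e : HIndex Γ.1))
        (HIndex.hi (.inr e : HIndex Γ.1)) ↔ Γ.2.Adj e.1.1 e.1.2 :=
      ⟨fun ⟨_, _, h⟩ => h, fun h => ⟨e.1.1.2, e.1.2.2, h⟩⟩
    rw [relatorsWord, if_neg h1, relatorsAt, List.flatMap_append, List.flatMap_cons,
      List.flatMap_singleton, hrep, List.append_assoc, gens, List.map_map, List.flatMap_map,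
      ← HIndex.flatMap_numbering]
    refine congrArg₂ _ (by rw [relWord_eq]; rfl) (congrArg₂ _ ?_ ?_)
    · by_cases h : Γ.2.Adj e.1.1 e.1.2
      · rw [if_pos (h2.2 h), hOrder_edge h]
      · rw [if_neg (mt h2.1 h), hOrder_nonedge h]
    · refine congrArg (fun f => List.flatMap f _) (funext fun x => ?_)
      rw [relWord_eq]
      rfl

theorem word_ofGraph (p : ℕ) (Γ : FinGraph) : (ofGraph p Γ).word =
    List.replicate (HIndex.tri Γ.1) .tick ++ ([.endmark] ++
      (List.range Γ.1).flatMap fun b => (List.range (b + 1)).flatMap fun a =>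
        relatorsWord p Γ a b) := by
  rw [← HIndex.flatMap_numbering]
  simp only [← flatMap_relatorsAt]
  simp only [word, ofGraph, gens, List.flatMap_map, List.flatMap_assoc]
  rfl

open StackProgram

variable {X A : Type} {enc : X → List A} {k : ℕ}

theorem out_natWord {v : List ((X → Ctx k → ℕ) × Bool)} (hv : ∀ q ∈ v, Num enc k q.1) :
    Out enc PresSym k fun x c => natWord (v.map fun q => (q.1 x c, q.2)) := by
  induction v with
  | nil => exact .emit _
  | cons q v ih =>
    refine (Out.append (.replicate (hv q List.mem_cons_self) .tick) (.append (.emit (.letter q.2))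
      (ih fun q hq => hv q (List.mem_cons_of_mem _ hq)))).congr fun x c => ?_
    rw [List.map_cons, natWord_cons]
    rfl

theorem out_natWord_replicate (m : ℕ) {e : X → Ctx k → ℕ} (he : Num enc k e) :
    Out enc PresSym k fun x c => natWord (List.replicate m (e x c, true)) :=
  (out_natWord (v := List.replicate m (e, true)) fun q hq => by
    rw [List.eq_of_mem_replicate hq]
    exact he).congr fun x c => by rw [List.map_replicate]

theorem out_relatorsWord (p : ℕ) {Γ : X → FinGraph} (H : GraphAccess enc Γ) {e f : X → Ctx k → ℕ}
    (he : Num enc k e) (hf : Num enc k f) :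
    Out enc PresSym k fun x c => relatorsWord p (Γ x) (e x c) (f x c) := by
  classical
  have hp : Num enc k fun x c => HIndex.tri (f x c) + e x c := .add (.tri hf) he
  have h1 : Out enc PresSym k fun x c => natWord [(HIndex.tri (e x c) + e x c, true),
      (HIndex.tri (f x c) + f x c, true), (HIndex.tri (e x c) + e x c, false),
      (HIndex.tri (f x c) + f x c, false), (HIndex.tri (f x c) + e x c, false)] :=
    out_natWord (v := [(fun x c => HIndex.tri (e x c) + e x c, true),
      (fun x c => HIndex.tri (f x c) + f x c, true),
      (fun x c => HIndex.tri (e x c) + e x c, false),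
      (fun x c => HIndex.tri (f x c) + f x c, false),
      (fun x c => HIndex.tri (f x c) + e x c, false)])
      (by simp [hp, he.tri.add he, hf.tri.add hf])
  have hcd : StackProgram.Num enc (k + 2) fun x c => HIndex.tri c.1.2 + c.2 :=
    .add (.tri (.weak .last)) .last
  have h2 : Out enc PresSym (k + 2) fun x c => natWord
      [(HIndex.tri (f x c.1.1) + e x c.1.1, true), (HIndex.tri c.1.2 + c.2, true),
      (HIndex.tri (f x c.1.1) + e x c.1.1, false), (HIndex.tri c.1.2 + c.2, false)] :=
    out_natWord (v := [(fun x (c : Ctx (k + 2)) => HIndex.tri (f x c.1.1) + e x c.1.1, true),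
      (fun x (c : Ctx (k + 2)) => HIndex.tri c.1.2 + c.2, true),
      (fun x (c : Ctx (k + 2)) => HIndex.tri (f x c.1.1) + e x c.1.1, false),
      (fun x (c : Ctx (k + 2)) => HIndex.tri c.1.2 + c.2, false)])
      (by simp [hp.weak.weak, hcd])
  exact .ite (.eq he hf) (out_natWord_replicate _ hp) (.append h1 (.append (.ite (H.adj he hf)
    (out_natWord_replicate _ hp) (out_natWord_replicate _ hp)) (.pairs H.order h2)))

theorem out_word_ofGraph (p : ℕ) {Γ : X → FinGraph} (H : GraphAccess enc Γ) :
    Out enc PresSym 0 fun x _ => (ofGraph p (Γ x)).word :=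
  (Out.append (.replicate (.tri H.order) .tick) (.append (.emit .endmark)
    (.pairs H.order (out_relatorsWord p H .last (.weak .last))))).congr fun _ _ => word_ofGraph _ _

theorem graphCoding (p : ℕ) [Fact p.Prime] :
    GraphCoding (fun P : {P : GroupPres // P.IsHPres p} => P.1.word)
      (fun P₁ P₂ => Nonempty (P₁.1.Grp ≃* P₂.1.Grp)) (fun P => graph p P.1)
      fun Γ => ⟨ofGraph p Γ, Γ.1, Γ.2, _, isPresOf_ofGraph p Γ⟩ where
  iso_iff := by
    rintro ⟨P, n, Γ, b, h : IsPresOf p P Γ b⟩ ⟨P', n', Γ', b', h' : IsPresOf p P' Γ' b'⟩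
    obtain ⟨σ⟩ := h.nonempty_iso_graph
    obtain ⟨σ'⟩ := h'.nonempty_iso_graph
    obtain ⟨f⟩ := h.nonempty_mulEquiv
    obtain ⟨f'⟩ := h'.nonempty_mulEquiv
    have h1 : Nonempty (P.Grp ≃* P'.Grp) ↔ Nonempty (Γ ≃g Γ') := by
      rw [← HGroup.nonempty_mulEquiv_iff (p := p)]
      exact ⟨fun ⟨g⟩ => ⟨(f.symm.trans g).trans f'⟩, fun ⟨g⟩ => ⟨(f.trans g).trans f'.symm⟩⟩
    exact h1.trans ⟨fun ⟨τ⟩ => ⟨(σ.symm.trans τ).trans σ'⟩, fun ⟨τ⟩ => ⟨(σ.trans τ).trans σ'.symm⟩⟩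
  iso_mk_iff Γ Δ := by
    rw [← HGroup.nonempty_mulEquiv_iff (p := p)]
    obtain ⟨f⟩ := (isPresOf_ofGraph p Γ).nonempty_mulEquiv
    obtain ⟨f'⟩ := (isPresOf_ofGraph p Δ).nonempty_mulEquiv
    exact ⟨fun ⟨g⟩ => ⟨(f.symm.trans g).trans f'⟩, fun ⟨g⟩ => ⟨(f.trans g).trans f'.symm⟩⟩
  read := graphAccess_graph p
  write := out_word_ofGraph p

end Writing

end GroupPres

/-! ### Assembly of the reductions, correctness statements and size bounds -/

theorem mainTheorem3 (p : ℕ) [Fact p.Prime] (hp : p ≠ 2) :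
    -- the chain of reductions, and the pairwise equivalences
    (GI ≤ᴾₜ HAI p ∧ HAI p ≤ᴾₜ HGI p ∧ HGI p ≤ᴾₜ GI) ∧
    (PolyTimeTuringEquiv GI (HAI p) ∧ PolyTimeTuringEquiv (HAI p) (HGI p) ∧
      PolyTimeTuringEquiv (HGI p) GI) ∧
    -- from graphs to algebras: correctness, and a basis of size `O(n ^ 2)`
    (∀ (n₁ n₂ : ℕ) (Γ₁ : SimpleGraph (Fin n₁)) (Γ₂ : SimpleGraph (Fin n₂)),
      Nonempty (Γ₁ ≃g Γ₂) ↔ AlgIso (ZMod (p ^ 3)) (HAlg p Γ₁) (HAlg p Γ₂)) ∧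
    (∀ (n : ℕ) (Γ : SimpleGraph (Fin n)),
      IsAdditiveBasis (hBasis p Γ) (hOrder p Γ) ∧ Fintype.card (HIndex n) ≤ n ^ 2) ∧
    -- from algebras to groups: correctness, and a presentation of polynomial size of a finite group
    (∀ (n₁ n₂ : ℕ) (Γ₁ : SimpleGraph (Fin n₁)) (Γ₂ : SimpleGraph (Fin n₂)),
      AlgIso (ZMod (p ^ 3)) (HAlg p Γ₁) (HAlg p Γ₂) ↔ Nonempty (HGroup p Γ₁ ≃* HGroup p Γ₂)) ∧
    (∀ (n : ℕ) (Γ : SimpleGraph (Fin n)),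
      Finite (HGroup p Γ) ∧ {w | HRelator p Γ w}.Finite ∧
        {w | HRelator p Γ w}.ncard ≤ 3 * n ^ 4 ∧ ∀ w, HRelator p Γ w → w.length ≤ p ^ 3) ∧
    -- from groups to multigraphs: correctness, and size `O(m ^ 3)` for a group of order `m`
    (∀ (G H : Type u) [Group G] [Group H] [Finite G] [Finite H],
      Nonempty (G ≃* H) ↔ (groupMultigraph G).Iso (groupMultigraph H)) ∧
    (∀ (G : Type u) [Group G] [Fintype G],
      Fintype.card (G ⊕ G × G × G) ≤ 2 * Fintype.card G ^ 3 ∧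
        ∑ x, ∑ y, (groupMultigraph G).mult x y ≤ 4 * Fintype.card G ^ 3) := by
  have hGA : GI ≤ᴾₜ HAI p := StackProgram.graphCoding_word.reducible (AlgTable.graphCoding p) _ _
  have hAG : HAI p ≤ᴾₜ GI := (AlgTable.graphCoding p).reducible StackProgram.graphCoding_word _ _
  have hAH : HAI p ≤ᴾₜ HGI p :=
    (AlgTable.graphCoding p).reducible (GroupPres.graphCoding p) _ _
  have hHA : HGI p ≤ᴾₜ HAI p :=
    (GroupPres.graphCoding p).reducible (AlgTable.graphCoding p) _ _
  have hHG : HGI p ≤ᴾₜ GI := (GroupPres.graphCoding p).reducible StackProgram.graphCoding_word _ _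
  have hGH : GI ≤ᴾₜ HGI p := StackProgram.graphCoding_word.reducible (GroupPres.graphCoding p) _ _
  exact ⟨⟨hGA, hAH, hHG⟩, ⟨⟨hGA, hAG⟩, ⟨hAH, hHA⟩, hHG, hGH⟩,
    fun _ _ _ _ => HAlg.algIso_iff.symm,
    fun n _ => ⟨HAlg.isAdditiveBasis, card_hIndex_le n⟩,
    fun _ _ _ _ => HAlg.algIso_iff.trans HGroup.nonempty_mulEquiv_iff.symm,
    fun _ _ => ⟨HGroup.finite, finite_setOf_hRelator, ncard_setOf_hRelator_le,
      fun _ h => h.length_le⟩,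
    fun _ _ _ _ _ _ => nonempty_mulEquiv_iff_groupMultigraph_iso,
    fun _ _ _ => ⟨card_groupMultigraph_le, sum_mult_groupMultigraph_le⟩⟩
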